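/- Let $R(x)=(1+|x|^2)^{1/2}$ for $x\in\mathbb R^3$, let $q>7+\sqrt{33}$ and $p=4-\frac8q$. For $\sigma:\mathbb R^3\to\mathbb R$ and $r>0$ put $\|\sigma\|_r=\sup_x|\sigma(x)|R(x)^r$; for a $C^1$ function $g$ on $\mathbb R^3\times\mathbb R^3$ put $$\|g\|_q=\sup_{x,v}|g(x,v)|\,(1+|x|^2+|v|^q),\qquad |||g|||=\|g\|_q+\|\nabla_{x,v}\,g\|_q+\Big\|\int g\,dv\Big\|_p ,$$ where $\|\nabla_{x,v}\,g\|_q$ is defined by the same formula with $|\nabla_{x,v}\,g|$ in place of $|g|$. Assume: (I) $F:\mathbb R^3\to[0,\infty)$ is $C^2$ and radial, $F(v)=F_R(|v|)$, with $F_R''(0)<0$, and there is $W\in(0,\infty)$ with $F_R'(u)<0$ for $u\in(0,W)$ and $F_R(u)=0$ for $u\ge W$. (II) $f_0:\mathbb R^3\times\mathbb R^3\to[0,\infty)$ is $C^1$ with compact $v$-support (uniformly in $x$), and there is $N>0$ with $f_0(x,v)=F(v)$ whenever $|x|>N$. (No spherical symmetry is assumed.) (IV) $A:[0,\infty)\times\mathbb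 R^3\to\mathbb R^3$ is $C^1$ and, for some $C>0$ and all $t\ge0$, $x\in\mathbb R^3$: $|A(t,x)|\le CR(x)^{-2}$, $|\partial_xA(t,x)|\le CR(x)^{-3}$ and $\nabla_x\cdot A(t,x)=0$. Then for every $t\ge0$ and $M\ge0$ there is a finite constant $C_{p,t}(M)$, depending only on $q$, $F$, $f_0$, $A$, $t$ and $M$, with the following property. Let $T>0$ and let $f:[0,T)\times\mathbb R^3\times\mathbb R^3\to[0,\infty)$ be a $C^1$ solution of $$\partial_tf+v\cdot\nabla_xf-(E+A)\cdot\nabla_vf=0,\quad \rho(t,x)=\int(F(v)-f(t,x,v))\,dv,\quad E(t,x)=\int\rho(t,y)\frac{x-y}{|x-y|^3}\,dy,\quad f(0,\cdot,\cdot)=f_0,$$ with $|||(F-f)(t)|||<\infty$ for every $t\in[0,T)$. Then for every $t\in[0,T)$ and every finite $M$ with $\sup_{\tau\in[0,t]}\|\rho(\tau)\|_p\le M$, $$\|\rho(t)\|_6=\sup_x|\rho(t,x)|\,(1+|x|^2)^3\le C_{p,t}(M).$$ -/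

import Mathlib

open MeasureTheory Set
open scoped NNReal ENNReal

/-- Three-dimensional Euclidean space, used both for positions and for velocities. -/
abbrev Space3 : Type := EuclideanSpace ℝ (Fin 3)

noncomputable section

namespace VlasovPoisson

/-- The weight `R(x) = (1 + |x|²)^(1/2)`. -/
def R (x : Space3) : ℝ := Real.sqrt (1 + ‖x‖ ^ 2)

/-- The exponent `p = 4 - 8 / q`. -/
def pOf (q : ℝ) : ℝ := 4 - 8 / q

/-- The weighted sup norm `‖σ‖_r = sup_x |σ(x)| R(x)^r` (possibly infinite). -/
def spaceNorm (r : ℝ) (σ : Space3 → ℝ) : ℝ≥0∞ :=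
  ⨆ x : Space3, ENNReal.ofReal (|σ x| * R x ^ r)

/-- The weighted sup norm `‖g‖_q = sup_{x,v} |g(x,v)| (1 + |x|² + |v|^q)` (possibly infinite). -/
def phaseNorm (q : ℝ) (g : Space3 → Space3 → ℝ) : ℝ≥0∞ :=
  ⨆ (x : Space3) (v : Space3), ENNReal.ofReal (|g x v| * (1 + ‖x‖ ^ 2 + ‖v‖ ^ q))

/-- The Euclidean length of the full gradient `(∇ₓ g, ∇ᵥ g)` at `(x, v)`. -/
def gradLength (g : Space3 → Space3 → ℝ) (x v : Space3) : ℝ :=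
  Real.sqrt (‖gradient (fun y => g y v) x‖ ^ 2 + ‖gradient (fun w => g x w) v‖ ^ 2)

/-- The norm `|||g||| = ‖g‖_q + ‖∇g‖_q + ‖∫ g dv‖_p` with `p = 4 - 8 / q`. -/
def tripleNorm (q : ℝ) (g : Space3 → Space3 → ℝ) : ℝ≥0∞ :=
  phaseNorm q g + phaseNorm q (gradLength g) + spaceNorm (pOf q) (fun x => ∫ v, g x v)

/-- The divergence of a vector field on three-dimensional space. -/
def divergence (B : Space3 → Space3) (x : Space3) : ℝ :=
  ∑ i : Fin 3, (fderiv ℝ B x (EuclideanSpace.single i 1)) i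

/-- The charge density `ρ(t,x) = ∫ (F(v) - f(t,x,v)) dv`. -/
def rho (F : Space3 → ℝ) (f : ℝ → Space3 → Space3 → ℝ) (t : ℝ) (x : Space3) : ℝ :=
  ∫ v, (F v - f t x v)

/-- The electric field `E(x) = ∫ σ(y) (x - y) / |x - y|³ dy` of a charge density `σ`. -/
def field (σ : Space3 → ℝ) (x : Space3) : Space3 :=
  ∫ y, (σ y / ‖x - y‖ ^ 3) • (x - y)

/-- The conditions on the background: `F(v) = F_R(|v|)` is nonnegative and `C²`, `F_R''(0) < 0`,
and `F_R' < 0` on `(0,W)`, `F_R = 0` on `[W,∞)` for some `W > 0`. The profile `F_R` lives on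
`[0,∞)`, so its derivatives are taken within that half-line. -/
def BackgroundCondition (F : Space3 → ℝ) : Prop :=
  (∀ v, 0 ≤ F v) ∧ ContDiff ℝ 2 F ∧
  ∃ FR : ℝ → ℝ, (∀ v, F v = FR ‖v‖) ∧
    iteratedDerivWithin 2 FR (Ici 0) 0 < 0 ∧
    ∃ W : ℝ, 0 < W ∧ (∀ u ∈ Ioo 0 W, derivWithin FR (Ici 0) u < 0) ∧ ∀ u, W ≤ u → FR u = 0

/-- The conditions on the initial datum: `f₀` is `C¹`, nonnegative, has compact velocity support,
and equals `F(v)` for large `|x|`. No symmetry is required. -/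
def InitialCondition (F : Space3 → ℝ) (f₀ : Space3 → Space3 → ℝ) : Prop :=
  ContDiff ℝ 1 (fun z : Space3 × Space3 => f₀ z.1 z.2) ∧
  (∀ x v, 0 ≤ f₀ x v) ∧
  (∃ K : Set Space3, IsCompact K ∧ ∀ x, ∀ v ∉ K, f₀ x v = 0) ∧
  ∃ N : ℝ, 0 < N ∧ ∀ x v, N < ‖x‖ → f₀ x v = F v

/-- The conditions on the external field for times `t ≥ 0`: `A` is `C¹`, `|A| ≤ C R⁻²`,
`|∂ₓA| ≤ C R⁻³` and `div A = 0`. -/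
def ExternalFieldCondition (A : ℝ → Space3 → Space3) : Prop :=
  ContDiffOn ℝ 1 (fun z : ℝ × Space3 => A z.1 z.2) (Ici 0 ×ˢ univ) ∧
  (∃ C : ℝ, 0 < C ∧ ∀ t, 0 ≤ t → ∀ x,
    ‖A t x‖ ≤ C * R x ^ (-2 : ℝ) ∧ ‖fderiv ℝ (A t) x‖ ≤ C * R x ^ (-3 : ℝ)) ∧
  ∀ t, 0 ≤ t → ∀ x, divergence (A t) x = 0

/-- `f` is a `C¹` solution on `[0,T) × ℝ³ × ℝ³` of the Vlasov-Poisson system with background `F`,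
external field `A` and initial datum `f₀`. The integrals defining `ρ` and `E` converge; the time
derivative at `t = 0` is one-sided. -/
structure IsSolution (F : Space3 → ℝ) (f₀ : Space3 → Space3 → ℝ) (A : ℝ → Space3 → Space3)
    (T : ℝ) (f : ℝ → Space3 → Space3 → ℝ) : Prop where
  contDiffOn : ContDiffOn ℝ 1 (fun z : ℝ × Space3 × Space3 => f z.1 z.2.1 z.2.2)
    (Ico 0 T ×ˢ univ)
  nonneg : ∀ t ∈ Ico 0 T, ∀ x v, 0 ≤ f t x v
  integrable_velocity : ∀ t ∈ Ico 0 T, ∀ x, Integrable (fun v => F v - f t x v)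
  integrable_field : ∀ t ∈ Ico 0 T, ∀ x,
    Integrable (fun y => (rho F f t y / ‖x - y‖ ^ 3) • (x - y))
  vlasov : ∀ t ∈ Ico 0 T, ∀ x v,
    derivWithin (fun s => f s x v) (Ico 0 T) t
      + inner ℝ v (gradient (fun y => f t y v) x)
      - inner ℝ (field (rho F f t) x + A t x) (gradient (fun w => f t x w) v) = 0
  initial : ∀ x v, f 0 x v = f₀ x v

end VlasovPoisson

end

/-!
Far from the origin the initial datum equals `F(v)`, and `f` is constant along characteristics, so
`ρ(s, x) = ∫ (F(v) - F(G v)) dv`, where `G v` is the velocity at time `0` of the characteristic that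
passes through `(x, v)` at time `s`. If the force is `O(R⁻³)`-Lipschitz in space, then `G` is the
identity plus an `O(k)`-Lipschitz map with `k = R(x)⁻³`, and the change of variables
`w = G v` bounds `|ρ(s, x)|` by a multiple of `sup |det DG - 1|`. Up to `O(k²) = O(R(x)⁻⁶)` this
determinant minus one is the trace of `DG - 1`, that is, a time integral of the divergence of the
force along the characteristic. Since `div E = 4πρ` and `div A = 0`, this gives the Volterra
inequality
`|ρ(s, x)| ≤ C R(x)⁻⁶ + C ∫₀ˢ sup {|ρ(τ, y)| : |y - x| ≤ R(x) / 16} dτ`.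
Grönwall's argument closes it in the weight `R⁻⁶ + ε R⁻ᵖ`, in which the a priori bound makes `ρ`
finite, and `ε → 0` leaves `R⁻⁶`.

The `R⁻³` Lipschitz bound on `E` needs `ρ` to be Lipschitz. A bounded density makes the force
bounded, which confines the velocity support, and log-Lipschitz, which by a logarithmic Grönwall
argument makes `f`, and hence `ρ`, Lipschitz up to a small additive error; the constant in this
bound improves itself by halving, and is thus independent of the solution.
-/

noncomputable section

namespace VlasovPoisson

open Metric Filter Topology

section Weight

lemma R_sq (x : Space3) : R x ^ 2 = 1 + ‖x‖ ^ 2 := Real.sq_sqrt (by positivity)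

lemma one_le_R (x : Space3) : 1 ≤ R x :=
  Real.one_le_sqrt.2 (le_add_of_nonneg_right (sq_nonneg ‖x‖))

lemma R_pos (x : Space3) : 0 < R x := zero_lt_one.trans_le (one_le_R x)

lemma R_rpow_pos (x : Space3) (r : ℝ) : 0 < R x ^ r := Real.rpow_pos_of_pos (R_pos x) r

lemma norm_le_R (x : Space3) : ‖x‖ ≤ R x := Real.le_sqrt_of_sq_le (by linarith)

lemma R_le_one_add_norm (x : Space3) : R x ≤ 1 + ‖x‖ :=
  Real.sqrt_le_iff.2 ⟨by positivity, by nlinarith [norm_nonneg x]⟩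

lemma R_le_R_add_norm_sub (x y : Space3) : R x ≤ R y + ‖x - y‖ := by
  have htri : ‖x‖ ≤ ‖y‖ + ‖x - y‖ := norm_le_norm_add_norm_sub' x y
  refine Real.sqrt_le_iff.2 ⟨add_nonneg (R_pos y).le (norm_nonneg _), ?_⟩
  nlinarith [R_sq y, norm_nonneg (x - y), mul_self_le_mul_self (norm_nonneg x) htri,
    mul_le_mul_of_nonneg_right (norm_le_R y) (norm_nonneg (x - y))]

lemma half_R_le_R {x y : Space3} (h : ‖x - y‖ ≤ R x / 2) : R x / 2 ≤ R y := by
  linarith [R_le_R_add_norm_sub x y]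

lemma R_rpow_neg_le_one (x : Space3) {r : ℝ} (hr : 0 ≤ r) : R x ^ (-r) ≤ 1 :=
  Real.rpow_le_one_of_one_le_of_nonpos (one_le_R x) (neg_nonpos.2 hr)

lemma R_rpow_neg_le_of_norm_sub_le {r : ℝ} (hr : 0 ≤ r) {x y : Space3}
    (h : ‖x - y‖ ≤ R x / 2) : R y ^ (-r) ≤ 2 ^ r * R x ^ (-r) := by
  calc R y ^ (-r) ≤ (R x / 2) ^ (-r) :=
        Real.rpow_le_rpow_of_nonpos (half_pos (R_pos x)) (half_R_le_R h) (neg_nonpos.2 hr)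
    _ = 2 ^ r * R x ^ (-r) := by
        rw [Real.div_rpow (R_pos x).le zero_le_two, Real.rpow_neg zero_le_two]
        field_simp

lemma integrable_R_rpow_neg {p : ℝ} (hp : 3 < p) : Integrable (fun y : Space3 => R y ^ (-p)) := by
  have h := integrable_rpow_neg_one_add_norm_sq (E := Space3) (μ := volume) (r := p)
    (by simpa using hp)
  refine h.congr (.of_forall fun y => ?_)
  simp only [R]
  rw [Real.sqrt_eq_rpow, ← Real.rpow_mul (by positivity)]
  congr 1
  ring

/-- The mass of the weight `R ^ (-p)`, which bounds the total charge of a density dominated by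
that weight. -/
def weightMass (p : ℝ) : ℝ := ∫ y : Space3, R y ^ (-p)

lemma weightMass_nonneg (p : ℝ) : 0 ≤ weightMass p :=
  integral_nonneg fun y => (R_rpow_pos y _).le

end Weight

section RadialIntegrals

lemma setIntegral_ball_fun_norm {E : Type*} [NormedAddCommGroup E] [NormedSpace ℝ E]
    [FiniteDimensional ℝ E] [Nontrivial E] [MeasurableSpace E] [BorelSpace E] (μ : Measure E)
    [μ.IsAddHaarMeasure] (φ : ℝ → ℝ) (r : ℝ) :
    ∫ z in ball (0 : E) r, φ ‖z‖ ∂μ = Module.finrank ℝ E * μ.real (ball 0 1) *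
      ∫ y in Ioo 0 r, y ^ (Module.finrank ℝ E - 1) * φ y := by
  have hball : ∫ z in ball (0 : E) r, φ ‖z‖ ∂μ = ∫ z : E, (Iio r).indicator φ ‖z‖ ∂μ := by
    rw [← integral_indicator measurableSet_ball]
    congr 1 with z
    simp [indicator]
  have hIoo : ∫ y in Ioi (0 : ℝ), y ^ (Module.finrank ℝ E - 1) • (Iio r).indicator φ y
      = ∫ y in Ioo 0 r, y ^ (Module.finrank ℝ E - 1) * φ y := by
    rw [← Ioi_inter_Iio, ← setIntegral_indicator measurableSet_Iio]
    congr 1 with y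
    by_cases hy : y < r <;> simp [indicator, hy]
  rw [hball, integral_fun_norm_addHaar μ, hIoo, nsmul_eq_mul, smul_eq_mul, mul_assoc]

/-- The volume of the unit ball of `ℝ³`; the area of the unit sphere, written `4π` in the paper,
appears as `3 * ballVol`. -/
def ballVol : ℝ := volume.real (ball (0 : Space3) 1)

lemma ballVol_nonneg : 0 ≤ ballVol := measureReal_nonneg

lemma setIntegral_ball_fun_norm_space3 (φ : ℝ → ℝ) (r : ℝ) :
    ∫ z in ball (0 : Space3) r, φ ‖z‖ = 3 * ballVol * ∫ y in Ioo 0 r, y ^ 2 * φ y := by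
  simpa [ballVol] using setIntegral_ball_fun_norm (volume : Measure Space3) φ r

lemma integrableOn_ball_inv_norm_sq (r : ℝ) :
    IntegrableOn (fun z : Space3 => (‖z‖ ^ 2)⁻¹) (ball 0 r) := by
  refine (integrableOn_fun_norm_addHaar (volume : Measure Space3)
    (f := fun y : ℝ => (y ^ 2)⁻¹)).2 ?_
  have hone : IntegrableOn (fun _ : ℝ => (1 : ℝ)) (Ioo 0 r) := by simp
  refine hone.congr_fun (fun y hy => ?_) measurableSet_Ioo
  have : y ≠ 0 := hy.1.ne'
  simp
  field_simp

lemma setIntegral_ball_inv_norm_sq {r : ℝ} (hr : 0 ≤ r) :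
    ∫ z in ball (0 : Space3) r, (‖z‖ ^ 2)⁻¹ = 3 * ballVol * r := by
  rw [setIntegral_ball_fun_norm_space3 (fun y => (y ^ 2)⁻¹) r]
  congr 1
  rw [setIntegral_congr_fun (g := fun _ => (1 : ℝ)) measurableSet_Ioo]
  · simp [hr]
  · intro y hy
    exact mul_inv_cancel₀ (pow_ne_zero 2 hy.1.ne')

lemma continuous_inv_max_cube {d : ℝ} (hd : 0 < d) : Continuous fun y : ℝ => (max y d ^ 3)⁻¹ :=
  Continuous.inv₀ (by fun_prop) fun _ => pow_ne_zero 3 (lt_max_of_lt_right hd).ne'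

lemma integrableOn_ball_inv_max_norm_cube {d : ℝ} (hd : 0 < d) (r : ℝ) :
    IntegrableOn (fun z : Space3 => (max ‖z‖ d ^ 3)⁻¹) (ball 0 r) :=
  (((continuous_inv_max_cube hd).comp continuous_norm).continuousOn.integrableOn_compact
    (isCompact_closedBall 0 r)).mono_set ball_subset_closedBall

lemma setIntegral_ball_inv_max_norm_cube {d r : ℝ} (hd : 0 < d) (hr : d ≤ r) :
    ∫ z in ball (0 : Space3) r, (max ‖z‖ d ^ 3)⁻¹ = ballVol * (1 + 3 * Real.log (r / d)) := by
  have hcont : Continuous fun y : ℝ => y ^ 2 * (max y d ^ 3)⁻¹ :=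
    (continuous_pow 2).mul (continuous_inv_max_cube hd)
  have hinner : ∫ y in (0 : ℝ)..d, y ^ 2 * (max y d ^ 3)⁻¹ = 1 / 3 := by
    have hcongr : ∫ y in (0 : ℝ)..d, y ^ 2 * (max y d ^ 3)⁻¹
        = ∫ y in (0 : ℝ)..d, y ^ 2 * (d ^ 3)⁻¹ := by
      refine intervalIntegral.integral_congr fun y hy => ?_
      rw [uIcc_of_le hd.le] at hy
      simp only [max_eq_right hy.2]
    rw [hcongr, intervalIntegral.integral_mul_const, integral_pow]
    field_simp
    norm_num [mul_comm]
  have houter : ∫ y in d..r, y ^ 2 * (max y d ^ 3)⁻¹ = Real.log (r / d) := by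
    rw [← integral_inv_of_pos hd (hd.trans_le hr)]
    refine intervalIntegral.integral_congr fun y hy => ?_
    rw [uIcc_of_le hr] at hy
    have : 0 < y := hd.trans_le hy.1
    simp only [max_eq_left hy.1]
    field_simp
  rw [setIntegral_ball_fun_norm_space3 (fun y => (max y d ^ 3)⁻¹) r, ← integral_Ioc_eq_integral_Ioo,
    ← intervalIntegral.integral_of_le (hd.le.trans hr),
    ← intervalIntegral.integral_add_adjacent_intervals (hcont.intervalIntegrable 0 d)
      (hcont.intervalIntegrable d r), hinner, houter]
  ring

end RadialIntegrals

section WeightedConvolution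

variable {p : ℝ} {x : Space3} {κ : Space3 → ℝ} {B : ℝ}

lemma R_rpow_neg_mul_kernel_le (hp : 0 ≤ p) (hκ : ∀ z, 0 ≤ κ z) (hB : 0 ≤ B)
    (hfar : ∀ z, R x / 2 ≤ ‖z‖ → κ z ≤ B) (y : Space3) :
    R y ^ (-p) * κ (x - y) ≤
      B * R y ^ (-p) + 2 ^ p * R x ^ (-p) * (ball 0 (R x / 2)).indicator κ (x - y) := by
  have hRy := (R_rpow_pos y (-p)).le
  by_cases hy : ‖x - y‖ < R x / 2
  · rw [indicator_of_mem (mem_ball_zero_iff.2 hy)]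
    have hnear := mul_le_mul_of_nonneg_right (R_rpow_neg_le_of_norm_sub_le hp hy.le) (hκ (x - y))
    linarith [mul_nonneg hB hRy]
  · rw [indicator_of_notMem (mt mem_ball_zero_iff.1 hy)]
    linarith [mul_le_mul_of_nonneg_left (hfar _ (not_lt.1 hy)) hRy]

lemma integrable_R_rpow_neg_mul_kernel (hp : 3 < p) (hκ : ∀ z, 0 ≤ κ z) (hκm : Measurable κ)
    (hB : 0 ≤ B) (hfar : ∀ z, R x / 2 ≤ ‖z‖ → κ z ≤ B)
    (hnear : IntegrableOn κ (ball 0 (R x / 2))) :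
    Integrable (fun y => R y ^ (-p) * κ (x - y)) := by
  refine (((integrable_R_rpow_neg hp).const_mul B).add
    (((hnear.integrable_indicator measurableSet_ball).comp_sub_left x).const_mul
      (2 ^ p * R x ^ (-p)))).mono' ?_ (.of_forall fun y => ?_)
  · exact (integrable_R_rpow_neg hp).aestronglyMeasurable.mul
      (hκm.comp (measurable_const.sub measurable_id)).aestronglyMeasurable
  · rw [Real.norm_of_nonneg (mul_nonneg (R_rpow_pos y _).le (hκ _))]
    exact R_rpow_neg_mul_kernel_le (by linarith) hκ hB hfar y

lemma integral_R_rpow_neg_mul_kernel_le (hp : 3 < p) (hκ : ∀ z, 0 ≤ κ z) (hκm : Measurable κ)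
    (hB : 0 ≤ B) (hfar : ∀ z, R x / 2 ≤ ‖z‖ → κ z ≤ B)
    (hnear : IntegrableOn κ (ball 0 (R x / 2))) :
    ∫ y, R y ^ (-p) * κ (x - y) ≤
      B * weightMass p + 2 ^ p * R x ^ (-p) * ∫ z in ball 0 (R x / 2), κ z := by
  have hfar_int := (integrable_R_rpow_neg hp).const_mul B
  have hnear_int := ((hnear.integrable_indicator measurableSet_ball).comp_sub_left x).const_mul
    (2 ^ p * R x ^ (-p))
  calc ∫ y, R y ^ (-p) * κ (x - y)
      ≤ ∫ y, (B * R y ^ (-p) +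
          2 ^ p * R x ^ (-p) * (ball 0 (R x / 2)).indicator κ (x - y)) :=
        integral_mono (integrable_R_rpow_neg_mul_kernel hp hκ hκm hB hfar hnear)
          (hfar_int.add hnear_int) (R_rpow_neg_mul_kernel_le (by linarith) hκ hB hfar)
    _ = _ := by
        rw [integral_add hfar_int hnear_int, integral_const_mul, integral_const_mul,
          integral_sub_left_eq_self (fun z => (ball 0 (R x / 2)).indicator κ z) volume x,
          integral_indicator measurableSet_ball, weightMass]

end WeightedConvolution

section CoulombKernel

/-- The Coulomb kernel `z / |z|³` truncated at distance `d`; the case `d = 0` is the Coulomb kernel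
itself, with value `0` at the origin. -/
def truncKernel (d : ℝ) (z : Space3) : Space3 := (max ‖z‖ d ^ 3)⁻¹ • z

/-- The field generated by the charge density `σ` through the truncated Coulomb kernel. -/
def truncField (d : ℝ) (σ : Space3 → ℝ) (x : Space3) : Space3 :=
  ∫ y, σ y • truncKernel d (x - y)

lemma field_eq_truncField_zero (σ : Space3 → ℝ) (x : Space3) : field σ x = truncField 0 σ x := by
  unfold field truncField truncKernel
  congr 1 with y : 1
  rw [smul_smul, max_eq_left (norm_nonneg _), div_eq_mul_inv]

lemma truncField_eq_integral_comp_sub (d : ℝ) (σ : Space3 → ℝ) (x : Space3) :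
    truncField d σ x = ∫ z, σ (x - z) • truncKernel d z := by
  rw [truncField, ← integral_sub_left_eq_self (fun y => σ y • truncKernel d (x - y)) volume x]
  simp only [sub_sub_cancel]

@[fun_prop]
lemma measurable_truncKernel (d : ℝ) : Measurable (truncKernel d) := by
  unfold truncKernel
  fun_prop

lemma norm_truncKernel_le (d : ℝ) (z : Space3) : ‖truncKernel d z‖ ≤ (‖z‖ ^ 2)⁻¹ := by
  rcases eq_or_ne z 0 with rfl | hz
  · simp [truncKernel]
  have hz' : 0 < ‖z‖ := norm_pos_iff.2 hz
  rw [truncKernel, norm_smul, norm_inv, norm_pow, Real.norm_of_nonneg (le_max_of_le_left hz'.le)]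
  calc (max ‖z‖ d ^ 3)⁻¹ * ‖z‖ ≤ (‖z‖ ^ 3)⁻¹ * ‖z‖ := by gcongr; exact le_max_left _ _
    _ = (‖z‖ ^ 2)⁻¹ := by field_simp

lemma norm_truncKernel_zero_sub_le (d : ℝ) (z : Space3) :
    ‖truncKernel 0 z - truncKernel d z‖ ≤ (ball 0 d).indicator (fun z => (‖z‖ ^ 2)⁻¹) z := by
  by_cases hzd : ‖z‖ < d
  · rw [indicator_of_mem (mem_ball_zero_iff.2 hzd)]
    rcases eq_or_ne z 0 with rfl | hz
    · simp [truncKernel]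
    have hz' : 0 < ‖z‖ := norm_pos_iff.2 hz
    have hd : 0 < d := hz'.trans hzd
    have hmono : (d ^ 3)⁻¹ ≤ (‖z‖ ^ 3)⁻¹ := by gcongr
    rw [truncKernel, truncKernel, max_eq_left hz'.le, max_eq_right hzd.le, ← sub_smul, norm_smul,
      Real.norm_of_nonneg (sub_nonneg.2 hmono)]
    calc ((‖z‖ ^ 3)⁻¹ - (d ^ 3)⁻¹) * ‖z‖ ≤ (‖z‖ ^ 3)⁻¹ * ‖z‖ := by
          gcongr
          exact sub_le_self _ (by positivity)
      _ = (‖z‖ ^ 2)⁻¹ := by field_simp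
  · rw [indicator_of_notMem (mt mem_ball_zero_iff.1 hzd)]
    simp [truncKernel, max_eq_left (not_lt.1 hzd)]

lemma abs_inv_cube_sub_inv_cube_mul_le {m n : ℝ} (hm : 0 < m) (hn : 0 < n) :
    |(m ^ 3)⁻¹ - (n ^ 3)⁻¹| * n ≤ 3 * |m - n| * ((m ^ 3)⁻¹ + (n ^ 3)⁻¹) := by
  have hfactor : ((m ^ 3)⁻¹ - (n ^ 3)⁻¹) * n
      = -(m - n) * (m⁻¹ ^ 3 + m⁻¹ ^ 2 * n⁻¹ + m⁻¹ * n⁻¹ ^ 2) := by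
    field_simp
    ring
  have hmean : m⁻¹ ^ 3 + m⁻¹ ^ 2 * n⁻¹ + m⁻¹ * n⁻¹ ^ 2 ≤ 3 * (m⁻¹ ^ 3 + n⁻¹ ^ 3) := by
    have hm' := inv_pos.2 hm
    have hn' := inv_pos.2 hn
    nlinarith [mul_nonneg (add_pos hm' hn').le (sq_nonneg (m⁻¹ - n⁻¹)), pow_pos hm' 3,
      pow_pos hn' 3]
  rw [← abs_of_pos hn, ← abs_mul, abs_of_pos hn, hfactor, abs_mul, abs_neg,
    abs_of_pos (a := m⁻¹ ^ 3 + _ + _) (by positivity), ← inv_pow, ← inv_pow, mul_comm 3, mul_assoc]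
  gcongr

lemma norm_truncKernel_sub_le {d : ℝ} (hd : 0 < d) (a b : Space3) :
    ‖truncKernel d a - truncKernel d b‖
      ≤ 4 * ‖a - b‖ * ((max ‖a‖ d ^ 3)⁻¹ + (max ‖b‖ d ^ 3)⁻¹) := by
  set m := max ‖a‖ d
  set n := max ‖b‖ d
  have hm : 0 < m := lt_max_of_lt_right hd
  have hn : 0 < n := lt_max_of_lt_right hd
  have hmn : |m - n| ≤ ‖a - b‖ :=
    (abs_max_sub_max_le_abs ‖a‖ ‖b‖ d).trans (abs_norm_sub_norm_le a b)
  have hsplit : truncKernel d a - truncKernel d b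
      = (m ^ 3)⁻¹ • (a - b) + ((m ^ 3)⁻¹ - (n ^ 3)⁻¹) • b := by
    simp only [truncKernel, smul_sub, sub_smul, m, n]
    abel
  calc ‖truncKernel d a - truncKernel d b‖
      ≤ (m ^ 3)⁻¹ * ‖a - b‖ + |(m ^ 3)⁻¹ - (n ^ 3)⁻¹| * n := by
        rw [hsplit]
        refine (norm_add_le _ _).trans ?_
        rw [norm_smul, norm_smul, Real.norm_of_nonneg (by positivity), Real.norm_eq_abs]
        gcongr
        exact le_max_left _ _
    _ ≤ (m ^ 3)⁻¹ * ‖a - b‖ + 3 * ‖a - b‖ * ((m ^ 3)⁻¹ + (n ^ 3)⁻¹) := by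
        have : 0 ≤ (m ^ 3)⁻¹ + (n ^ 3)⁻¹ := by positivity
        exact add_le_add_right ((abs_inv_cube_sub_inv_cube_mul_le hm hn).trans (by gcongr)) _
    _ ≤ 4 * ‖a - b‖ * ((m ^ 3)⁻¹ + (n ^ 3)⁻¹) := by
        have : 0 ≤ (n ^ 3)⁻¹ * ‖a - b‖ := by positivity
        linarith

end CoulombKernel

section FieldDecay

variable {p M : ℝ} {σ : Space3 → ℝ}

lemma inv_pow_le_of_half_R_le (n : ℕ) {x : Space3} {m : ℝ} (hm : R x / 2 ≤ m) :
    (m ^ n)⁻¹ ≤ 2 ^ n * R x ^ (-(n : ℝ)) := by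
  have hR := R_pos x
  calc (m ^ n)⁻¹ ≤ ((R x / 2) ^ n)⁻¹ := by gcongr
    _ = 2 ^ n * R x ^ (-(n : ℝ)) := by
        rw [Real.rpow_neg hR.le, Real.rpow_natCast, div_pow, inv_div, div_eq_mul_inv]

lemma inv_norm_sq_le {x z : Space3} (hz : R x / 2 ≤ ‖z‖) :
    (‖z‖ ^ 2)⁻¹ ≤ 4 * R x ^ (-2 : ℝ) := by
  have := inv_pow_le_of_half_R_le 2 hz
  norm_num at this ⊢
  exact this

lemma integrable_R_rpow_neg_mul_inv_norm_sq (hp : 3 < p) (x : Space3) :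
    Integrable (fun y => R y ^ (-p) * (‖x - y‖ ^ 2)⁻¹) :=
  integrable_R_rpow_neg_mul_kernel (κ := fun z => (‖z‖ ^ 2)⁻¹) hp (fun _ => by positivity)
    (by fun_prop) (by have := R_pos x; positivity) (fun _ => inv_norm_sq_le)
    (integrableOn_ball_inv_norm_sq _)

/-- The constant in the decay estimate `|E| ≤ C R⁻²` of the electric field. -/
def fieldConst (p : ℝ) : ℝ := 4 * weightMass p + 2 ^ p * (3 * ballVol)

lemma fieldConst_nonneg (p : ℝ) : 0 ≤ fieldConst p := by
  have := weightMass_nonneg p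
  have := ballVol_nonneg
  unfold fieldConst
  positivity

lemma integral_R_rpow_neg_mul_inv_norm_sq_le (hp : 3 < p) (x : Space3) :
    ∫ y, R y ^ (-p) * (‖x - y‖ ^ 2)⁻¹ ≤ fieldConst p * R x ^ (-2 : ℝ) := by
  have hR := R_pos x
  have hv := ballVol_nonneg
  have hexp : R x ^ (-p) * R x ≤ R x ^ (-2 : ℝ) := by
    rw [← Real.rpow_add_one hR.ne']
    exact Real.rpow_le_rpow_of_exponent_le (one_le_R x) (by linarith)
  calc ∫ y, R y ^ (-p) * (‖x - y‖ ^ 2)⁻¹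
      ≤ 4 * R x ^ (-2 : ℝ) * weightMass p
          + 2 ^ p * R x ^ (-p) * ∫ z in ball 0 (R x / 2), (‖z‖ ^ 2)⁻¹ :=
        integral_R_rpow_neg_mul_kernel_le (κ := fun z => (‖z‖ ^ 2)⁻¹) hp (fun _ => by positivity)
          (by fun_prop) (by positivity) (fun _ => inv_norm_sq_le) (integrableOn_ball_inv_norm_sq _)
    _ = 4 * R x ^ (-2 : ℝ) * weightMass p + 2 ^ p * (3 * ballVol) * (R x ^ (-p) * R x) / 2 := by
        rw [setIntegral_ball_inv_norm_sq (by positivity)]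
        ring
    _ ≤ 4 * R x ^ (-2 : ℝ) * weightMass p + 2 ^ p * (3 * ballVol) * R x ^ (-2 : ℝ) := by
        gcongr
        refine (half_le_self (by positivity)).trans (by gcongr)
    _ = fieldConst p * R x ^ (-2 : ℝ) := by rw [fieldConst]; ring

lemma nonneg_of_abs_le_mul_R_rpow {r : ℝ} (hσ : ∀ y, |σ y| ≤ M * R y ^ r) : 0 ≤ M :=
  nonneg_of_mul_nonneg_left ((abs_nonneg _).trans (hσ 0)) (R_rpow_pos 0 _)

lemma norm_smul_truncKernel_le (hσ : ∀ y, |σ y| ≤ M * R y ^ (-p)) (d : ℝ) (x y : Space3) :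
    ‖σ y • truncKernel d (x - y)‖ ≤ M * (R y ^ (-p) * (‖x - y‖ ^ 2)⁻¹) := by
  rw [norm_smul, Real.norm_eq_abs, ← mul_assoc]
  exact mul_le_mul (hσ y) (norm_truncKernel_le d _) (norm_nonneg _) ((abs_nonneg _).trans (hσ y))

lemma norm_field_le (hp : 3 < p) (hσ : ∀ y, |σ y| ≤ M * R y ^ (-p)) (x : Space3) :
    ‖field σ x‖ ≤ M * fieldConst p * R x ^ (-2 : ℝ) := by
  rw [field_eq_truncField_zero, truncField]
  refine (norm_integral_le_of_norm_le ((integrable_R_rpow_neg_mul_inv_norm_sq hp x).const_mul M)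
    (.of_forall (norm_smul_truncKernel_le hσ 0 x))).trans ?_
  rw [integral_const_mul, mul_assoc]
  exact mul_le_mul_of_nonneg_left (integral_R_rpow_neg_mul_inv_norm_sq_le hp x)
    (nonneg_of_abs_le_mul_R_rpow hσ)

end FieldDecay

section LipschitzWeight

variable {p : ℝ}

lemma inv_max_norm_cube_le (d : ℝ) {x z : Space3} (hz : R x / 2 ≤ ‖z‖) :
    (max ‖z‖ d ^ 3)⁻¹ ≤ 8 * R x ^ (-3 : ℝ) := by
  have := inv_pow_le_of_half_R_le 3 (hz.trans (le_max_left ‖z‖ d))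
  norm_num at this ⊢
  exact this

lemma inv_max_norm_cube_nonneg {d : ℝ} (hd : 0 < d) (z : Space3) : 0 ≤ (max ‖z‖ d ^ 3)⁻¹ :=
  inv_nonneg.2 (pow_nonneg (le_max_of_le_right hd.le) 3)

lemma integrable_R_rpow_neg_mul_inv_max_norm_cube (hp : 3 < p) {d : ℝ} (hd : 0 < d) (x : Space3) :
    Integrable (fun y => R y ^ (-p) * (max ‖x - y‖ d ^ 3)⁻¹) :=
  integrable_R_rpow_neg_mul_kernel (κ := fun z => (max ‖z‖ d ^ 3)⁻¹) hp
    (inv_max_norm_cube_nonneg hd) (by fun_prop) (by have := R_pos x; positivity)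
    (fun _ => inv_max_norm_cube_le d) (integrableOn_ball_inv_max_norm_cube hd _)

lemma R_rpow_neg_le_R_rpow_neg_three (hp : 3 < p) (x : Space3) : R x ^ (-p) ≤ R x ^ (-3 : ℝ) :=
  Real.rpow_le_rpow_of_exponent_le (one_le_R x) (by linarith)

lemma R_rpow_neg_mul_log_R_le (hp : 3 < p) (x : Space3) :
    R x ^ (-p) * Real.log (R x) ≤ R x ^ (-3 : ℝ) / (p - 3) := by
  have hR := R_pos x
  calc R x ^ (-p) * Real.log (R x) ≤ R x ^ (-p) * (R x ^ (p - 3) / (p - 3)) := by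
        gcongr
        exact Real.log_le_rpow_div hR.le (sub_pos.2 hp)
    _ = R x ^ (-3 : ℝ) / (p - 3) := by
        rw [← mul_div_assoc, ← Real.rpow_add hR]
        congr 2
        ring

lemma R_rpow_neg_mul_one_add_log_R_le (hp : 3 < p) (x : Space3) :
    R x ^ (-p) * (1 + 3 * Real.log (R x)) ≤ (1 + 3 / (p - 3)) * R x ^ (-3 : ℝ) := by
  have hsplit : (1 + 3 / (p - 3)) * R x ^ (-3 : ℝ)
      = R x ^ (-3 : ℝ) + 3 * (R x ^ (-3 : ℝ) / (p - 3)) := by ring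
  linarith [R_rpow_neg_mul_log_R_le hp x, R_rpow_neg_le_R_rpow_neg_three hp x]

/-- The local Lipschitz constant at `x`, up to the factor `truncLipConst p`, of the field that is
generated by a density of size `R ^ (-p)` through the kernel truncated at distance `d`. -/
def truncLipWeight (p d : ℝ) (x : Space3) : ℝ :=
  R x ^ (-3 : ℝ) + R x ^ (-p) * Real.log (1 / d)

/-- The constant accompanying `truncLipWeight`. -/
def truncLipConst (p : ℝ) : ℝ := 8 * weightMass p + 2 ^ p * ballVol * (4 + 3 / (p - 3))

lemma truncLipConst_nonneg (hp : 3 < p) : 0 ≤ truncLipConst p := by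
  have := weightMass_nonneg p
  have := ballVol_nonneg
  have : 0 < p - 3 := sub_pos.2 hp
  unfold truncLipConst
  positivity

lemma log_one_div_nonneg {d : ℝ} (hd : 0 < d) (hd1 : d ≤ 1) : 0 ≤ Real.log (1 / d) :=
  Real.log_nonneg (one_le_one_div hd hd1)

lemma truncLipWeight_le_one_add_log (hp : 0 ≤ p) {d : ℝ} (hd : 0 < d) (hd1 : d ≤ 1) (x : Space3) :
    truncLipWeight p d x ≤ 1 + Real.log (1 / d) :=
  add_le_add (R_rpow_neg_le_one x (by norm_num))
    (mul_le_of_le_one_left (log_one_div_nonneg hd hd1) (R_rpow_neg_le_one x hp))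

lemma R_rpow_neg_mul_log_quotient_le (hp : 3 < p) {d : ℝ} (hd : 0 < d) (x : Space3) :
    R x ^ (-p) * (1 + 3 * Real.log (R x / 2 / d))
      ≤ (1 + 3 / (p - 3)) * R x ^ (-3 : ℝ) + 3 * (R x ^ (-p) * Real.log (1 / d)) := by
  have hR := R_pos x
  have hlog : Real.log (R x / 2 / d) ≤ Real.log (R x) + Real.log (1 / d) := by
    rw [← Real.log_mul hR.ne' (by positivity), mul_one_div]
    gcongr
    linarith
  have := mul_le_mul_of_nonneg_left hlog (R_rpow_pos x (-p)).le
  linarith [R_rpow_neg_mul_one_add_log_R_le hp x]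

lemma integral_R_rpow_neg_mul_inv_max_norm_cube_le (hp : 3 < p) {d : ℝ} (hd : 0 < d)
    (hd2 : d ≤ 1 / 2) (x : Space3) :
    ∫ y, R y ^ (-p) * (max ‖x - y‖ d ^ 3)⁻¹ ≤ truncLipConst p * truncLipWeight p d x := by
  have hR := R_pos x
  have hconv := integral_R_rpow_neg_mul_kernel_le (κ := fun z => (max ‖z‖ d ^ 3)⁻¹) hp
    (inv_max_norm_cube_nonneg hd) (by fun_prop) (by positivity) (fun _ => inv_max_norm_cube_le d)
    (integrableOn_ball_inv_max_norm_cube hd (R x / 2))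
  rw [setIntegral_ball_inv_max_norm_cube hd (by linarith [one_le_R x])] at hconv
  have hB : 0 ≤ 2 ^ p * ballVol := mul_nonneg (by positivity) ballVol_nonneg
  have hlog := mul_le_mul_of_nonneg_left (R_rpow_neg_mul_log_quotient_le hp hd x) hB
  have hr : 0 ≤ R x ^ (-3 : ℝ) := (R_rpow_pos x _).le
  have hl : 0 ≤ R x ^ (-p) * Real.log (1 / d) :=
    mul_nonneg (R_rpow_pos x _).le (log_one_div_nonneg hd (by linarith))
  have hp3 : 0 ≤ 3 / (p - 3) := div_nonneg zero_le_three (sub_pos.2 hp).le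
  have := mul_nonneg hB hr
  have := mul_nonneg hB hl
  have := mul_nonneg (weightMass_nonneg p) hl
  have := mul_nonneg hp3 (mul_nonneg hB hl)
  simp only [truncLipConst, truncLipWeight]
  nlinarith

lemma log_one_div_half_R_rpow_le (x : Space3) :
    Real.log (1 / (R x ^ (-3 : ℝ) / 2)) ≤ 1 + 3 * Real.log (R x) := by
  rw [one_div_div, Real.log_div two_ne_zero (R_rpow_pos x _).ne', Real.log_rpow (R_pos x)]
  linarith [Real.log_two_lt_d9]

lemma truncLipWeight_half_R_rpow_le (hp : 3 < p) {x y : Space3} (h : ‖x - y‖ ≤ R x / 2) :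
    truncLipWeight p (R x ^ (-3 : ℝ) / 2) y
      ≤ (8 + 2 ^ p * (1 + 3 / (p - 3))) * R x ^ (-3 : ℝ) := by
  have hcube : R y ^ (-3 : ℝ) ≤ 8 * R x ^ (-3 : ℝ) := by
    have := R_rpow_neg_le_of_norm_sub_le (by norm_num : (0 : ℝ) ≤ 3) h
    rwa [show (2 : ℝ) ^ (3 : ℝ) = 8 by norm_num] at this
  have hlog : R y ^ (-p) * Real.log (1 / (R x ^ (-3 : ℝ) / 2))
      ≤ 2 ^ p * ((1 + 3 / (p - 3)) * R x ^ (-3 : ℝ)) := by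
    have hlog0 : 0 ≤ 1 + 3 * Real.log (R x) := by linarith [Real.log_nonneg (one_le_R x)]
    calc R y ^ (-p) * Real.log (1 / (R x ^ (-3 : ℝ) / 2))
        ≤ R y ^ (-p) * (1 + 3 * Real.log (R x)) :=
          mul_le_mul_of_nonneg_left (log_one_div_half_R_rpow_le x) (R_rpow_pos y _).le
      _ ≤ 2 ^ p * R x ^ (-p) * (1 + 3 * Real.log (R x)) :=
          mul_le_mul_of_nonneg_right (R_rpow_neg_le_of_norm_sub_le (by linarith) h) hlog0
      _ = 2 ^ p * (R x ^ (-p) * (1 + 3 * Real.log (R x))) := mul_assoc _ _ _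
      _ ≤ _ := mul_le_mul_of_nonneg_left (R_rpow_neg_mul_one_add_log_R_le hp x) (by positivity)
  rw [truncLipWeight]
  linarith

end LipschitzWeight

section FieldLipschitz

/-- The density `σ` is continuous and bounded by `M R ^ (-p)` for an integrable weight
`R ^ (-p)`; this is the class of charge densities whose fields are estimated below. -/
structure IsDominated (p M : ℝ) (σ : Space3 → ℝ) : Prop where
  three_lt : 3 < p
  continuous : Continuous σ
  abs_le : ∀ y, |σ y| ≤ M * R y ^ (-p)

namespace IsDominated

variable {p M : ℝ} {σ : Space3 → ℝ}

lemma nonneg (h : IsDominated p M σ) : 0 ≤ M := nonneg_of_abs_le_mul_R_rpow h.abs_le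

lemma integrable_smul_truncKernel (h : IsDominated p M σ) (d : ℝ) (x : Space3) :
    Integrable (fun y => σ y • truncKernel d (x - y)) :=
  ((integrable_R_rpow_neg_mul_inv_norm_sq h.three_lt x).const_mul M).mono'
    (h.continuous.aestronglyMeasurable.smul (by fun_prop : Measurable fun y : Space3 =>
      truncKernel d (x - y)).aestronglyMeasurable)
    (.of_forall (norm_smul_truncKernel_le h.abs_le d x))

lemma integrable_comp_sub_smul_truncKernel (h : IsDominated p M σ) (d : ℝ) (x : Space3) :
    Integrable (fun z => σ (x - z) • truncKernel d z) := by
  simpa using (h.integrable_smul_truncKernel d x).comp_sub_left x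

lemma norm_field_sub_truncField_sub_le (h : IsDominated p M σ) {d η : ℝ} (hd : 0 ≤ d)
    {x x' : Space3} (hη : ∀ z, ‖z‖ < d → |σ (x' - z) - σ (x - z)| ≤ η) :
    ‖(field σ x' - truncField d σ x') - (field σ x - truncField d σ x)‖
      ≤ 3 * ballVol * d * η := by
  have hint := h.integrable_comp_sub_smul_truncKernel
  have heq : (field σ x' - truncField d σ x') - (field σ x - truncField d σ x)
      = ∫ z, (σ (x' - z) - σ (x - z)) • (truncKernel 0 z - truncKernel d z) := by
    simp only [field_eq_truncField_zero, truncField_eq_integral_comp_sub]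
    rw [← integral_sub (hint 0 x') (hint d x'), ← integral_sub (hint 0 x) (hint d x)]
    refine (integral_sub ((hint 0 x').sub (hint d x')) ((hint 0 x).sub (hint d x))).symm.trans ?_
    congr 1 with z : 1
    simp only [sub_smul, smul_sub, Pi.sub_apply]
    abel
  rw [heq]
  refine (norm_integral_le_of_norm_le (((integrableOn_ball_inv_norm_sq d).integrable_indicator
    measurableSet_ball).const_mul η) (.of_forall fun z => ?_)).trans ?_
  · rw [norm_smul, Real.norm_eq_abs]
    have hker := norm_truncKernel_zero_sub_le d z
    by_cases hz : ‖z‖ < d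
    · exact mul_le_mul (hη z hz) hker (norm_nonneg _) ((abs_nonneg _).trans (hη z hz))
    · rw [indicator_of_notMem (mt mem_ball_zero_iff.1 hz)] at hker ⊢
      rw [le_antisymm hker (norm_nonneg _), mul_zero, mul_zero]
  · rw [integral_const_mul, integral_indicator measurableSet_ball, setIntegral_ball_inv_norm_sq hd]
    exact le_of_eq (by ring)

lemma norm_truncField_sub_le (h : IsDominated p M σ) {d : ℝ} (hd : 0 < d) (hd2 : d ≤ 1 / 2)
    (x x' : Space3) :
    ‖truncField d σ x' - truncField d σ x‖ ≤ 4 * M * ‖x' - x‖ *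
      (truncLipConst p * (truncLipWeight p d x' + truncLipWeight p d x)) := by
  have hint := integrable_R_rpow_neg_mul_inv_max_norm_cube h.three_lt hd
  have hM := h.nonneg
  have hpt (y : Space3) : ‖σ y • truncKernel d (x' - y) - σ y • truncKernel d (x - y)‖
      ≤ 4 * M * ‖x' - x‖ *
        (R y ^ (-p) * (max ‖x' - y‖ d ^ 3)⁻¹ + R y ^ (-p) * (max ‖x - y‖ d ^ 3)⁻¹) := by
    have hker := norm_truncKernel_sub_le hd (x' - y) (x - y)
    rw [sub_sub_sub_cancel_right] at hker
    rw [← smul_sub, norm_smul, Real.norm_eq_abs]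
    calc |σ y| * ‖truncKernel d (x' - y) - truncKernel d (x - y)‖
        ≤ M * R y ^ (-p) * (4 * ‖x' - x‖ *
            ((max ‖x' - y‖ d ^ 3)⁻¹ + (max ‖x - y‖ d ^ 3)⁻¹)) :=
          mul_le_mul (h.abs_le y) hker (norm_nonneg _) ((abs_nonneg _).trans (h.abs_le y))
      _ = _ := by ring
  rw [truncField, truncField, ← integral_sub (h.integrable_smul_truncKernel d x')
    (h.integrable_smul_truncKernel d x)]
  refine (norm_integral_le_of_norm_le (((hint x').add (hint x)).const_mul _)
    (.of_forall hpt)).trans ?_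
  rw [integral_const_mul]
  simp only [Pi.add_apply]
  rw [integral_add (hint x') (hint x), mul_add (truncLipConst p)]
  gcongr <;> exact integral_R_rpow_neg_mul_inv_max_norm_cube_le h.three_lt hd hd2 _

lemma norm_field_sub_le (h : IsDominated p M σ) {d η : ℝ} (hd : 0 < d) (hd2 : d ≤ 1 / 2)
    {x x' : Space3} (hη : ∀ z, ‖z‖ < d → |σ (x' - z) - σ (x - z)| ≤ η) :
    ‖field σ x' - field σ x‖ ≤ 3 * ballVol * d * η + 4 * M * ‖x' - x‖ *
      (truncLipConst p * (truncLipWeight p d x' + truncLipWeight p d x)) := by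
  have hsplit : field σ x' - field σ x
      = ((field σ x' - truncField d σ x') - (field σ x - truncField d σ x))
        + (truncField d σ x' - truncField d σ x) := by abel
  rw [hsplit]
  exact (norm_add_le _ _).trans (add_le_add (h.norm_field_sub_truncField_sub_le hd.le hη)
    (h.norm_truncField_sub_le hd hd2 x x'))

lemma norm_field_sub_le_log (h : IsDominated p M σ) {d η : ℝ} (hd : 0 < d) (hd2 : d ≤ 1 / 2)
    {x x' : Space3} (hη : ∀ z, ‖z‖ < d → |σ (x' - z) - σ (x - z)| ≤ η) :
    ‖field σ x' - field σ x‖ ≤ 3 * ballVol * d * η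
      + 8 * M * truncLipConst p * (1 + Real.log (1 / d)) * ‖x' - x‖ := by
  have hM := h.nonneg
  have hp := h.three_lt
  have hc := truncLipConst_nonneg hp
  have hle := truncLipWeight_le_one_add_log (by linarith : 0 ≤ p) hd (by linarith)
  calc ‖field σ x' - field σ x‖ ≤ 3 * ballVol * d * η + 4 * M * ‖x' - x‖ *
        (truncLipConst p * (truncLipWeight p d x' + truncLipWeight p d x)) :=
        h.norm_field_sub_le hd hd2 hη
    _ ≤ 3 * ballVol * d * η + 4 * M * ‖x' - x‖ *
        (truncLipConst p * ((1 + Real.log (1 / d)) + (1 + Real.log (1 / d)))) := by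
        gcongr <;> exact hle _
    _ = _ := by ring

end IsDominated

/-- The constant in the weighted Lipschitz estimate of the electric field. -/
def lipConst (p : ℝ) : ℝ :=
  3 * ballVol + 8 * truncLipConst p * (8 + 2 ^ p * (1 + 3 / (p - 3)))

lemma lipConst_nonneg {p : ℝ} (hp : 3 < p) : 0 ≤ lipConst p := by
  have := truncLipConst_nonneg hp
  have := ballVol_nonneg
  have : 0 < p - 3 := sub_pos.2 hp
  unfold lipConst
  positivity

/-- The truncation distance `R x ^ (-3) / 2` balances the near field, of size `d Λ`, against the
far field, of size `R x ^ (-p) log (1 / d)`. -/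
lemma IsDominated.norm_field_sub_le_R_rpow {p M Λ : ℝ} {σ : Space3 → ℝ} (h : IsDominated p M σ)
    (hΛ : 0 ≤ Λ) (hL : ∀ y y', |σ y' - σ y| ≤ Λ * ‖y' - y‖) {x x' : Space3}
    (hx : ‖x - x'‖ ≤ R x / 2) :
    ‖field σ x' - field σ x‖ ≤ lipConst p * (M + Λ) * R x ^ (-3 : ℝ) * ‖x' - x‖ := by
  have hp := h.three_lt
  have hM := h.nonneg
  have hc := truncLipConst_nonneg hp
  have hv := ballVol_nonneg
  have : 0 < p - 3 := sub_pos.2 hp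
  set r := R x ^ (-3 : ℝ)
  have hr : 0 < r := R_rpow_pos x _
  have hr1 : r ≤ 1 := R_rpow_neg_le_one x (by norm_num)
  set g := 8 + 2 ^ p * (1 + 3 / (p - 3))
  have : 0 ≤ g := by positivity
  have hx0 : ‖x - x‖ ≤ R x / 2 := by
    simpa using (half_pos (R_pos x)).le
  calc ‖field σ x' - field σ x‖
      ≤ 3 * ballVol * (r / 2) * (Λ * ‖x' - x‖) + 4 * M * ‖x' - x‖ *
        (truncLipConst p * (truncLipWeight p (r / 2) x' + truncLipWeight p (r / 2) x)) :=
        h.norm_field_sub_le (half_pos hr) (by linarith) fun z _ => by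
          simpa using hL (x - z) (x' - z)
    _ ≤ 3 * ballVol * r * (Λ * ‖x' - x‖) + 4 * M * ‖x' - x‖ *
        (truncLipConst p * (g * r + g * r)) := by
        gcongr
        · exact half_le_self hr.le
        · exact truncLipWeight_half_R_rpow_le hp hx
        · exact truncLipWeight_half_R_rpow_le hp hx0
    _ = (3 * ballVol * Λ + 8 * truncLipConst p * g * M) * r * ‖x' - x‖ := by ring
    _ ≤ (3 * ballVol * (M + Λ) + 8 * truncLipConst p * g * (M + Λ)) * r * ‖x' - x‖ := by
        gcongr <;> linarith
    _ = lipConst p * (M + Λ) * r * ‖x' - x‖ := by rw [lipConst]; ring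

end FieldLipschitz

section DifferenceQuotient

/-- The `i`-th coordinate vector of `ℝ³`. -/
abbrev coordVec (i : Fin 3) : Space3 := EuclideanSpace.single i 1

/-- The difference quotient with step `h` whose limit as `h → 0` is the divergence of `B` at `x`.
It is used because the electric field is not known to be differentiable. -/
def divQuot (B : Space3 → Space3) (x : Space3) (h : ℝ) : ℝ :=
  ∑ i : Fin 3, (B (x + h • coordVec i) i - B x i) / h

lemma divQuot_add (B B' : Space3 → Space3) (x : Space3) (h : ℝ) :
    divQuot (fun y => B y + B' y) x h = divQuot B x h + divQuot B' x h := by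
  simp only [divQuot, ← Finset.sum_add_distrib, PiLp.add_apply]
  exact Finset.sum_congr rfl fun i _ => by ring

lemma divQuot_sub (B B' : Space3 → Space3) (x : Space3) (h : ℝ) :
    divQuot (fun y => B y - B' y) x h = divQuot B x h - divQuot B' x h := by
  simp only [divQuot, ← Finset.sum_sub_distrib, PiLp.sub_apply]
  exact Finset.sum_congr rfl fun i _ => by ring

lemma abs_divQuot_le {B : Space3 → Space3} {x : Space3} {h L : ℝ} (hL0 : 0 ≤ L)
    (hL : ∀ i, ‖B (x + h • coordVec i) - B x‖ ≤ L * |h|) : |divQuot B x h| ≤ 3 * L := by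
  have hterm (i : Fin 3) : |(B (x + h • coordVec i) i - B x i) / h| ≤ L := by
    rw [abs_div]
    refine div_le_of_le_mul₀ (abs_nonneg _) hL0 (le_trans ?_ (hL i))
    simpa using PiLp.norm_apply_le (B (x + h • coordVec i) - B x) i
  calc |divQuot B x h| ≤ ∑ i : Fin 3, |(B (x + h • coordVec i) i - B x i) / h| :=
        Finset.abs_sum_le_sum_abs _ _
    _ ≤ ∑ _i : Fin 3, L := Finset.sum_le_sum fun i _ => hterm i
    _ = 3 * L := by simp

lemma tendsto_divQuot_of_hasDerivAt {B : Space3 → Space3} {x : Space3} {c : Fin 3 → ℝ}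
    (hB : ∀ i, HasDerivAt (fun h : ℝ => B (x + h • coordVec i) i) (c i) 0) :
    Tendsto (divQuot B x) (𝓝[≠] 0) (𝓝 (∑ i, c i)) := by
  refine tendsto_finsetSum _ fun i _ => ?_
  refine (hasDerivAt_iff_tendsto_slope_zero.1 (hB i)).congr fun h => ?_
  simp [div_eq_inv_mul]

lemma tendsto_divQuot_of_hasFDerivAt {B : Space3 → Space3} {D : Space3 →L[ℝ] Space3} {x : Space3}
    (hD : HasFDerivAt B D x) :
    Tendsto (divQuot B x) (𝓝[≠] 0) (𝓝 (∑ i, D (coordVec i) i)) := by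
  refine tendsto_divQuot_of_hasDerivAt fun i => ?_
  have hline : HasDerivAt (fun h : ℝ => x + h • coordVec i) (coordVec i) 0 := by
    simpa using ((hasDerivAt_id (0 : ℝ)).smul_const (coordVec i)).const_add x
  have hD' : HasFDerivAt B D (x + (0 : ℝ) • coordVec i) := by simpa using hD
  exact (EuclideanSpace.proj (𝕜 := ℝ) i).hasFDerivAt.comp_hasDerivAt (0 : ℝ)
    (hD'.comp_hasDerivAt (0 : ℝ) hline)

end DifferenceQuotient

section KernelDivergence

variable {d : ℝ} {z : Space3}

lemma hasDerivAt_truncKernel_of_lt_norm (hd : 0 ≤ d) (hz : d < ‖z‖) (i : Fin 3) :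
    HasDerivAt (fun h : ℝ => truncKernel d (z + h • coordVec i) i)
      ((‖z‖ ^ 3)⁻¹ - 3 * (‖z‖ ^ 5)⁻¹ * z i ^ 2) 0 := by
  have hz0 : 0 < ‖z‖ := hd.trans_lt hz
  have hline : HasDerivAt (fun h : ℝ => z + h • coordVec i) (coordVec i) 0 := by
    simpa using ((hasDerivAt_id (0 : ℝ)).smul_const (coordVec i)).const_add z
  have hsq : HasDerivAt (fun h : ℝ => ‖z + h • coordVec i‖ ^ 2) (2 * z i) 0 := by
    simpa [EuclideanSpace.inner_single_right] using hline.norm_sq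
  have hcoord : HasDerivAt (fun h : ℝ => z i + h) 1 0 := by
    simpa using (hasDerivAt_id (0 : ℝ)).const_add (z i)
  have hprod := (hsq.rpow_const (p := (-3 / 2 : ℝ)) (.inl (by simpa using hz0.ne'))).mul hcoord
  have hev : ∀ᶠ h in 𝓝 (0 : ℝ), d < ‖z + h • coordVec i‖ :=
    (by fun_prop : ContinuousAt (fun h : ℝ => ‖z + h • coordVec i‖) 0).eventually_const_lt
      (by simpa using hz)
  refine (hprod.congr_of_eventuallyEq ?_).congr_deriv ?_
  · filter_upwards [hev] with h hh
    simp only [truncKernel, max_eq_left hh.le, Pi.mul_apply]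
    rw [← Real.rpow_natCast _ 2, ← Real.rpow_mul (hd.trans_lt hh).le]
    norm_num
    ring
  · simp only [zero_smul, add_zero]
    rw [← Real.rpow_natCast _ 2, ← Real.rpow_mul hz0.le, ← Real.rpow_mul hz0.le]
    norm_num
    ring

lemma hasDerivAt_truncKernel_of_norm_lt (hz : ‖z‖ < d) (i : Fin 3) :
    HasDerivAt (fun h : ℝ => truncKernel d (z + h • coordVec i) i) (d ^ 3)⁻¹ 0 := by
  have hlin : HasDerivAt (fun h : ℝ => (d ^ 3)⁻¹ * (z i + h)) (d ^ 3)⁻¹ 0 := by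
    simpa using ((hasDerivAt_id (0 : ℝ)).const_add (z i)).const_mul (d ^ 3)⁻¹
  have hev : ∀ᶠ h in 𝓝 (0 : ℝ), ‖z + h • coordVec i‖ < d :=
    (by fun_prop : ContinuousAt (fun h : ℝ => ‖z + h • coordVec i‖) 0).eventually_lt_const
      (by simpa using hz)
  refine hlin.congr_of_eventuallyEq ?_
  filter_upwards [hev] with h hh
  simp [truncKernel, max_eq_right hh.le]
  ring

lemma tendsto_divQuot_truncKernel (hd : 0 < d) (hz : ‖z‖ ≠ d) :
    Tendsto (divQuot (truncKernel d) z) (𝓝[≠] 0)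
      (𝓝 ((ball (0 : Space3) d).indicator (fun _ => 3 / d ^ 3) z)) := by
  rcases lt_or_gt_of_ne hz with h | h
  · rw [indicator_of_mem (mem_ball_zero_iff.2 h)]
    convert tendsto_divQuot_of_hasDerivAt (hasDerivAt_truncKernel_of_norm_lt h) using 2
    simp [div_eq_mul_inv]
  · rw [indicator_of_notMem (mt mem_ball_zero_iff.1 h.le.not_gt)]
    convert tendsto_divQuot_of_hasDerivAt (hasDerivAt_truncKernel_of_lt_norm hd.le h) using 2
    have hz0 : 0 < ‖z‖ := hd.trans h
    have hsq : ‖z‖ ^ 2 = z 0 ^ 2 + z 1 ^ 2 + z 2 ^ 2 := by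
      rw [EuclideanSpace.real_norm_sq_eq, Fin.sum_univ_three]
    rw [Fin.sum_univ_three]
    field_simp
    rw [hsq]
    ring

lemma abs_divQuot_truncKernel_le (hd : 0 < d) (z : Space3) (h : ℝ) :
    |divQuot (truncKernel d) z h| ≤ 3 * (8 * (d ^ 3)⁻¹) := by
  refine abs_divQuot_le (by positivity) fun i => ?_
  have hstep : ‖z + h • coordVec i - z‖ = |h| := by simp [norm_smul]
  calc ‖truncKernel d (z + h • coordVec i) - truncKernel d z‖
      ≤ 4 * |h| * ((max ‖z + h • coordVec i‖ d ^ 3)⁻¹ + (max ‖z‖ d ^ 3)⁻¹) :=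
        hstep ▸ norm_truncKernel_sub_le hd _ _
    _ ≤ 4 * |h| * ((d ^ 3)⁻¹ + (d ^ 3)⁻¹) := by gcongr <;> exact le_max_right _ _
    _ = 8 * (d ^ 3)⁻¹ * |h| := by ring

lemma measurable_divQuot_truncKernel (d h : ℝ) : Measurable (divQuot (truncKernel d) · h) := by
  unfold divQuot
  fun_prop

end KernelDivergence

section FieldDivergence

namespace IsDominated

variable {p M : ℝ} {σ : Space3 → ℝ}

lemma divQuot_truncField (hσ : IsDominated p M σ) (d : ℝ) (x : Space3) (h : ℝ) :
    divQuot (truncField d σ) x h = ∫ y, σ y * divQuot (truncKernel d) (x - y) h := by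
  have hcoord (x : Space3) (i : Fin 3) :
      truncField d σ x i = ∫ y, σ y * truncKernel d (x - y) i := by
    simpa [truncField] using ((EuclideanSpace.proj (𝕜 := ℝ) i).integral_comp_comm
      (hσ.integrable_smul_truncKernel d x)).symm
  have hint (x : Space3) (i : Fin 3) : Integrable fun y => σ y * truncKernel d (x - y) i := by
    simpa using (EuclideanSpace.proj (𝕜 := ℝ) i).integrable_comp
      (hσ.integrable_smul_truncKernel d x)
  have hterm (i : Fin 3) (y : Space3) :
      (σ y * truncKernel d (x + h • coordVec i - y) i - σ y * truncKernel d (x - y) i) / h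
        = σ y * ((truncKernel d (x - y + h • coordVec i) i - truncKernel d (x - y) i) / h) := by
    rw [add_sub_right_comm]
    ring
  simp only [divQuot, hcoord, Finset.mul_sum]
  rw [integral_finsetSum]
  · refine Finset.sum_congr rfl fun i _ => ?_
    rw [← integral_sub (hint _ i) (hint _ i), ← integral_div]
    exact integral_congr_ae (.of_forall (hterm i))
  · intro i _
    exact (((hint (x + h • coordVec i) i).sub (hint x i)).div_const h).congr (.of_forall (hterm i))

lemma tendsto_divQuot_truncField (hσ : IsDominated p M σ) {d : ℝ} (hd : 0 < d) (x : Space3) :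
    Tendsto (divQuot (truncField d σ) x) (𝓝[≠] 0) (𝓝 (3 / d ^ 3 * ∫ y in ball x d, σ y)) := by
  have hball (y : Space3) : x - y ∈ ball (0 : Space3) d ↔ y ∈ ball x d := by
    rw [mem_ball_zero_iff, mem_ball, dist_eq_norm, norm_sub_rev]
  have hlim : 3 / d ^ 3 * ∫ y in ball x d, σ y
      = ∫ y, σ y * (ball (0 : Space3) d).indicator (fun _ => 3 / d ^ 3) (x - y) := by
    rw [← integral_indicator measurableSet_ball, ← integral_const_mul]
    congr 1 with y
    by_cases hy : y ∈ ball x d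
    · rw [indicator_of_mem hy, indicator_of_mem ((hball y).2 hy), mul_comm]
    · rw [indicator_of_notMem hy, indicator_of_notMem (mt (hball y).1 hy), mul_zero, mul_zero]
  rw [hlim, funext (hσ.divQuot_truncField d x)]
  refine tendsto_integral_filter_of_dominated_convergence
    (fun y => M * R y ^ (-p) * (3 * (8 * (d ^ 3)⁻¹))) (.of_forall fun h => ?_)
    (.of_forall fun h => .of_forall fun y => ?_)
    (((integrable_R_rpow_neg hσ.three_lt).const_mul M).mul_const _) ?_
  · exact hσ.continuous.aestronglyMeasurable.mul ((measurable_divQuot_truncKernel d h).comp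
      (measurable_const.sub measurable_id)).aestronglyMeasurable
  · rw [norm_mul, Real.norm_eq_abs, Real.norm_eq_abs]
    exact mul_le_mul (hσ.abs_le y) (abs_divQuot_truncKernel_le hd _ _) (abs_nonneg _)
      ((abs_nonneg _).trans (hσ.abs_le y))
  · have hnull : ∀ᵐ y : Space3, y ∉ sphere x d :=
      measure_eq_zero_iff_ae_notMem.1 (Measure.addHaar_sphere volume x d)
    filter_upwards [hnull] with y hy
    refine (tendsto_divQuot_truncKernel hd ?_).const_mul _
    simpa [dist_eq_norm, norm_sub_rev] using hy

lemma abs_divQuot_field_sub_truncField_le (hσ : IsDominated p M σ) {d Λ h : ℝ} (hd : 0 ≤ d)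
    (hΛ : 0 ≤ Λ) {x : Space3}
    (hL : ∀ i z, ‖z‖ < d → |σ (x + h • coordVec i - z) - σ (x - z)| ≤ Λ * |h|) :
    |divQuot (field σ) x h - divQuot (truncField d σ) x h| ≤ 9 * ballVol * Λ * d := by
  have := ballVol_nonneg
  rw [← divQuot_sub]
  refine (abs_divQuot_le (L := 3 * ballVol * d * Λ) (by positivity) fun i => ?_).trans
    (le_of_eq (by ring))
  exact (hσ.norm_field_sub_truncField_sub_le hd (hL i)).trans (le_of_eq (by ring))

end IsDominated

lemma volume_real_ball_space3 (x : Space3) {d : ℝ} (hd : 0 ≤ d) :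
    volume.real (ball x d) = d ^ 3 * ballVol := by
  rw [measureReal_def, Measure.addHaar_ball volume x hd, ENNReal.toReal_mul,
    ENNReal.toReal_ofReal (by positivity), finrank_euclideanSpace_fin, ballVol, measureReal_def]

lemma abs_setIntegral_ball_sub_le {σ : Space3 → ℝ} (hσ : Continuous σ) {d η : ℝ} (hd : 0 < d)
    {x : Space3} (hη : ∀ y ∈ ball x d, |σ y - σ x| ≤ η) :
    |3 / d ^ 3 * (∫ y in ball x d, σ y) - 3 * ballVol * σ x| ≤ 3 * ballVol * η := by
  have hvol := volume_real_ball_space3 x hd.le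
  have hsub : 3 / d ^ 3 * (∫ y in ball x d, σ y) - 3 * ballVol * σ x
      = 3 / d ^ 3 * ∫ y in ball x d, (σ y - σ x) := by
    rw [integral_sub ((hσ.continuousOn.integrableOn_compact (isCompact_closedBall x d)).mono_set
      ball_subset_closedBall) (integrableOn_const measure_ball_lt_top.ne), setIntegral_const, hvol,
      smul_eq_mul, mul_sub]
    field_simp
  have hint : ‖∫ y in ball x d, (σ y - σ x)‖ ≤ η * volume.real (ball x d) :=
    norm_setIntegral_le_of_norm_le_const measure_ball_lt_top fun y hy => hη y hy
  rw [Real.norm_eq_abs, hvol] at hint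
  calc _ = 3 / d ^ 3 * |∫ y in ball x d, (σ y - σ x)| := by
        rw [hsub, abs_mul, abs_of_pos (by positivity : 0 < 3 / d ^ 3)]
    _ ≤ 3 / d ^ 3 * (η * (d ^ 3 * ballVol)) := by gcongr
    _ = 3 * ballVol * η := by field_simp

/-- Gauss's law `div E = 4πρ`, up to the choice of a truncation distance `d`: the truncated field
has divergence the mean of `4πσ` over the ball of radius `d`, and the rest of the field is a
convolution with a kernel of mass `O(d)`. -/
lemma IsDominated.tendsto_divQuot_field {p M : ℝ} {σ : Space3 → ℝ} (hσ : IsDominated p M σ)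
    {x : Space3} {Λ : ℝ} (hΛ : 0 ≤ Λ)
    (hL : ∀ y ∈ ball x 2, ∀ y' ∈ ball x 2, |σ y' - σ y| ≤ Λ * ‖y' - y‖) :
    Tendsto (divQuot (field σ) x) (𝓝[≠] 0) (𝓝 (3 * ballVol * σ x)) := by
  have hv := ballVol_nonneg
  rw [Metric.tendsto_nhds]
  intro ε hε
  set d : ℝ := min 1 (ε / (24 * ballVol * Λ + 1))
  have hd : 0 < d := by positivity
  have hd1 : d ≤ 1 := min_le_left _ _
  have hdε : 12 * ballVol * Λ * d ≤ ε / 2 := by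
    have hdle : d ≤ ε / (24 * ballVol * Λ + 1) := min_le_right _ _
    rw [le_div_iff₀ (by positivity)] at hdle
    linarith
  have hmean := abs_setIntegral_ball_sub_le hσ.continuous hd (x := x) (η := Λ * d) fun y hy =>
    (hL x (by simp) y (ball_subset_ball (by linarith) hy)).trans
      (mul_le_mul_of_nonneg_left (mem_ball_iff_norm.1 hy).le hΛ)
  have htrunc := Metric.tendsto_nhds.1 (hσ.tendsto_divQuot_truncField hd x) (ε / 2) (half_pos hε)
  have hsmall : ∀ᶠ h in 𝓝[≠] (0 : ℝ), |h| < 1 :=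
    nhdsWithin_le_nhds (continuous_abs.continuousAt.eventually_lt_const (by simp))
  filter_upwards [hsmall, htrunc] with h h1 hclose
  have hnear := hσ.abs_divQuot_field_sub_truncField_le hd.le hΛ (x := x) (h := h) fun i z hz => by
    have hstep : ‖h • coordVec i‖ = |h| := by simp [norm_smul]
    refine (hL (x - z) ?_ (x + h • coordVec i - z) ?_).trans_eq ?_
    · rw [mem_ball_iff_norm, sub_sub_cancel_left, norm_neg]
      linarith
    · rw [mem_ball_iff_norm, add_sub_assoc, add_sub_cancel_left]
      linarith [norm_sub_le (h • coordVec i) z]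
    · rw [sub_sub_sub_cancel_right, add_sub_cancel_left, hstep]
  rw [Real.dist_eq] at hclose ⊢
  have htri := abs_add_three (divQuot (field σ) x h - divQuot (truncField d σ) x h)
    (divQuot (truncField d σ) x h - 3 / d ^ 3 * ∫ y in ball x d, σ y)
    (3 / d ^ 3 * (∫ y in ball x d, σ y) - 3 * ballVol * σ x)
  rw [sub_add_sub_cancel, sub_add_sub_cancel] at htri
  linarith

end FieldDivergence

section LimitInequality

lemma le_of_forall_pos_le_add_mul {a b c : ℝ} (h : ∀ ε > 0, a ≤ b + ε * c) : a ≤ b := by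
  have hlim : Tendsto (fun ε : ℝ => b + ε * c) (𝓝[>] 0) (𝓝 (b + 0 * c)) :=
    ((tendsto_id.mono_left nhdsWithin_le_nhds).mul_const c).const_add b
  rw [zero_mul, add_zero] at hlim
  exact ge_of_tendsto hlim (eventually_mem_nhdsWithin.mono h)

end LimitInequality

section Characteristic

/-- `(X, V)` is the backward characteristic `X' = V`, `V' = -H(τ, X)` on `[0, s]` that ends at
`(x, v)` at time `s`. -/
structure IsCharacteristic {E : Type*} [NormedAddCommGroup E] [NormedSpace ℝ E] (H : ℝ → E → E)
    (s : ℝ) (x v : E) (X V : ℝ → E) : Prop where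
  X_end : X s = x
  V_end : V s = v
  deriv_X : ∀ τ ∈ Icc 0 s, HasDerivWithinAt X (V τ) (Icc 0 s) τ
  deriv_V : ∀ τ ∈ Icc 0 s, HasDerivWithinAt V (-H τ (X τ)) (Icc 0 s) τ

/-- The total field `E + A` generated by the distribution `f`. -/
def force (F : Space3 → ℝ) (f : ℝ → Space3 → Space3 → ℝ) (A : ℝ → Space3 → Space3)
    (s : ℝ) (x : Space3) : Space3 := field (rho F f s) x + A s x

/-- The derivative of `f` on `[0, T) × ℝ³ × ℝ³` in all variables, one-sided in time at `0`. -/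
def fullDeriv (T : ℝ) (f : ℝ → Space3 → Space3 → ℝ) (s : ℝ) (x v : Space3) :
    ℝ × Space3 × Space3 →L[ℝ] ℝ :=
  fderivWithin ℝ (fun z : ℝ × Space3 × Space3 => f z.1 z.2.1 z.2.2) (Ico 0 T ×ˢ univ) (s, x, v)

namespace IsSolution

variable {F : Space3 → ℝ} {f₀ : Space3 → Space3 → ℝ} {A : ℝ → Space3 → Space3} {T : ℝ}
  {f : ℝ → Space3 → Space3 → ℝ}

lemma hasFDerivWithinAt (hS : IsSolution F f₀ A T f) {s : ℝ} (hs : s ∈ Ico 0 T) (x v : Space3) :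
    HasFDerivWithinAt (fun z : ℝ × Space3 × Space3 => f z.1 z.2.1 z.2.2)
      (fullDeriv T f s x v) (Ico 0 T ×ˢ univ) (s, x, v) :=
  (hS.contDiffOn.differentiableOn one_ne_zero (s, x, v) ⟨hs, trivial⟩).hasFDerivWithinAt

lemma derivWithin_time_eq (hS : IsSolution F f₀ A T f) {s : ℝ} (hs : s ∈ Ico 0 T)
    (x v : Space3) : derivWithin (fun s => f s x v) (Ico 0 T) s = fullDeriv T f s x v (1, 0) := by
  have hderiv := (hS.hasFDerivWithinAt hs x v).comp_hasDerivWithinAt s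
    ((hasDerivWithinAt_id s _).prodMk (hasDerivWithinAt_const _ _ (x, v)))
    fun _ hτ => mk_mem_prod hτ (mem_univ _)
  exact hderiv.derivWithin (uniqueDiffOn_Ico 0 T s hs)

lemma inner_gradient_position_eq (hS : IsSolution F f₀ A T f) {s : ℝ} (hs : s ∈ Ico 0 T)
    (x v a : Space3) :
    inner ℝ a (gradient (fun y => f s y v) x) = fullDeriv T f s x v (0, a, 0) := by
  have hderiv := (hS.hasFDerivWithinAt hs x v).comp_hasFDerivAt (f := fun y => (s, y, v)) x
    ((hasFDerivAt_prodMk_right s (x, v)).comp x (hasFDerivAt_prodMk_left x v))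
    (.of_forall fun _ => ⟨hs, trivial⟩)
  rw [inner_gradient_right]
  exact DFunLike.congr_fun hderiv.fderiv a

lemma inner_gradient_velocity_eq (hS : IsSolution F f₀ A T f) {s : ℝ} (hs : s ∈ Ico 0 T)
    (x v a : Space3) :
    inner ℝ a (gradient (fun w => f s x w) v) = fullDeriv T f s x v (0, 0, a) := by
  have hderiv := (hS.hasFDerivWithinAt hs x v).comp_hasFDerivAt (f := fun w => (s, x, w)) v
    ((hasFDerivAt_prodMk_right s (x, v)).comp v (hasFDerivAt_prodMk_right x v))
    (.of_forall fun _ => ⟨hs, trivial⟩)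
  rw [inner_gradient_right]
  exact DFunLike.congr_fun hderiv.fderiv a

lemma fullDeriv_characteristic (hS : IsSolution F f₀ A T f) {s : ℝ} (hs : s ∈ Ico 0 T)
    (x v : Space3) : fullDeriv T f s x v (1, v, -force F f A s x) = 0 := by
  have hsplit : ((1 : ℝ), v, -force F f A s x)
      = (1, 0, 0) + (0, v, 0) - (0, 0, field (rho F f s) x + A s x) := by
    simp [force]
  rw [hsplit, map_sub, map_add, ← Prod.zero_eq_mk, ← hS.derivWithin_time_eq hs,
    ← hS.inner_gradient_position_eq hs, ← hS.inner_gradient_velocity_eq hs]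
  exact hS.vlasov s hs x v

lemma hasDerivWithinAt_comp_zero (hS : IsSolution F f₀ A T f) {θ : ℝ → ℝ} {X V : ℝ → Space3}
    {S : Set ℝ} {a c : ℝ} (ha : a ∈ S) (hθT : MapsTo θ S (Ico 0 T))
    (hθ : HasDerivWithinAt θ c S a) (hX : HasDerivWithinAt X (c • V a) S a)
    (hV : HasDerivWithinAt V (c • -force F f A (θ a) (X a)) S a) :
    HasDerivWithinAt (fun τ => f (θ τ) (X τ) (V τ)) 0 S a := by
  refine ((hS.hasFDerivWithinAt (hθT ha) (X a) (V a)).comp_hasDerivWithinAt a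
    (hθ.prodMk (hX.prodMk hV)) fun τ hτ => mk_mem_prod (hθT hτ) (mem_univ _)).congr_deriv ?_
  have hsmul : (c, c • V a, c • -force F f A (θ a) (X a))
      = c • ((1 : ℝ), V a, -force F f A (θ a) (X a)) := by simp
  rw [hsmul, map_smul, hS.fullDeriv_characteristic (hθT ha), smul_zero]

lemma eq_initial (hS : IsSolution F f₀ A T f) {s : ℝ} (hs : s ∈ Ico 0 T) {x v : Space3}
    {X V : ℝ → Space3} (hc : IsCharacteristic (force F f A) s x v X V) :
    f s x v = f₀ (X 0) (V 0) := by
  have hderiv : ∀ τ ∈ Icc 0 s, HasDerivWithinAt (fun τ => f τ (X τ) (V τ)) 0 (Icc 0 s) τ :=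
    fun τ hτ => hS.hasDerivWithinAt_comp_zero hτ (fun _ h => ⟨h.1, h.2.trans_lt hs.2⟩)
      (hasDerivWithinAt_id τ _) (by simpa using hc.deriv_X τ hτ) (by simpa using hc.deriv_V τ hτ)
  have hconst := constant_of_has_deriv_right_zero
    (fun τ hτ => (hderiv τ hτ).continuousWithinAt)
    (fun τ hτ => (hderiv τ ⟨hτ.1, hτ.2.le⟩).mono_of_mem_nhdsWithin (Icc_mem_nhdsGE_of_mem hτ))
    s ⟨hs.1, le_rfl⟩
  rwa [hc.X_end, hc.V_end, hS.initial] at hconst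

end IsSolution

end Characteristic

section DomainOfDependence

/-- The states `(τ, y, w)` from which a particle with acceleration at most `K` can reach `(x, v)`
at time `s`. -/
def backwardCone (K s : ℝ) (x v : Space3) : Set (ℝ × Space3 × Space3) :=
  {z | z.1 ∈ Icc 0 s ∧ ‖z.2.1 - x‖ ≤ (‖v‖ + K * s) * (s - z.1) ∧ ‖z.2.2 - v‖ ≤ K * (s - z.1)}

variable {K s : ℝ} {x v : Space3}

lemma isCompact_backwardCone (hK : 0 ≤ K) (hs : 0 ≤ s) : IsCompact (backwardCone K s x v) := by
  refine ((isCompact_Icc (a := 0) (b := s)).prod ((isCompact_closedBall x ((‖v‖ + K * s) * s)).prod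
    (isCompact_closedBall v (K * s)))).of_isClosed_subset ?_ ?_
  · have hτ : IsClosed {z : ℝ × Space3 × Space3 | z.1 ∈ Icc 0 s} :=
      isClosed_Icc.preimage continuous_fst
    have hx : IsClosed {z : ℝ × Space3 × Space3 | ‖z.2.1 - x‖ ≤ (‖v‖ + K * s) * (s - z.1)} :=
      isClosed_le (by fun_prop) (by fun_prop)
    have hv : IsClosed {z : ℝ × Space3 × Space3 | ‖z.2.2 - v‖ ≤ K * (s - z.1)} :=
      isClosed_le (by fun_prop) (by fun_prop)
    exact hτ.inter (hx.inter hv)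
  · rintro ⟨τ, y, w⟩ ⟨hτ, hy, hw⟩
    have hτs : s - τ ≤ s := by linarith [hτ.1]
    exact ⟨hτ, mem_closedBall_iff_norm.2 (hy.trans (by gcongr)),
      mem_closedBall_iff_norm.2 (hw.trans (by gcongr))⟩

lemma mem_backwardCone_of_mem (hK : 0 ≤ K) {τ : ℝ} {y w a : Space3}
    (h : (τ, y, w) ∈ backwardCone K s x v) (ha : ‖a‖ ≤ K) {δ : ℝ} (hδ : δ ∈ Icc 0 τ) :
    (τ - δ, y - δ • w, w + δ • a) ∈ backwardCone K s x v := by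
  obtain ⟨hτ, hy, hw⟩ := h
  have hwB : ‖w‖ ≤ ‖v‖ + K * s := by
    have hKτ : K * (s - τ) ≤ K * s := by gcongr; linarith [hτ.1]
    linarith [norm_le_norm_add_norm_sub' w v]
  refine ⟨⟨by linarith [hδ.2], by linarith [hδ.1, hτ.2]⟩, ?_, ?_⟩
  · calc ‖y - δ • w - x‖ = ‖(y - x) - δ • w‖ := by rw [sub_right_comm]
      _ ≤ ‖y - x‖ + δ * ‖w‖ := by
        simpa [norm_smul, abs_of_nonneg hδ.1] using norm_sub_le (y - x) (δ • w)
      _ ≤ (‖v‖ + K * s) * (s - τ) + δ * (‖v‖ + K * s) :=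
        add_le_add hy (mul_le_mul_of_nonneg_left hwB hδ.1)
      _ = (‖v‖ + K * s) * (s - (τ - δ)) := by ring
  · calc ‖w + δ • a - v‖ = ‖(w - v) + δ • a‖ := by rw [add_sub_right_comm]
      _ ≤ ‖w - v‖ + δ * ‖a‖ := by
        simpa [norm_smul, abs_of_nonneg hδ.1] using norm_add_le (w - v) (δ • a)
      _ ≤ K * (s - τ) + δ * K := add_le_add hw (mul_le_mul_of_nonneg_left ha hδ.1)
      _ = K * (s - (τ - δ)) := by ring

lemma deriv_nonpos_of_isMaxOn_left_endpoint {g : ℝ → ℝ} {g' b : ℝ} (hb : 0 < b)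
    (hmax : IsMaxOn g (Icc 0 b) 0) (hg : HasDerivWithinAt g g' (Icc 0 b) 0) : g' ≤ 0 := by
  have hcone : b ∈ posTangentConeAt (Icc 0 b) 0 :=
    mem_posTangentConeAt_of_segment_subset (by rw [zero_add, segment_eq_Icc hb.le])
  have h := hmax.localize.hasFDerivWithinAt_nonpos hg.hasFDerivWithinAt hcone
  exact nonpos_of_mul_nonpos_right (by simpa using h) hb

namespace IsSolution

variable {F : Space3 → ℝ} {f₀ : Space3 → Space3 → ℝ} {A : ℝ → Space3 → Space3} {T : ℝ}
  {f : ℝ → Space3 → Space3 → ℝ}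

-- Otherwise `f` strictly increases backwards in time, faster than `ε τ` decreases, along the curve
-- that leaves `(τ, y, w)` in the characteristic direction and stays in the cone.
lemma eq_zero_of_isMaxOn_backwardCone (hS : IsSolution F f₀ A T f) (hs : s ∈ Ico 0 T)
    (hK : ∀ τ ∈ Icc 0 s, ∀ y, ‖force F f A τ y‖ ≤ K) {ε : ℝ} (hε : 0 < ε) {τ : ℝ} {y w : Space3}
    (hz : (τ, y, w) ∈ backwardCone K s x v)
    (hmax : IsMaxOn (fun z : ℝ × Space3 × Space3 => f z.1 z.2.1 z.2.2 - ε * z.1)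
      (backwardCone K s x v) (τ, y, w)) : τ = 0 := by
  have hK0 : 0 ≤ K := (norm_nonneg _).trans (hK 0 ⟨le_rfl, hs.1⟩ 0)
  by_contra hτ0
  have hτ : 0 < τ := lt_of_le_of_ne hz.1.1 (Ne.symm hτ0)
  set a := force F f A τ y
  have hf : HasDerivWithinAt (fun δ : ℝ => f (τ - δ) (y - δ • w) (w + δ • a)) 0 (Icc 0 τ) 0 := by
    refine hS.hasDerivWithinAt_comp_zero (c := -1) (left_mem_Icc.2 hτ.le)
      (fun δ hδ => ⟨sub_nonneg.2 hδ.2, by linarith [hδ.1, hz.1.2, hs.2]⟩) ?_ ?_ ?_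
    · simpa using (hasDerivWithinAt_id (0 : ℝ) (Icc 0 τ)).const_sub τ
    · simpa using ((hasDerivWithinAt_id (0 : ℝ) (Icc 0 τ)).smul_const w).const_sub y
    · simpa [a] using ((hasDerivWithinAt_id (0 : ℝ) (Icc 0 τ)).smul_const a).const_add w
  have htime : HasDerivWithinAt (fun δ : ℝ => ε * (τ - δ)) (-ε) (Icc 0 τ) 0 := by
    simpa using ((hasDerivWithinAt_id (0 : ℝ) (Icc 0 τ)).const_sub τ).const_mul ε
  have hnonpos := deriv_nonpos_of_isMaxOn_left_endpoint hτ (fun δ hδ => by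
    simpa using hmax (mem_backwardCone_of_mem hK0 hz (hK τ hz.1 y) hδ)) (hf.sub htime)
  linarith

lemma exists_le_initial (hS : IsSolution F f₀ A T f) (hs : s ∈ Ico 0 T)
    (hK : ∀ τ ∈ Icc 0 s, ∀ y, ‖force F f A τ y‖ ≤ K) (x v : Space3) {ε : ℝ} (hε : 0 < ε) :
    ∃ y w, ‖w - v‖ ≤ K * s ∧ f s x v ≤ f₀ y w + ε * s := by
  have hK0 : 0 ≤ K := (norm_nonneg _).trans (hK 0 ⟨le_rfl, hs.1⟩ 0)
  have hvertex : (s, x, v) ∈ backwardCone K s x v := ⟨⟨hs.1, le_rfl⟩, by simp, by simp⟩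
  have hcont : ContinuousOn (fun z : ℝ × Space3 × Space3 => f z.1 z.2.1 z.2.2 - ε * z.1)
      (backwardCone K s x v) :=
    (hS.contDiffOn.continuousOn.mono fun _ hz =>
      ⟨⟨hz.1.1, hz.1.2.trans_lt hs.2⟩, trivial⟩).sub (by fun_prop)
  obtain ⟨⟨τ, y, w⟩, hz, hmax⟩ :=
    (isCompact_backwardCone hK0 hs.1).exists_isMaxOn ⟨_, hvertex⟩ hcont
  obtain rfl := hS.eq_zero_of_isMaxOn_backwardCone hs hK hε hz hmax
  have hle : f s x v - ε * s ≤ f 0 y w - ε * 0 := hmax hvertex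
  rw [hS.initial] at hle
  exact ⟨y, w, by simpa using hz.2.2, by linarith⟩

lemma eq_zero_of_lt (hS : IsSolution F f₀ A T f) (hs : s ∈ Ico 0 T)
    (hK : ∀ τ ∈ Icc 0 s, ∀ y, ‖force F f A τ y‖ ≤ K) {W : ℝ} (hW : ∀ x v, W < ‖v‖ → f₀ x v = 0)
    (x : Space3) (hv : W + K * s < ‖v‖) : f s x v = 0 := by
  refine le_antisymm (le_of_forall_pos_le_add_mul (c := s) fun ε hε => ?_) (hS.nonneg s hs x v)
  obtain ⟨y, w, hw, hf⟩ := hS.exists_le_initial hs hK x v hε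
  rwa [hW y w (by linarith [norm_le_norm_add_norm_sub w v])] at hf

end IsSolution

end DomainOfDependence

section Density

variable {F : Space3 → ℝ} {f₀ : Space3 → Space3 → ℝ} {A : ℝ → Space3 → Space3} {T t Q : ℝ}
  {f : ℝ → Space3 → Space3 → ℝ}

lemma rho_eq_setIntegral {τ : ℝ} {x : Space3} {B : Set Space3} (hF : ∀ v ∉ B, F v = 0)
    (hf : ∀ v ∉ B, f τ x v = 0) : rho F f τ x = ∫ v in B, (F v - f τ x v) := by
  rw [rho, setIntegral_eq_integral_of_forall_compl_eq_zero]
  intro v hv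
  rw [hF v hv, hf v hv, sub_zero]

namespace IsSolution

lemma continuous_velocity (hS : IsSolution F f₀ A T f) {τ : ℝ} (hτ : τ ∈ Ico 0 T) (x : Space3) :
    Continuous (f τ x) :=
  hS.contDiffOn.continuousOn.comp_continuous (f := fun v => (τ, x, v)) (by fun_prop)
    fun _ => ⟨hτ, trivial⟩

lemma abs_rho_sub_le (hS : IsSolution F f₀ A T f) (hFc : Continuous F)
    (hF : ∀ v, Q < ‖v‖ → F v = 0) {τ : ℝ} (hτ : τ ∈ Ico 0 T)
    (hf : ∀ x v, Q < ‖v‖ → f τ x v = 0) {x x' : Space3} {η : ℝ}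
    (hη : ∀ v ∈ closedBall (0 : Space3) Q, |f τ x' v - f τ x v| ≤ η) :
    |rho F f τ x' - rho F f τ x| ≤ η * volume.real (closedBall (0 : Space3) Q) := by
  have hint (x : Space3) : IntegrableOn (fun v => F v - f τ x v) (closedBall 0 Q) :=
    (hFc.sub (hS.continuous_velocity hτ x)).continuousOn.integrableOn_compact
      (isCompact_closedBall _ _)
  have hρ (x : Space3) : rho F f τ x = ∫ v in closedBall 0 Q, (F v - f τ x v) :=
    rho_eq_setIntegral (fun v hv => hF v (by simpa using hv)) fun v hv => hf x v (by simpa using hv)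
  rw [hρ x', hρ x, ← integral_sub (hint x') (hint x), ← Real.norm_eq_abs]
  refine norm_setIntegral_le_of_norm_le_const measure_closedBall_lt_top fun v hv => ?_
  rw [sub_sub_sub_cancel_left, Real.norm_eq_abs, abs_sub_comm]
  exact hη v hv

lemma continuousOn_rho (hS : IsSolution F f₀ A T f) (ht : t < T) (hFc : Continuous F)
    (hF : ∀ v, Q < ‖v‖ → F v = 0) (hf : ∀ τ ∈ Icc 0 t, ∀ x v, Q < ‖v‖ → f τ x v = 0) :
    ContinuousOn (fun z : ℝ × Space3 => rho F f z.1 z.2) (Icc 0 t ×ˢ univ) := by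
  refine continuousOn_integral_of_compact_support (isCompact_closedBall (0 : Space3) Q) ?_ ?_
  · have hfc : ContinuousOn (fun z : (ℝ × Space3) × Space3 => f z.1.1 z.1.2 z.2)
        ((Icc 0 t ×ˢ univ) ×ˢ univ) :=
      hS.contDiffOn.continuousOn.comp
        (f := fun z : (ℝ × Space3) × Space3 => (z.1.1, z.1.2, z.2)) (by fun_prop)
        fun z hz => ⟨⟨hz.1.1.1, hz.1.1.2.trans_lt ht⟩, trivial⟩
    exact (hFc.comp continuous_snd).continuousOn.sub hfc
  · intro z v hz hv
    have hQ : Q < ‖v‖ := by simpa using hv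
    rw [hF v hQ, hf z.1 hz.1 z.2 v hQ, sub_zero]

lemma exists_local_lipschitz_rho (hS : IsSolution F f₀ A T f) (ht : t < T)
    (hFc : Continuous F) (hF : ∀ v, Q < ‖v‖ → F v = 0)
    (hf : ∀ τ ∈ Icc 0 t, ∀ x v, Q < ‖v‖ → f τ x v = 0) (r : ℝ) :
    ∃ L : ℝ, ∀ τ ∈ Icc 0 t, ∀ y ∈ closedBall (0 : Space3) r, ∀ y' ∈ closedBall (0 : Space3) r,
      |rho F f τ y' - rho F f τ y| ≤ L * ‖y' - y‖ := by
  set C : Set (ℝ × Space3 × Space3) := Icc 0 t ×ˢ closedBall 0 r ×ˢ closedBall 0 Q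
  have hC : IsCompact C :=
    isCompact_Icc.prod ((isCompact_closedBall _ _).prod (isCompact_closedBall _ _))
  have hCT : C ⊆ Ico 0 T ×ˢ univ := fun z hz => ⟨⟨hz.1.1, hz.1.2.trans_lt ht⟩, trivial⟩
  have hloc : LocallyLipschitzOn (Ico 0 T ×ˢ univ)
      fun z : ℝ × Space3 × Space3 => f z.1 z.2.1 z.2.2 := fun z hz =>
    (hS.contDiffOn z hz).exists_lipschitzOnWith ((convex_Ico _ _).prod convex_univ)
  obtain ⟨L, hL⟩ := (hloc.mono hCT).exists_lipschitzOnWith_of_compact hC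
  refine ⟨L * volume.real (closedBall (0 : Space3) Q), fun τ hτ y hy y' hy' => ?_⟩
  refine (hS.abs_rho_sub_le hFc hF ⟨hτ.1, hτ.2.trans_lt ht⟩ (hf τ hτ)
    (η := L * ‖y' - y‖) fun v hv => ?_).trans_eq (by ring)
  simpa [Prod.norm_def] using hL.norm_sub_le (show (τ, y', v) ∈ C from ⟨hτ, hy', hv⟩)
    (show (τ, y, v) ∈ C from ⟨hτ, hy, hv⟩)

end IsSolution

end Density

section FieldContinuity

variable {t p M : ℝ} {σ : ℝ → Space3 → ℝ}

lemma norm_comp_sub_smul_truncKernel_zero_le (hp : 0 ≤ p) {σ : Space3 → ℝ}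
    (hσ : ∀ y, |σ y| ≤ M * R y ^ (-p)) {x x₀ : Space3} (hx : ‖x₀ - x‖ ≤ 1 / 2) (y : Space3) :
    ‖σ (x - y) • truncKernel 0 y‖ ≤ M * 2 ^ p * (R (x₀ - y) ^ (-p) * (‖y‖ ^ 2)⁻¹) := by
  have hM : 0 ≤ M := nonneg_of_abs_le_mul_R_rpow hσ
  have hR : 0 < R (x₀ - y) := R_pos _
  have hweight : R (x - y) ^ (-p) ≤ 2 ^ p * R (x₀ - y) ^ (-p) :=
    R_rpow_neg_le_of_norm_sub_le hp (by
      rw [sub_sub_sub_cancel_right]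
      linarith [one_le_R (x₀ - y)])
  calc ‖σ (x - y) • truncKernel 0 y‖ = |σ (x - y)| * ‖truncKernel 0 y‖ := norm_smul _ _
    _ ≤ M * (2 ^ p * R (x₀ - y) ^ (-p)) * (‖y‖ ^ 2)⁻¹ := by
      gcongr
      · exact (hσ _).trans (by gcongr)
      · exact norm_truncKernel_le 0 y
    _ = M * 2 ^ p * (R (x₀ - y) ^ (-p) * (‖y‖ ^ 2)⁻¹) := by ring

lemma continuousOn_field (hp : 3 < p)
    (hσ : ContinuousOn (fun z : ℝ × Space3 => σ z.1 z.2) (Icc 0 t ×ˢ univ))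
    (hb : ∀ τ ∈ Icc 0 t, ∀ y, |σ τ y| ≤ M * R y ^ (-p)) :
    ContinuousOn (fun z : ℝ × Space3 => field (σ z.1) z.2) (Icc 0 t ×ˢ univ) := by
  rintro ⟨τ₀, x₀⟩ hz₀
  simp only [field_eq_truncField_zero, truncField_eq_integral_comp_sub]
  have hnear : ∀ᶠ z : ℝ × Space3 in 𝓝[Icc 0 t ×ˢ univ] (τ₀, x₀), ‖x₀ - z.2‖ < 1 / 2 :=
    nhdsWithin_le_nhds <| (by fun_prop : ContinuousAt (fun z : ℝ × Space3 => ‖x₀ - z.2‖)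
      (τ₀, x₀)).eventually_lt_const (by simp)
  refine continuousWithinAt_of_dominated
    (bound := fun y => M * 2 ^ p * (R (x₀ - y) ^ (-p) * (‖y‖ ^ 2)⁻¹)) ?_ ?_ ?_ ?_
  · filter_upwards [self_mem_nhdsWithin] with z hz
    have hcont : Continuous fun y => σ z.1 (z.2 - y) :=
      hσ.comp_continuous (f := fun y => (z.1, z.2 - y)) (by fun_prop) fun _ => ⟨hz.1, trivial⟩
    exact hcont.aestronglyMeasurable.smul (measurable_truncKernel 0).aestronglyMeasurable
  · filter_upwards [self_mem_nhdsWithin, hnear] with z hz hzn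
    exact .of_forall fun y =>
      norm_comp_sub_smul_truncKernel_zero_le (by linarith) (hb z.1 hz.1) hzn.le y
  · simpa using ((integrable_R_rpow_neg_mul_inv_norm_sq hp x₀).comp_sub_left x₀).const_mul
      (M * 2 ^ p)
  · refine .of_forall fun y => ?_
    have hσy : ContinuousWithinAt (fun z : ℝ × Space3 => σ z.1 (z.2 - y)) (Icc 0 t ×ˢ univ)
        (τ₀, x₀) :=
      ContinuousWithinAt.comp (f := fun z : ℝ × Space3 => (z.1, z.2 - y))
        (g := fun z : ℝ × Space3 => σ z.1 z.2)
        (hσ (τ₀, x₀ - y) ⟨hz₀.1, trivial⟩) (by fun_prop) fun z hz => ⟨hz.1, trivial⟩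
    exact hσy.smul continuousWithinAt_const

end FieldContinuity

section ExistenceOfCharacteristics

variable {E : Type*} [NormedAddCommGroup E] [NormedSpace ℝ E] {H : ℝ → E → E} {s : ℝ}

/-- The characteristic system `X' = V`, `V' = -H(τ, X)` in the sheared coordinates
`(X - (τ - s) V, V)`. Here free transport is constant, so that a bounded `H` makes the whole vector
field bounded and the Picard–Lindelöf theorem applies on all of `[0, s]` at once. -/
def shearedField (H : ℝ → E → E) (s τ : ℝ) (z : E × E) : E × E :=
  ((τ - s) • H τ (z.1 + (τ - s) • z.2), -H τ (z.1 + (τ - s) • z.2))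

lemma abs_sub_le_of_mem_Icc {τ : ℝ} (hτ : τ ∈ Icc 0 s) : |τ - s| ≤ s := by
  rw [abs_le]
  constructor <;> linarith [hτ.1, hτ.2]

lemma norm_fst_add_smul_snd_le {c : ℝ} (hc : |c| ≤ s) (z : E × E) :
    ‖z.1 + c • z.2‖ ≤ (s + 1) * ‖z‖ :=
  calc ‖z.1 + c • z.2‖ ≤ ‖z.1‖ + |c| * ‖z.2‖ := by
        simpa [norm_smul] using norm_add_le z.1 (c • z.2)
    _ ≤ ‖z‖ + s * ‖z‖ := by
        gcongr
        · exact norm_fst_le z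
        · exact (abs_nonneg c).trans hc
        · exact norm_snd_le z
    _ = (s + 1) * ‖z‖ := by ring

lemma norm_smul_neg_le {c : ℝ} (hc : |c| ≤ s) (a : E) : ‖(c • a, -a)‖ ≤ (s + 1) * ‖a‖ := by
  have hs : 0 ≤ s := (abs_nonneg c).trans hc
  rw [Prod.norm_def, sup_le_iff, norm_smul, norm_neg, Real.norm_eq_abs]
  constructor
  · gcongr
    linarith
  · exact le_mul_of_one_le_left (norm_nonneg a) (by linarith)

lemma norm_shearedField_le {K τ : ℝ} (hτ : τ ∈ Icc 0 s) (hK : ∀ y, ‖H τ y‖ ≤ K) (z : E × E) :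
    ‖shearedField H s τ z‖ ≤ (s + 1) * K :=
  (norm_smul_neg_le (abs_sub_le_of_mem_Icc hτ) _).trans
    (mul_le_mul_of_nonneg_left (hK _) (by linarith [hτ.1, hτ.2]))

lemma lipschitzOnWith_shearedField {τ r : ℝ} (hτ : τ ∈ Icc 0 s) {L S : ℝ≥0} (hS : S = s + 1)
    (hL : LipschitzOnWith L (H τ) (closedBall 0 (S * r))) :
    LipschitzOnWith (S * (L * S)) (shearedField H s τ) (closedBall 0 r) := by
  have hc := abs_sub_le_of_mem_Icc hτ
  have hpos (z : E × E) : ‖z.1 + (τ - s) • z.2‖ ≤ S * ‖z‖ := hS ▸ norm_fst_add_smul_snd_le hc z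
  have hball {z : E × E} (hz : z ∈ closedBall (0 : E × E) r) :
      z.1 + (τ - s) • z.2 ∈ closedBall (0 : E) (S * r) :=
    mem_closedBall_zero_iff.2 ((hpos z).trans
      (mul_le_mul_of_nonneg_left (mem_closedBall_zero_iff.1 hz) S.2))
  refine LipschitzOnWith.of_dist_le_mul fun z hz z' hz' => ?_
  rw [dist_eq_norm, dist_eq_norm, NNReal.coe_mul, NNReal.coe_mul]
  have hH : ‖H τ (z.1 + (τ - s) • z.2) - H τ (z'.1 + (τ - s) • z'.2)‖ ≤ L * (S * ‖z - z'‖) := by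
    refine (hL.norm_sub_le (hball hz) (hball hz')).trans ?_
    gcongr
    rw [add_sub_add_comm, ← smul_sub]
    exact hpos (z - z')
  calc ‖shearedField H s τ z - shearedField H s τ z'‖
      ≤ S * ‖H τ (z.1 + (τ - s) • z.2) - H τ (z'.1 + (τ - s) • z'.2)‖ := by
        simp only [shearedField, Prod.mk_sub_mk, ← smul_sub, neg_sub_neg]
        rw [← neg_sub (H τ (z.1 + (τ - s) • z.2)), hS]
        exact norm_smul_neg_le hc _
    _ ≤ S * (L * (S * ‖z - z'‖)) := by gcongr
    _ = S * (L * S) * ‖z - z'‖ := by ring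

lemma continuousOn_shearedField
    (hH : ContinuousOn (fun z : ℝ × E => H z.1 z.2) (Icc 0 s ×ˢ univ)) (z : E × E) :
    ContinuousOn (shearedField H s · z) (Icc 0 s) := by
  have hcomp : ContinuousOn (fun τ => H τ (z.1 + (τ - s) • z.2)) (Icc 0 s) :=
    hH.comp (f := fun τ : ℝ => (τ, z.1 + (τ - s) • z.2)) (by fun_prop) fun τ hτ => ⟨hτ, trivial⟩
  exact ((by fun_prop : ContinuousOn (fun τ : ℝ => τ - s) (Icc 0 s)).smul hcomp).prodMk hcomp.neg

lemma isCharacteristic_of_shearedField {x v : E} {α : ℝ → E × E} (hα : α s = (x, v))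
    (hderiv : ∀ τ ∈ Icc 0 s, HasDerivWithinAt α (shearedField H s τ (α τ)) (Icc 0 s) τ) :
    IsCharacteristic H s x v (fun τ => (α τ).1 + (τ - s) • (α τ).2) fun τ => (α τ).2 where
  X_end := by simp [hα]
  V_end := by simp [hα]
  deriv_X τ hτ := by
    have hfst : HasDerivWithinAt (fun τ => (α τ).1) (shearedField H s τ (α τ)).1 (Icc 0 s) τ :=
      (hasFDerivAt_fst (p := α τ)).comp_hasDerivWithinAt τ (hderiv τ hτ)
    have hsnd : HasDerivWithinAt (fun τ => (α τ).2) (shearedField H s τ (α τ)).2 (Icc 0 s) τ :=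
      (hasFDerivAt_snd (p := α τ)).comp_hasDerivWithinAt τ (hderiv τ hτ)
    exact (hfst.add (((hasDerivWithinAt_id τ _).sub_const s).smul hsnd)).congr_deriv
      (by simp [shearedField])
  deriv_V τ hτ := (hasFDerivAt_snd (p := α τ)).comp_hasDerivWithinAt τ (hderiv τ hτ)

lemma exists_isCharacteristic [CompleteSpace E] (hs : 0 ≤ s) {K : ℝ}
    (hH : ContinuousOn (fun z : ℝ × E => H z.1 z.2) (Icc 0 s ×ˢ univ))
    (hK : ∀ τ ∈ Icc 0 s, ∀ y, ‖H τ y‖ ≤ K)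
    (hL : ∀ r, ∃ L : ℝ≥0, ∀ τ ∈ Icc 0 s, LipschitzOnWith L (H τ) (closedBall 0 r)) (x v : E) :
    ∃ X V, IsCharacteristic H s x v X V := by
  have hK0 : 0 ≤ K := (norm_nonneg _).trans (hK s ⟨hs, le_rfl⟩ 0)
  lift K to ℝ≥0 using hK0
  obtain ⟨S, hS⟩ : ∃ S : ℝ≥0, (S : ℝ) = s + 1 := ⟨⟨s + 1, by positivity⟩, rfl⟩
  obtain ⟨a, ha⟩ : ∃ a : ℝ≥0, (a : ℝ) = S * K * s := ⟨⟨S * K * s, by positivity⟩, rfl⟩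
  obtain ⟨L, hL⟩ := hL (S * (‖(x, v)‖ + a))
  have hpl : IsPicardLindelof (shearedField H s) (tmin := 0) (tmax := s) ⟨s, hs, le_rfl⟩ (x, v)
      a 0 (S * K) (S * (L * S)) :=
    { lipschitzOnWith := fun τ hτ => (lipschitzOnWith_shearedField hτ hS (hL τ hτ)).mono
        (closedBall_subset_closedBall' (by rw [dist_zero_right, add_comm]))
      continuousOn := fun z _ => continuousOn_shearedField hH z
      norm_le := fun τ hτ z _ => by
        rw [NNReal.coe_mul, hS]
        exact norm_shearedField_le hτ (hK τ hτ) z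
      mul_max_le := by simp [ha, hs] }
  obtain ⟨α, hα, hderiv⟩ := hpl.exists_eq_forall_mem_Icc_hasDerivWithinAt₀
  exact ⟨_, _, isCharacteristic_of_shearedField hα hderiv⟩

end ExistenceOfCharacteristics

section Gronwall

variable {E : Type*} [NormedAddCommGroup E] [NormedSpace ℝ E] {s ε : ℝ} {κ κI : ℝ → ℝ}

lemma norm_add_le_mul_exp_of_norm_deriv_lt {g g' : ℝ → E} (hκ : ∀ τ, HasDerivAt κI (κ τ) τ)
    (hg : ∀ τ ∈ Icc 0 s, HasDerivWithinAt g (g' τ) (Icc 0 s) τ)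
    (hlt : ∀ τ ∈ Icc 0 s, ‖g' τ‖ < κ τ * (‖g τ‖ + ε)) {τ : ℝ} (hτ : τ ∈ Icc 0 s) :
    ‖g τ‖ + ε ≤ (‖g s‖ + ε) * Real.exp (κI s - κI τ) := by
  have hrev : MapsTo (fun σ : ℝ => s - σ) (Icc 0 s) (Icc 0 s) := fun σ hσ =>
    ⟨by linarith [hσ.2], by linarith [hσ.1]⟩
  have hgrev : ∀ σ ∈ Icc 0 s,
      HasDerivWithinAt (fun σ => g (s - σ)) (-g' (s - σ)) (Icc 0 s) σ := fun σ hσ =>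
    ((hg _ (hrev hσ)).scomp σ ((hasDerivWithinAt_id σ _).const_sub s) hrev).congr_deriv (by simp)
  have hbound (σ : ℝ) : HasDerivAt (fun σ => (‖g s‖ + ε) * Real.exp (κI s - κI (s - σ)) - ε)
      (κ (s - σ) * ((‖g s‖ + ε) * Real.exp (κI s - κI (s - σ)))) σ := by
    have hκrev : HasDerivAt (fun σ => κI (s - σ)) (-κ (s - σ)) σ :=
      (hκ (s - σ)).comp_const_sub s σ
    exact (((hκrev.const_sub (κI s)).exp.const_mul _).sub_const ε).congr_deriv (by ring)
  have hle := image_norm_le_of_norm_deriv_right_lt_deriv_boundary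
    (fun σ hσ => (hgrev σ hσ).continuousWithinAt)
    (fun σ hσ => (hgrev σ ⟨hσ.1, hσ.2.le⟩).mono_of_mem_nhdsWithin (Icc_mem_nhdsGE_of_mem hσ))
    (by simp) hbound (fun σ hσ heq => by
      rw [norm_neg, sub_eq_iff_eq_add.1 heq.symm]
      exact hlt _ (hrev ⟨hσ.1, hσ.2.le⟩)) (hrev hτ)
  rw [sub_sub_cancel] at hle
  linarith

lemma IsCharacteristic.norm_sub_le {H : ℝ → E → E} {x v x' v' : E} {X V X' V' : ℝ → E}
    (hc : IsCharacteristic H s x v X V) (hc' : IsCharacteristic H s x' v' X' V') (hε : 0 < ε)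
    (hκI : ∀ τ, HasDerivAt κI (κ τ) τ) (hκ : ∀ τ ∈ Icc 0 s, 1 < κ τ)
    (hH : ∀ τ ∈ Icc 0 s, ‖H τ (X' τ) - H τ (X τ)‖ < κ τ * (‖(X' τ - X τ, V' τ - V τ)‖ + ε))
    {τ : ℝ} (hτ : τ ∈ Icc 0 s) :
    ‖(X' τ - X τ, V' τ - V τ)‖ + ε ≤ (‖(x' - x, v' - v)‖ + ε) * Real.exp (κI s - κI τ) := by
  rw [← hc.X_end, ← hc.V_end, ← hc'.X_end, ← hc'.V_end]
  refine norm_add_le_mul_exp_of_norm_deriv_lt (g := fun τ => (X' τ - X τ, V' τ - V τ)) hκI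
    (fun τ hτ => ((hc'.deriv_X τ hτ).sub (hc.deriv_X τ hτ)).prodMk
      ((hc'.deriv_V τ hτ).sub (hc.deriv_V τ hτ))) (fun τ hτ => ?_) hτ
  rw [Prod.norm_def, sup_lt_iff, neg_sub_neg, norm_sub_rev (H τ (X τ))]
  refine ⟨?_, hH τ hτ⟩
  calc ‖V' τ - V τ‖ ≤ ‖(X' τ - X τ, V' τ - V τ)‖ := norm_snd_le (X' τ - X τ, V' τ - V τ)
    _ < ‖(X' τ - X τ, V' τ - V τ)‖ + ε := lt_add_of_pos_right _ hε
    _ ≤ κ τ * (‖(X' τ - X τ, V' τ - V τ)‖ + ε) :=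
      le_mul_of_one_le_left (by positivity) (hκ τ hτ).le

end Gronwall

section Halving

lemma two_mul_mem_of_isClosed_of_halving {S : Set ℝ} (hS : IsClosed S) {a m : ℝ} (ha : 0 ≤ a)
    (hm : 2 * a ≤ m) (hmS : m ∈ S) (hstep : ∀ m ∈ S, 0 ≤ m → a + m / 2 ∈ S) : 2 * a ∈ S := by
  have hmem (n : ℕ) : 2 * a + (m - 2 * a) / 2 ^ n ∈ S := by
    induction n with
    | zero => simpa using hmS
    | succ n ih =>
      have hpos : 0 ≤ (m - 2 * a) / 2 ^ n := div_nonneg (by linarith) (by positivity)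
      convert hstep _ ih (by linarith) using 1
      rw [pow_succ]
      field_simp
      ring
  have hlim : Tendsto (fun n : ℕ => (m - 2 * a) / 2 ^ n) atTop (𝓝 0) :=
    tendsto_const_nhds.div_atTop (tendsto_pow_atTop_atTop_of_one_lt one_lt_two)
  have hlim' := hlim.const_add (2 * a)
  rw [add_zero] at hlim'
  exact hS.mem_of_tendsto hlim' (.of_forall hmem)

end Halving

section LogLipschitzTransport

variable {E : Type*} [NormedAddCommGroup E] {H : ℝ → E → E} {f₀ : E → E → ℝ}
  {f : ℝ → E → E → ℝ} {t L₀ B₀ c₁ ε m : ℝ}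

/-- `f s` is Lipschitz on `[0, t]` up to an additive error `ε`, with a constant that grows doubly
exponentially in time. `m` is the parameter improved by iteration. -/
def HasApproxLipBound (f : ℝ → E → E → ℝ) (t c ε m : ℝ) : Prop :=
  ∀ s ∈ Icc 0 t, ∀ x v x' v', |f s x' v' - f s x v| ≤
    Real.exp (1 + m * Real.exp (2 * c * s)) * (‖(x' - x, v' - v)‖ + ε)

/-- A Lipschitz bound `Λ` on `f` up to the error `ε` makes `H` Lipschitz, up to the same error,
with a constant of order `log Λ`. -/
def IsLogLipschitzForce (H : ℝ → E → E) (f : ℝ → E → E → ℝ) (t c₁ ε : ℝ) : Prop :=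
  ∀ τ ∈ Icc 0 t, ∀ Λ, 2 ≤ Λ → (∀ x x' v, |f τ x' v - f τ x v| ≤ Λ * (‖x' - x‖ + ε)) →
    ∀ y y', ‖H τ y' - H τ y‖ ≤ c₁ * (1 + Real.log Λ) * (‖y' - y‖ + ε)

lemma isClosed_setOf_hasApproxLipBound (f : ℝ → E → E → ℝ) (t c ε : ℝ) :
    IsClosed {m | HasApproxLipBound f t c ε m} := by
  simp only [HasApproxLipBound, ofPred_forall]
  exact isClosed_biInter fun s _ => isClosed_iInter fun x => isClosed_iInter fun v =>
    isClosed_iInter fun x' => isClosed_iInter fun v' =>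
      isClosed_le continuous_const (by fun_prop)

lemma HasApproxLipBound.norm_force_sub_lt (hH : IsLogLipschitzForce H f t c₁ ε) (hc₁ : 0 ≤ c₁)
    (hε : 0 < ε) (hm : 0 ≤ m) {c : ℝ} (hc : 2 * c₁ < c) (hf : HasApproxLipBound f t c ε m)
    {τ : ℝ} (hτ : τ ∈ Icc 0 t) (y y' w : E) :
    ‖H τ y' - H τ y‖ < c * (1 + m * Real.exp (2 * c * τ)) * (‖(y' - y, w)‖ + ε) := by
  have he : 0 ≤ m * Real.exp (2 * c * τ) := by positivity
  have hforce := hH τ hτ (Real.exp (1 + m * Real.exp (2 * c * τ)))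
    (by linarith [Real.add_one_le_exp (1 + m * Real.exp (2 * c * τ))])
    (fun y y' w => by simpa [Prod.norm_def] using hf τ hτ y w y' w) y y'
  rw [Real.log_exp] at hforce
  calc ‖H τ y' - H τ y‖
      ≤ c₁ * (1 + (1 + m * Real.exp (2 * c * τ))) * (‖y' - y‖ + ε) := hforce
    _ ≤ c₁ * (1 + (1 + m * Real.exp (2 * c * τ))) * (‖(y' - y, w)‖ + ε) := by
      gcongr
      exact norm_fst_le (y' - y, w)
    _ < c * (1 + m * Real.exp (2 * c * τ)) * (‖(y' - y, w)‖ + ε) := by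
      refine mul_lt_mul_of_pos_right ?_ (by positivity)
      nlinarith [mul_nonneg hc₁ he]

variable [NormedSpace ℝ E]

/-- On `[0, t]` the values of `f` are transported from `f₀` along the characteristics of `H`. -/
def IsTransported (H : ℝ → E → E) (f₀ : E → E → ℝ) (t : ℝ) (f : ℝ → E → E → ℝ) : Prop :=
  ∀ s ∈ Icc 0 t, ∀ x v, ∃ X V, IsCharacteristic H s x v X V ∧ f s x v = f₀ (X 0) (V 0)

lemma IsTransported.hasApproxLipBound_of_le (hf : IsTransported H f₀ t f) {c : ℝ} (hc : 0 ≤ c)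
    (hε : 0 < ε) (hB₀ : ∀ x v, |f₀ x v| ≤ B₀) (hm : 0 ≤ m) (hBm : 2 * B₀ ≤ m * ε) :
    HasApproxLipBound f t c ε m := by
  intro s hs x v x' v'
  have hfB (x v : E) : |f s x v| ≤ B₀ := by
    obtain ⟨X, V, -, hXV⟩ := hf s hs x v
    exact hXV ▸ hB₀ _ _
  have hexp : m ≤ Real.exp (1 + m * Real.exp (2 * c * s)) :=
    calc m ≤ m * Real.exp (2 * c * s) :=
          le_mul_of_one_le_right hm (Real.one_le_exp (mul_nonneg (by positivity) hs.1))
      _ ≤ Real.exp (1 + m * Real.exp (2 * c * s)) := by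
          linarith [Real.add_one_le_exp (1 + m * Real.exp (2 * c * s))]
  calc |f s x' v' - f s x v| ≤ |f s x' v'| + |f s x v| := abs_sub _ _
    _ ≤ 2 * B₀ := by linarith [hfB x v, hfB x' v']
    _ ≤ m * ε := hBm
    _ ≤ Real.exp (1 + m * Real.exp (2 * c * s)) * (‖(x' - x, v' - v)‖ + ε) := by
      gcongr
      exact le_add_of_nonneg_left (norm_nonneg _)

-- Grönwall with the rate `c (1 + m e ^ (2cτ))`: integrating the rate over time gains the factor
-- `1 / 2` in front of `m`.
lemma HasApproxLipBound.half (hf : IsTransported H f₀ t f) (hL₀ : 1 ≤ L₀)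
    (hf₀ : ∀ x v x' v', |f₀ x' v' - f₀ x v| ≤ L₀ * ‖(x' - x, v' - v)‖) (hc₁ : 0 ≤ c₁)
    (hH : IsLogLipschitzForce H f t c₁ ε) (hε : 0 < ε) (hm : 0 ≤ m) {c : ℝ} (hc1 : 1 < c)
    (hc : 2 * c₁ < c) (hfm : HasApproxLipBound f t c ε m) :
    HasApproxLipBound f t c ε (Real.log L₀ + c * t + m / 2) := by
  intro s hs x v x' v'
  obtain ⟨X, V, hXV, hf_eq⟩ := hf s hs x v
  obtain ⟨X', V', hXV', hf'_eq⟩ := hf s hs x' v'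
  have hrate (τ : ℝ) : HasDerivAt (fun τ => c * τ + m / 2 * Real.exp (2 * c * τ))
      (c * (1 + m * Real.exp (2 * c * τ))) τ :=
    (((hasDerivAt_id τ).const_mul c).add
      (((hasDerivAt_id τ).const_mul (2 * c)).exp.const_mul (m / 2))).congr_deriv (by simp; ring)
  have hgrowth := hXV.norm_sub_le hXV' hε hrate
    (fun τ _ => by nlinarith [show 0 ≤ m * Real.exp (2 * c * τ) by positivity])
    (fun τ hτ => hfm.norm_force_sub_lt hH hc₁ hε hm hc ⟨hτ.1, hτ.2.trans hs.2⟩ _ _ _)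
    ⟨le_rfl, hs.1⟩
  set Φ := c * s + m / 2 * Real.exp (2 * c * s) - (c * 0 + m / 2 * Real.exp (2 * c * 0)) with hΦ
  have hexp : L₀ * Real.exp Φ
      ≤ Real.exp (1 + (Real.log L₀ + c * t + m / 2) * Real.exp (2 * c * s)) := by
    have hlog : 0 ≤ Real.log L₀ := Real.log_nonneg hL₀
    have ht : 0 ≤ t := hs.1.trans hs.2
    have hgrow : Real.log L₀ + c * t ≤ (Real.log L₀ + c * t) * Real.exp (2 * c * s) :=
      le_mul_of_one_le_right (by positivity)
        (Real.one_le_exp (mul_nonneg (by positivity) hs.1))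
    have hcs : c * s ≤ c * t := mul_le_mul_of_nonneg_left hs.2 (by linarith)
    nth_rewrite 1 [← Real.exp_log (by linarith : 0 < L₀)]
    rw [← Real.exp_add, Real.exp_le_exp, hΦ, mul_zero, mul_zero, Real.exp_zero]
    linarith
  calc |f s x' v' - f s x v| ≤ L₀ * ‖(X' 0 - X 0, V' 0 - V 0)‖ := by
        rw [hf_eq, hf'_eq]
        exact hf₀ _ _ _ _
    _ ≤ L₀ * ((‖(x' - x, v' - v)‖ + ε) * Real.exp Φ) := by
      gcongr
      linarith
    _ = L₀ * Real.exp Φ * (‖(x' - x, v' - v)‖ + ε) := by ring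
    _ ≤ _ := by gcongr

/-- The Lipschitz constant on `[0, t]` that results from the logarithmic Grönwall argument. -/
def transportLipConst (L₀ c₁ t : ℝ) : ℝ :=
  Real.exp (1 + 2 * (Real.log L₀ + (2 * c₁ + 2) * t) * Real.exp (2 * (2 * c₁ + 2) * t))

lemma IsTransported.abs_sub_le (hf : IsTransported H f₀ t f) (hL₀ : 1 ≤ L₀)
    (hf₀ : ∀ x v x' v', |f₀ x' v' - f₀ x v| ≤ L₀ * ‖(x' - x, v' - v)‖)
    (hB₀ : ∀ x v, |f₀ x v| ≤ B₀) (hc₁ : 0 ≤ c₁)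
    (hH : ∀ ε > 0, IsLogLipschitzForce H f t c₁ ε) {s : ℝ} (hs : s ∈ Icc 0 t) (x v x' v' : E) :
    |f s x' v' - f s x v| ≤ transportLipConst L₀ c₁ t * ‖(x' - x, v' - v)‖ := by
  set c := 2 * c₁ + 2
  set a := Real.log L₀ + c * t
  have ha : 0 ≤ a := add_nonneg (Real.log_nonneg hL₀)
    (mul_nonneg (by positivity) (hs.1.trans hs.2))
  have hB : 0 ≤ B₀ := (abs_nonneg _).trans (hB₀ 0 0)
  have happrox (ε : ℝ) (hε : 0 < ε) : HasApproxLipBound f t c ε (2 * a) :=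
    two_mul_mem_of_isClosed_of_halving (isClosed_setOf_hasApproxLipBound f t c ε) ha
      (le_add_of_nonneg_right (by positivity : 0 ≤ 2 * B₀ / ε))
      (hf.hasApproxLipBound_of_le (by positivity) hε hB₀ (by positivity) (by
        rw [add_mul, div_mul_cancel₀ _ hε.ne']
        exact le_add_of_nonneg_left (by positivity)))
      fun m hm hm0 => hm.half hf hL₀ hf₀ hc₁ (hH ε hε) hε hm0 (by linarith) (by linarith)
  have hexp : Real.exp (1 + 2 * a * Real.exp (2 * c * s)) ≤ transportLipConst L₀ c₁ t := by
    unfold transportLipConst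
    gcongr
    exact hs.2
  refine le_of_forall_pos_le_add_mul (c := transportLipConst L₀ c₁ t) fun ε hε => ?_
  calc |f s x' v' - f s x v|
      ≤ Real.exp (1 + 2 * a * Real.exp (2 * c * s)) * (‖(x' - x, v' - v)‖ + ε) :=
        happrox ε hε s hs x v x' v'
    _ ≤ transportLipConst L₀ c₁ t * (‖(x' - x, v' - v)‖ + ε) := by gcongr
    _ = _ := by ring

end LogLipschitzTransport

section DeterminantNearOne

lemma abs_det_one_add_sub_le {B : Matrix (Fin 3) (Fin 3) ℝ} {b : ℝ} (hb : b ≤ 1)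
    (hB : ∀ i j, |B i j| ≤ b) : |(1 + B).det - 1| ≤ |B.trace| + 12 * b ^ 2 := by
  have : 0 ≤ b := (abs_nonneg _).trans (hB 0 0)
  have hminor (i j : Fin 3) : |(B.submatrix ![i, j] ![i, j]).det| ≤ 2 * b ^ 2 := by
    simpa using Matrix.det_le (A := B.submatrix ![i, j] ![i, j]) (abv := AbsoluteValue.abs)
      (x := b) fun k l => hB _ _
  have hdet : |B.det| ≤ 6 * b ^ 2 :=
    calc |B.det| ≤ 6 * b ^ 3 := by
          simpa [Nat.factorial] using
            Matrix.det_le (A := B) (abv := AbsoluteValue.abs) (x := b) fun i j => hB i j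
      _ = 6 * b ^ 2 * b := by ring
      _ ≤ 6 * b ^ 2 := mul_le_of_le_one_right (by positivity) hb
  have hexpand : (1 + B).det - 1 = B.trace + ((B.submatrix ![0, 1] ![0, 1]).det
      + (B.submatrix ![0, 2] ![0, 2]).det + (B.submatrix ![1, 2] ![1, 2]).det + B.det) := by
    simp only [Matrix.det_fin_two, Matrix.submatrix_apply, Matrix.cons_val_zero,
      Matrix.cons_val_one, Matrix.det_fin_three, Matrix.trace_fin_three, Matrix.add_apply,
      Matrix.one_fin_three, Matrix.of_apply, Matrix.cons_val]
    ring
  rw [hexpand]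
  refine (abs_add_le _ _).trans (add_le_add_right ?_ _)
  have htri := abs_add_three (B.submatrix ![0, 1] ![0, 1]).det (B.submatrix ![0, 2] ![0, 2]).det
    (B.submatrix ![1, 2] ![1, 2]).det
  linarith [abs_add_le ((B.submatrix ![0, 1] ![0, 1]).det + (B.submatrix ![0, 2] ![0, 2]).det
    + (B.submatrix ![1, 2] ![1, 2]).det) B.det, hminor 0 1, hminor 0 2, hminor 1 2]

lemma abs_det_sub_one_le {D : Space3 →L[ℝ] Space3} {b : ℝ} (hb : b ≤ 1)
    (hD : ‖D - ContinuousLinearMap.id ℝ Space3‖ ≤ b) :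
    |D.det - 1| ≤ |∑ i, D (coordVec i) i - 3| + 12 * b ^ 2 := by
  set B : Matrix (Fin 3) (Fin 3) ℝ := .of fun i j => (D (coordVec j) - coordVec j) i with hB
  have hBb (i j : Fin 3) : |B i j| ≤ b :=
    calc |B i j| ≤ ‖(D - ContinuousLinearMap.id ℝ Space3) (coordVec j)‖ :=
          PiLp.norm_apply_le (D (coordVec j) - coordVec j) i
      _ ≤ ‖D - ContinuousLinearMap.id ℝ Space3‖ := by
          simpa using (D - ContinuousLinearMap.id ℝ Space3).le_opNorm (coordVec j)
      _ ≤ b := hD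
  have hdet : D.det = (1 + B).det := by
    rw [ContinuousLinearMap.det,
      ← LinearMap.det_toMatrix (EuclideanSpace.basisFun (Fin 3) ℝ).toBasis]
    congr 1
    ext i j
    simp [LinearMap.toMatrix_apply, hB, Matrix.one_apply]
  have htrace : B.trace = ∑ i, D (coordVec i) i - 3 := by
    simp [Matrix.trace, hB]
  rw [hdet, ← htrace]
  exact abs_det_one_add_sub_le hb hBb

end DeterminantNearOne

section ChangeOfVariables

variable {E : Type*} [NormedAddCommGroup E] {G : E → E} {U : Set E} {K : ℝ≥0}

lemma lipschitzOnWith_of_sub_id (hG : LipschitzOnWith K (fun v => G v - v) U) :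
    LipschitzOnWith (K + 1) G U := by
  simpa using hG.add LipschitzWith.id.lipschitzOnWith

lemma injOn_of_lipschitzOnWith_sub_id (hG : LipschitzOnWith K (fun v => G v - v) U) (hK : K < 1) :
    InjOn G U := by
  intro v hv w hw hvw
  have hcontr : ‖v - w‖ ≤ K * ‖v - w‖ := by
    simpa [hvw, norm_sub_rev] using hG.norm_sub_le hv hw
  have : (K : ℝ) < 1 := hK
  exact sub_eq_zero.1 (norm_eq_zero.1 (by nlinarith [norm_nonneg (v - w)]))

variable [NormedSpace ℝ E]

lemma closedBall_subset_image_of_lipschitzOnWith_sub_id [CompleteSpace E] {Q r W : ℝ}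
    (hG : LipschitzOnWith K (fun v => G v - v) (ball 0 Q)) (hr : 0 ≤ r) (hrQ : r < Q)
    (hW : W + ‖G 0‖ ≤ (1 - K) * r) : closedBall 0 W ⊆ G '' ball 0 Q := by
  have happrox : ApproximatesLinearOn G (ContinuousLinearMap.id ℝ E) (ball 0 Q) K :=
    ApproximatesLinearOn.approximatesLinearOn_iff_lipschitzOnWith.2 hG
  let inv : (ContinuousLinearMap.id ℝ E).NonlinearRightInverse :=
    { toFun := id, nnnorm := 1, bound' := by simp, right_inv' := by simp }
  have hsub : closedBall (0 : E) r ⊆ ball 0 Q := closedBall_subset_ball hrQ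
  have hsurj := happrox.surjOn_closedBall_of_nonlinearRightInverse inv hr hsub
  intro w hw
  have hw' : w ∈ closedBall (G 0) (((inv.nnnorm : ℝ)⁻¹ - K) * r) := by
    rw [mem_closedBall, dist_eq_norm, NNReal.coe_one, inv_one]
    linarith [norm_sub_le w (G 0), mem_closedBall_zero_iff.1 hw]
  exact image_mono hsub (hsurj hw')

variable [FiniteDimensional ℝ E] [MeasurableSpace E] [BorelSpace E] (μ : Measure E)
  [μ.IsAddHaarMeasure]

-- The Hausdorff measure of dimension `finrank ℝ E` is a Haar measure.
lemma addHaar_image_eq_zero_of_lipschitzOnWith (hG : LipschitzOnWith K G U) (hU : μ U = 0) :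
    μ (G '' U) = 0 := by
  refine Measure.absolutelyContinuous_isAddHaarMeasure μ (μH[Module.finrank ℝ E]) ?_
  refine le_antisymm ((hG.hausdorffMeasure_image_le (Nat.cast_nonneg _)).trans ?_) zero_le
  rw [Measure.absolutelyContinuous_isAddHaarMeasure (μH[Module.finrank ℝ E]) μ hU, mul_zero]

lemma exists_differentiableAt_subset (hG : LipschitzOnWith K G U) (hU : IsOpen U) :
    ∃ S ⊆ U, MeasurableSet S ∧ S =ᵐ[μ] U ∧ G '' S =ᵐ[μ] G '' U ∧
      ∀ v ∈ S, HasFDerivAt G (fderiv ℝ G v) v := by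
  have hdiff : ∀ᵐ v ∂μ, v ∈ U → DifferentiableAt ℝ G v := by
    filter_upwards [hG.ae_differentiableWithinAt_of_mem (μ := μ)] with v hv hvU
    exact (hv hvU).differentiableAt (hU.mem_nhds hvU)
  set N := toMeasurable μ {v | ¬(v ∈ U → DifferentiableAt ℝ G v)}
  have hN : μ N = 0 := (measure_toMeasurable _).trans hdiff
  have hnull : μ (G '' (U ∩ N)) = 0 :=
    addHaar_image_eq_zero_of_lipschitzOnWith μ (hG.mono inter_subset_left)
      (measure_mono_null inter_subset_right hN)
  refine ⟨U \ N, sdiff_subset, hU.measurableSet.diff (measurableSet_toMeasurable _ _),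
    sdiff_null_ae_eq_self hN, ?_, fun v hv => ?_⟩
  · rw [← sdiff_union_inter U N, image_union, sdiff_union_inter]
    exact (union_ae_eq_left_of_ae_eq_empty (ae_eq_empty.2 hnull)).symm
  · have hv' : ¬¬(v ∈ U → DifferentiableAt ℝ G v) := fun h => hv.2 (subset_toMeasurable _ _ h)
    exact (not_not.1 hv' hv.1).hasFDerivAt

variable {F : E → ℝ}

lemma setIntegral_sub_comp_eq (hU : IsOpen U) (hμU : μ U ≠ ∞) (hG : LipschitzOnWith K G U)
    (hinj : InjOn G U) (hFc : Continuous F) (hFs : HasCompactSupport F)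
    (hFU : Function.support F ⊆ U) (hFG : Function.support F ⊆ G '' U) :
    ∫ v in U, (F v - F (G v)) ∂μ = ∫ v in U, (|(fderiv ℝ G v).det| - 1) * F (G v) ∂μ := by
  obtain ⟨S, hSU, hS, hSae, hGS, hderiv⟩ := exists_differentiableAt_subset μ hG hU
  have hderivS : ∀ v ∈ S, HasFDerivWithinAt G (fderiv ℝ G v) S v :=
    fun v hv => (hderiv v hv).hasFDerivWithinAt
  have hFint : Integrable F μ := hFc.integrable_of_hasCompactSupport hFs
  have hFGint : IntegrableOn (fun v => F (G v)) U μ := by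
    obtain ⟨BF, hBF⟩ := hFc.bounded_above_of_compact_support hFs
    exact .of_bound hμU.lt_top ((hFc.comp_continuousOn hG.continuousOn).aestronglyMeasurable
      hU.measurableSet) BF (.of_forall fun v => hBF _)
  have hJint : IntegrableOn (fun v => |(fderiv ℝ G v).det| * F (G v)) U μ :=
    ((integrableOn_image_iff_integrableOn_abs_det_fderiv_smul μ hS hderivS (hinj.mono hSU) F).1
      hFint.integrableOn).congr_set_ae hSae.symm
  have hJ : ∫ v in U, |(fderiv ℝ G v).det| * F (G v) ∂μ = ∫ v in U, F v ∂μ :=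
    calc ∫ v in U, |(fderiv ℝ G v).det| * F (G v) ∂μ
        = ∫ v in G '' U, F v ∂μ := by
          rw [← setIntegral_congr_set hSae, ← setIntegral_congr_set hGS,
            integral_image_eq_integral_abs_det_fderiv_smul μ hS hderivS (hinj.mono hSU)]
          rfl
      _ = ∫ v in U, F v ∂μ := by
          rw [setIntegral_eq_integral_of_forall_compl_eq_zero fun v hv =>
              Function.notMem_support.1 fun h => hv (hFU h),
            setIntegral_eq_integral_of_forall_compl_eq_zero fun v hv =>
              Function.notMem_support.1 fun h => hv (hFG h)]
  simp_rw [sub_one_mul]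
  rw [integral_sub hFint.integrableOn hFGint, integral_sub hJint hFGint, hJ]

lemma abs_setIntegral_sub_comp_le (hU : IsOpen U) (hμU : μ U ≠ ∞) (hK : K < 1)
    (hG : LipschitzOnWith K (fun v => G v - v) U) (hFc : Continuous F)
    (hFs : HasCompactSupport F) (hFU : Function.support F ⊆ U)
    (hFG : Function.support F ⊆ G '' U) {BF J : ℝ} (hBF : ∀ v, |F v| ≤ BF)
    (hJ : ∀ v ∈ U, ∀ D, HasFDerivAt G D v → |D.det - 1| ≤ J) :
    |∫ v in U, (F v - F (G v)) ∂μ| ≤ BF * J * μ.real U := by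
  have hlip := lipschitzOnWith_of_sub_id hG
  obtain ⟨S, hSU, -, hSae, -, hderiv⟩ := exists_differentiableAt_subset μ hlip hU
  rw [setIntegral_sub_comp_eq μ hU hμU hlip (injOn_of_lipschitzOnWith_sub_id hG hK) hFc hFs hFU
    hFG, ← setIntegral_congr_set hSae, ← measureReal_congr hSae, ← Real.norm_eq_abs]
  refine norm_setIntegral_le_of_norm_le_const ((measure_mono hSU).trans_lt hμU.lt_top)
    fun v hv => ?_
  have hdet : |(|(fderiv ℝ G v).det| - 1)| ≤ J :=
    calc |(|(fderiv ℝ G v).det| - 1)| ≤ |(fderiv ℝ G v).det - 1| := by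
          simpa using abs_abs_sub_abs_le (fderiv ℝ G v).det 1
      _ ≤ J := hJ v (hSU hv) _ (hderiv v hv)
  rw [norm_mul, Real.norm_eq_abs, Real.norm_eq_abs, mul_comm]
  exact mul_le_mul (hBF _) hdet (abs_nonneg _) ((abs_nonneg _).trans (hBF 0))

end ChangeOfVariables

section SingleCharacteristic

variable {E : Type*} [NormedAddCommGroup E] [NormedSpace ℝ E] {H : ℝ → E → E} {s K τ : ℝ}
  {x v : E} {X V : ℝ → E}

lemma norm_sub_le_mul_of_norm_hasDerivWithinAt_le {g g' : ℝ → E} {C : ℝ}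
    (hg : ∀ τ ∈ Icc 0 s, HasDerivWithinAt g (g' τ) (Icc 0 s) τ) (hC : ∀ τ ∈ Icc 0 s, ‖g' τ‖ ≤ C)
    (hτ : τ ∈ Icc 0 s) : ‖g τ - g s‖ ≤ C * s := by
  have hs : s ∈ Icc 0 s := ⟨hτ.1.trans hτ.2, le_rfl⟩
  refine ((convex_Icc 0 s).norm_image_sub_le_of_norm_hasDerivWithin_le hg hC hs hτ).trans ?_
  exact mul_le_mul_of_nonneg_left (abs_sub_le_of_mem_Icc hτ) ((norm_nonneg _).trans (hC s hs))

namespace IsCharacteristic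

lemma norm_velocity_sub_le (hc : IsCharacteristic H s x v X V)
    (hK : ∀ τ ∈ Icc 0 s, ∀ y, ‖H τ y‖ ≤ K) (hτ : τ ∈ Icc 0 s) : ‖V τ - v‖ ≤ K * s := by
  rw [← hc.V_end]
  exact norm_sub_le_mul_of_norm_hasDerivWithinAt_le hc.deriv_V
    (fun σ hσ => (norm_neg _).trans_le (hK σ hσ _)) hτ

lemma norm_position_sub_le (hc : IsCharacteristic H s x v X V)
    (hK : ∀ τ ∈ Icc 0 s, ∀ y, ‖H τ y‖ ≤ K) (hτ : τ ∈ Icc 0 s) :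
    ‖X τ - x‖ ≤ (‖v‖ + K * s) * s := by
  rw [← hc.X_end]
  refine norm_sub_le_mul_of_norm_hasDerivWithinAt_le hc.deriv_X (fun σ hσ => ?_) hτ
  calc ‖V σ‖ ≤ ‖v‖ + ‖V σ - v‖ := norm_le_norm_add_norm_sub' _ _
    _ ≤ ‖v‖ + K * s := add_le_add_right (hc.norm_velocity_sub_le hK hσ) _

lemma continuousOn_force_add (hc : IsCharacteristic H s x v X V)
    (hH : ContinuousOn (fun z : ℝ × E => H z.1 z.2) (Icc 0 s ×ˢ univ)) (a : E) :
    ContinuousOn (fun τ => H τ (X τ + (τ - s) • a)) (Icc 0 s) := by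
  have hX : ContinuousOn X (Icc 0 s) := fun τ hτ => (hc.deriv_X τ hτ).continuousWithinAt
  exact hH.comp (f := fun τ : ℝ => (τ, X τ + (τ - s) • a))
    (continuousOn_id.prodMk (hX.add (by fun_prop))) fun τ hτ => ⟨hτ, trivial⟩

lemma continuousOn_force (hc : IsCharacteristic H s x v X V)
    (hH : ContinuousOn (fun z : ℝ × E => H z.1 z.2) (Icc 0 s ×ˢ univ)) :
    ContinuousOn (fun τ => H τ (X τ)) (Icc 0 s) := by
  simpa using hc.continuousOn_force_add hH 0

lemma velocity_zero_eq [CompleteSpace E] (hc : IsCharacteristic H s x v X V) (hs : 0 ≤ s)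
    (hH : ContinuousOn (fun z : ℝ × E => H z.1 z.2) (Icc 0 s ×ˢ univ)) :
    V 0 = v + ∫ τ in 0..s, H τ (X τ) := by
  have hftc := intervalIntegral.integral_eq_sub_of_hasDeriv_right_of_le hs
    (fun τ hτ => (hc.deriv_V τ hτ).continuousWithinAt)
    (fun τ hτ => (hc.deriv_V τ ⟨hτ.1.le, hτ.2.le⟩).mono_of_mem_nhdsWithin
      (Icc_mem_nhdsGT_of_mem ⟨hτ.1.le, hτ.2⟩))
    ((hc.continuousOn_force hH).neg.intervalIntegrable_of_Icc hs)
  rw [intervalIntegral.integral_neg, hc.V_end] at hftc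
  rw [← sub_eq_iff_eq_add', ← neg_inj, hftc, neg_sub]

end IsCharacteristic

end SingleCharacteristic

section CharacteristicFan

variable {E : Type*} [NormedAddCommGroup E] [NormedSpace ℝ E] {H : ℝ → E → E} {s k r Q τ : ℝ}
  {x v v' : E} {X V : E → ℝ → E}

/-- The fan of all characteristics `(X w, V w)` of `H` that reach the common position `x` at time
`s` with a velocity `w` in the ball of radius `Q`. On `[0, s]` they stay in the ball of radius `r`
about `x`, and `H` is `k`-Lipschitz with `k ≤ 1` on twice that ball. The factor two leaves room to
compare a characteristic with the free transport of a neighbouring one. -/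
structure IsCharacteristicFan (H : ℝ → E → E) (s k r Q : ℝ) (x : E) (X V : E → ℝ → E) : Prop where
  time_nonneg : 0 ≤ s
  radius_pos : 0 < r
  lip_nonneg : 0 ≤ k
  lip_le_one : k ≤ 1
  isCharacteristic : ∀ w ∈ ball (0 : E) Q, IsCharacteristic H s x w (X w) (V w)
  position_mem : ∀ w ∈ ball (0 : E) Q, ∀ τ ∈ Icc 0 s, X w τ ∈ closedBall x r
  continuousOn : ContinuousOn (fun z : ℝ × E => H z.1 z.2) (Icc 0 s ×ˢ univ)
  norm_sub_le : ∀ τ ∈ Icc 0 s, ∀ y ∈ closedBall x (2 * r), ∀ y' ∈ closedBall x (2 * r),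
    ‖H τ y' - H τ y‖ ≤ k * ‖y' - y‖

namespace IsCharacteristicFan

lemma mul_exp_nonneg (hX : IsCharacteristicFan H s k r Q x X V) :
    0 ≤ k * s * Real.exp (3 * s) :=
  mul_nonneg (mul_nonneg hX.lip_nonneg hX.time_nonneg) (Real.exp_nonneg _)

lemma norm_force_sub_le (hX : IsCharacteristicFan H s k r Q x X V) (hv : v ∈ ball 0 Q)
    (hv' : v' ∈ ball 0 Q) (hτ : τ ∈ Icc 0 s) :
    ‖H τ (X v' τ) - H τ (X v τ)‖ ≤ k * ‖X v' τ - X v τ‖ := by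
  have hsub : closedBall x r ⊆ closedBall x (2 * r) :=
    closedBall_subset_closedBall (by linarith [hX.radius_pos])
  exact hX.norm_sub_le τ hτ _ (hsub (hX.position_mem v hv τ hτ)) _
    (hsub (hX.position_mem v' hv' τ hτ))

lemma norm_sub_le_exp (hX : IsCharacteristicFan H s k r Q x X V) (hv : v ∈ ball 0 Q)
    (hv' : v' ∈ ball 0 Q) (hτ : τ ∈ Icc 0 s) :
    ‖(X v' τ - X v τ, V v' τ - V v τ)‖ ≤ Real.exp (3 * s) * ‖v' - v‖ := by
  refine le_of_forall_pos_le_add_mul (c := Real.exp (3 * s)) fun ε hε => ?_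
  have hforce : ∀ τ ∈ Icc 0 s, ‖H τ (X v' τ) - H τ (X v τ)‖
      < 3 * (‖(X v' τ - X v τ, V v' τ - V v τ)‖ + ε) := fun τ hτ => by
    have hfst : ‖X v' τ - X v τ‖ ≤ ‖(X v' τ - X v τ, V v' τ - V v τ)‖ :=
      norm_fst_le (X v' τ - X v τ, V v' τ - V v τ)
    have hLip : ‖H τ (X v' τ) - H τ (X v τ)‖ ≤ ‖X v' τ - X v τ‖ :=
      (hX.norm_force_sub_le hv hv' hτ).trans
        (mul_le_of_le_one_left (norm_nonneg _) hX.lip_le_one)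
    linarith [norm_nonneg (X v' τ - X v τ)]
  have hgron := (hX.isCharacteristic v hv).norm_sub_le (hX.isCharacteristic v' hv') hε
    (fun τ => by simpa using (hasDerivAt_id τ).const_mul 3) (fun _ _ => by norm_num) hforce hτ
  calc ‖(X v' τ - X v τ, V v' τ - V v τ)‖
      ≤ (‖(x - x, v' - v)‖ + ε) * Real.exp (3 * s - 3 * τ) := by linarith
    _ ≤ (‖v' - v‖ + ε) * Real.exp (3 * s) := by
        gcongr
        · simp [Prod.norm_def]
        · linarith [hτ.1]
    _ = Real.exp (3 * s) * ‖v' - v‖ + ε * Real.exp (3 * s) := by ring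

lemma norm_velocity_sub_sub_le (hX : IsCharacteristicFan H s k r Q x X V) (hv : v ∈ ball 0 Q)
    (hv' : v' ∈ ball 0 Q) (hτ : τ ∈ Icc 0 s) :
    ‖V v' τ - V v τ - (v' - v)‖ ≤ k * s * Real.exp (3 * s) * ‖v' - v‖ := by
  have hc := hX.isCharacteristic v hv
  have hc' := hX.isCharacteristic v' hv'
  have hmvt := norm_sub_le_mul_of_norm_hasDerivWithinAt_le (g := fun τ => V v' τ - V v τ)
    (C := k * (Real.exp (3 * s) * ‖v' - v‖))
    (fun σ hσ => (hc'.deriv_V σ hσ).sub (hc.deriv_V σ hσ)) (fun σ hσ => by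
      rw [neg_sub_neg, norm_sub_rev]
      exact (hX.norm_force_sub_le hv hv' hσ).trans (mul_le_mul_of_nonneg_left
        ((norm_fst_le (X v' σ - X v σ, V v' σ - V v σ)).trans (hX.norm_sub_le_exp hv hv' hσ))
        hX.lip_nonneg)) hτ
  simp only [hc.V_end, hc'.V_end] at hmvt
  linarith

lemma norm_position_sub_sub_le (hX : IsCharacteristicFan H s k r Q x X V) (hv : v ∈ ball 0 Q)
    (hv' : v' ∈ ball 0 Q) (hτ : τ ∈ Icc 0 s) :
    ‖X v' τ - X v τ - (τ - s) • (v' - v)‖ ≤ k * s ^ 2 * Real.exp (3 * s) * ‖v' - v‖ := by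
  have hc := hX.isCharacteristic v hv
  have hc' := hX.isCharacteristic v' hv'
  have hmvt := norm_sub_le_mul_of_norm_hasDerivWithinAt_le
    (g := fun τ => X v' τ - X v τ - (τ - s) • (v' - v))
    (fun σ hσ => (((hc'.deriv_X σ hσ).sub (hc.deriv_X σ hσ)).sub
      (((hasDerivWithinAt_id σ (Icc 0 s)).sub_const s).smul_const (v' - v))).congr_deriv
      (by rw [one_smul]))
    (fun σ hσ => hX.norm_velocity_sub_sub_le hv hv' hσ) hτ
  simp only [hc.X_end, hc'.X_end, sub_self, zero_smul, sub_zero] at hmvt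
  linarith

lemma lipschitzOnWith_velocity_zero_sub_id (hX : IsCharacteristicFan H s k r Q x X V) {K : ℝ≥0}
    (hK : (K : ℝ) = k * s * Real.exp (3 * s)) :
    LipschitzOnWith K (fun w => V w 0 - w) (ball 0 Q) := by
  refine LipschitzOnWith.of_dist_le_mul fun v' hv' v hv => ?_
  rw [dist_eq_norm, dist_eq_norm, hK, sub_sub_sub_comm]
  exact hX.norm_velocity_sub_sub_le hv hv' ⟨le_rfl, hX.time_nonneg⟩

lemma add_smul_mem_closedBall (hX : IsCharacteristicFan H s k r Q x X V) (hv : v ∈ ball 0 Q)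
    {a : E} (ha : s * ‖a‖ ≤ r) (hτ : τ ∈ Icc 0 s) :
    X v τ + (τ - s) • a ∈ closedBall x (2 * r) := by
  have hpos := hX.position_mem v hv τ hτ
  rw [mem_closedBall_iff_norm] at hpos ⊢
  have hshift : ‖(τ - s) • a‖ ≤ r := by
    rw [norm_smul, Real.norm_eq_abs]
    exact (mul_le_mul_of_nonneg_right (abs_sub_le_of_mem_Icc hτ) (norm_nonneg a)).trans ha
  rw [add_sub_right_comm]
  linarith [norm_add_le (X v τ - x) ((τ - s) • a)]

lemma norm_velocity_zero_expansion_le [CompleteSpace E] (hX : IsCharacteristicFan H s k r Q x X V)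
    (hv : v ∈ ball 0 Q) (hv' : v' ∈ ball 0 Q) (hsmall : s * ‖v' - v‖ ≤ r) :
    ‖V v' 0 - V v 0 - (v' - v)
        - ∫ τ in 0..s, (H τ (X v τ + (τ - s) • (v' - v)) - H τ (X v τ))‖
      ≤ k ^ 2 * s ^ 3 * Real.exp (3 * s) * ‖v' - v‖ := by
  have hs := hX.time_nonneg
  have hc := hX.isCharacteristic v hv
  have hc' := hX.isCharacteristic v' hv'
  have hint := (hc.continuousOn_force hX.continuousOn).intervalIntegrable_of_Icc
    (μ := volume) hs
  have hint' := (hc'.continuousOn_force hX.continuousOn).intervalIntegrable_of_Icc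
    (μ := volume) hs
  have hint_shift := (hc.continuousOn_force_add hX.continuousOn
    (v' - v)).intervalIntegrable_of_Icc (μ := volume) hs
  have hremainder : V v' 0 - V v 0 - (v' - v)
        - ∫ τ in 0..s, (H τ (X v τ + (τ - s) • (v' - v)) - H τ (X v τ))
      = ∫ τ in 0..s, (H τ (X v' τ) - H τ (X v τ + (τ - s) • (v' - v))) := by
    rw [hc.velocity_zero_eq hs hX.continuousOn, hc'.velocity_zero_eq hs hX.continuousOn,
      intervalIntegral.integral_sub hint_shift hint, intervalIntegral.integral_sub hint' hint_shift]
    abel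
  have hbound : ∀ τ ∈ uIoc 0 s, ‖H τ (X v' τ) - H τ (X v τ + (τ - s) • (v' - v))‖
      ≤ k * (k * s ^ 2 * Real.exp (3 * s) * ‖v' - v‖) := fun τ hτ => by
    rw [uIoc_of_le hs] at hτ
    have hτ : τ ∈ Icc 0 s := Ioc_subset_Icc_self hτ
    refine (hX.norm_sub_le τ hτ _ (hX.add_smul_mem_closedBall hv hsmall hτ) _
      (closedBall_subset_closedBall (by linarith [hX.radius_pos])
        (hX.position_mem v' hv' τ hτ))).trans (mul_le_mul_of_nonneg_left ?_ hX.lip_nonneg)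
    rw [← sub_sub]
    exact hX.norm_position_sub_sub_le hv hv' hτ
  rw [hremainder]
  refine (intervalIntegral.norm_integral_le_of_norm_le_const hbound).trans_eq ?_
  rw [sub_zero, abs_of_nonneg hs]
  ring

end IsCharacteristicFan

end CharacteristicFan

section Trace

variable {H : ℝ → Space3 → Space3} {s k r Q h τ : ℝ} {x v : Space3} {X V : Space3 → ℝ → Space3}

lemma mul_divQuot_mul (B : Space3 → Space3) (y : Space3) (c h : ℝ) :
    c * divQuot B y (c * h) = ∑ i, (B (y + c • h • coordVec i) - B y) i / h := by
  rw [divQuot, Finset.mul_sum]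
  refine Finset.sum_congr rfl fun i _ => ?_
  rw [smul_smul, PiLp.sub_apply]
  rcases eq_or_ne c 0 with rfl | hc
  · simp
  · rw [← div_div, mul_div_assoc', mul_div_cancel₀ _ hc]

lemma integral_mul_divQuot_mul (Y : ℝ → Space3)
    (hint : ∀ i, IntervalIntegrable
      (fun τ => H τ (Y τ + (τ - s) • h • coordVec i) - H τ (Y τ)) volume 0 s) :
    ∫ τ in 0..s, (τ - s) * divQuot (H τ) (Y τ) ((τ - s) * h)
      = ∑ i, (∫ τ in 0..s, (H τ (Y τ + (τ - s) • h • coordVec i) - H τ (Y τ))) i / h := by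
  have hint_coord (i : Fin 3) : IntervalIntegrable
      (fun τ => (H τ (Y τ + (τ - s) • h • coordVec i) - H τ (Y τ)) i / h) volume 0 s :=
    ⟨((EuclideanSpace.proj (𝕜 := ℝ) i).integrable_comp (hint i).1).div_const h,
      ((EuclideanSpace.proj (𝕜 := ℝ) i).integrable_comp (hint i).2).div_const h⟩
  simp only [mul_divQuot_mul]
  rw [intervalIntegral.integral_finsetSum fun i _ => hint_coord i]
  refine Finset.sum_congr rfl fun i _ => ?_
  rw [intervalIntegral.integral_div]
  exact congrArg (· / h) ((EuclideanSpace.proj (𝕜 := ℝ) i).intervalIntegral_comp_comm (hint i))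

lemma norm_smul_coordVec (h : ℝ) (i : Fin 3) : ‖h • coordVec i‖ = |h| := by simp [norm_smul]

namespace IsCharacteristicFan

lemma abs_divQuot_force_le (hX : IsCharacteristicFan H s k r Q x X V) (hv : v ∈ ball 0 Q)
    (hsmall : s * |h| ≤ r) (hτ : τ ∈ Icc 0 s) :
    |divQuot (H τ) (X v τ) ((τ - s) * h)| ≤ 3 * k := by
  refine abs_divQuot_le hX.lip_nonneg fun i => ?_
  rw [mul_smul]
  refine (hX.norm_sub_le τ hτ _ ?_ _ ?_).trans_eq ?_
  · exact closedBall_subset_closedBall (by linarith [hX.radius_pos]) (hX.position_mem v hv τ hτ)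
  · exact hX.add_smul_mem_closedBall hv (by rwa [norm_smul_coordVec]) hτ
  · rw [add_sub_cancel_left, ← mul_smul, norm_smul_coordVec]

lemma continuousOn_mul_divQuot_force (hX : IsCharacteristicFan H s k r Q x X V)
    (hv : v ∈ ball 0 Q) (h : ℝ) :
    ContinuousOn (fun τ => (τ - s) * divQuot (H τ) (X v τ) ((τ - s) * h)) (Icc 0 s) := by
  have hc := hX.isCharacteristic v hv
  simp only [mul_divQuot_mul]
  exact continuousOn_finsetSum _ fun i _ =>
    ((EuclideanSpace.proj (𝕜 := ℝ) i).continuous.comp_continuousOn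
      ((hc.continuousOn_force_add hX.continuousOn _).sub
        (hc.continuousOn_force hX.continuousOn))).div_const h

lemma eventually_mul_abs_le (hX : IsCharacteristicFan H s k r Q x X V) :
    ∀ᶠ h in 𝓝[≠] (0 : ℝ), s * |h| ≤ r := by
  have hcont : ContinuousAt (fun h : ℝ => s * |h|) 0 := by fun_prop
  exact nhdsWithin_le_nhds (hcont.eventually_le_const (by simpa using hX.radius_pos))

lemma tendsto_integral_mul_divQuot (hX : IsCharacteristicFan H s k r Q x X V) (hv : v ∈ ball 0 Q)
    {ℓ : ℝ → ℝ}
    (hdiv : ∀ τ ∈ Icc 0 s, Tendsto (divQuot (H τ) (X v τ)) (𝓝[≠] 0) (𝓝 (ℓ τ))) :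
    Tendsto (fun h => ∫ τ in 0..s, (τ - s) * divQuot (H τ) (X v τ) ((τ - s) * h)) (𝓝[≠] 0)
      (𝓝 (∫ τ in 0..s, (τ - s) * ℓ τ)) := by
  have hs := hX.time_nonneg
  refine intervalIntegral.tendsto_integral_filter_of_dominated_convergence
    (fun _ => s * (3 * k)) (.of_forall fun h => ?_) ?_ (by simp) ?_
  · rw [uIoc_of_le hs]
    exact ((hX.continuousOn_mul_divQuot_force hv h).mono
      Ioc_subset_Icc_self).aestronglyMeasurable measurableSet_Ioc
  · filter_upwards [hX.eventually_mul_abs_le] with h hh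
    refine .of_forall fun τ hτ => ?_
    rw [uIoc_of_le hs] at hτ
    rw [norm_mul, Real.norm_eq_abs, Real.norm_eq_abs]
    exact mul_le_mul (abs_sub_le_of_mem_Icc (Ioc_subset_Icc_self hτ))
      (hX.abs_divQuot_force_le hv hh (Ioc_subset_Icc_self hτ)) (abs_nonneg _) hs
  · filter_upwards [compl_mem_ae_iff.2 (measure_singleton s)] with τ hτs hτ
    rw [uIoc_of_le hs] at hτ
    refine ((hdiv τ (Ioc_subset_Icc_self hτ)).comp ?_).const_mul _
    have hlim : Tendsto (fun h : ℝ => (τ - s) * h) (𝓝[≠] 0) (𝓝 0) := by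
      simpa using ((continuous_const_mul (τ - s)).tendsto (0 : ℝ)).mono_left nhdsWithin_le_nhds
    refine tendsto_nhdsWithin_iff.2 ⟨hlim, ?_⟩
    filter_upwards [self_mem_nhdsWithin] with h hh
    exact mul_ne_zero (sub_ne_zero.2 hτs) hh

lemma abs_divQuot_velocity_zero_sub_le (hX : IsCharacteristicFan H s k r Q x X V)
    (hv : v ∈ ball 0 Q) (hh : h ≠ 0) (hsmall : s * |h| ≤ r)
    (hmem : ∀ i, v + h • coordVec i ∈ ball (0 : Space3) Q) :
    |divQuot (V · 0) v h - 3 - ∫ τ in 0..s, (τ - s) * divQuot (H τ) (X v τ) ((τ - s) * h)|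
      ≤ 3 * (k ^ 2 * s ^ 3 * Real.exp (3 * s)) := by
  have hs := hX.time_nonneg
  have hc := hX.isCharacteristic v hv
  set remainder : Fin 3 → Space3 := fun i => V (v + h • coordVec i) 0 - V v 0 - h • coordVec i
    - ∫ τ in 0..s, (H τ (X v τ + (τ - s) • h • coordVec i) - H τ (X v τ))
  have hexp (i : Fin 3) : ‖remainder i‖ ≤ k ^ 2 * s ^ 3 * Real.exp (3 * s) * |h| := by
    have := hX.norm_velocity_zero_expansion_le hv (hmem i)
      (by rwa [add_sub_cancel_left, norm_smul_coordVec])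
    rwa [add_sub_cancel_left, norm_smul_coordVec] at this
  have hsum : divQuot (V · 0) v h - 3
        - ∫ τ in 0..s, (τ - s) * divQuot (H τ) (X v τ) ((τ - s) * h)
      = ∑ i, remainder i i / h := by
    have hthree : (3 : ℝ) = ∑ i : Fin 3, (h • coordVec i) i / h := by simp [hh]
    rw [integral_mul_divQuot_mul _ fun i => ((hc.continuousOn_force_add hX.continuousOn _).sub
      (hc.continuousOn_force hX.continuousOn)).intervalIntegrable_of_Icc hs, hthree, divQuot,
      ← Finset.sum_sub_distrib, ← Finset.sum_sub_distrib]
    refine Finset.sum_congr rfl fun i _ => ?_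
    simp only [remainder, PiLp.sub_apply]
    ring
  rw [hsum]
  calc |∑ i, remainder i i / h| ≤ ∑ i, |remainder i i / h| := Finset.abs_sum_le_sum_abs _ _
    _ ≤ ∑ _i : Fin 3, k ^ 2 * s ^ 3 * Real.exp (3 * s) := Finset.sum_le_sum fun i _ => by
        rw [abs_div]
        exact div_le_of_le_mul₀ (abs_nonneg _) (by positivity)
          ((PiLp.norm_apply_le _ i).trans (hexp i))
    _ = 3 * (k ^ 2 * s ^ 3 * Real.exp (3 * s)) := by simp

lemma abs_trace_sub_three_le (hX : IsCharacteristicFan H s k r Q x X V) (hv : v ∈ ball 0 Q)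
    {ℓ b : ℝ → ℝ} (hdiv : ∀ τ ∈ Icc 0 s, Tendsto (divQuot (H τ) (X v τ)) (𝓝[≠] 0) (𝓝 (ℓ τ)))
    (hℓ : ∀ τ ∈ Icc 0 s, |ℓ τ| ≤ b τ) (hb : Continuous b) {D : Space3 →L[ℝ] Space3}
    (hD : HasFDerivAt (V · 0) D v) :
    |∑ i, D (coordVec i) i - 3|
      ≤ 3 * (k ^ 2 * s ^ 3 * Real.exp (3 * s)) + s * ∫ τ in 0..s, b τ := by
  have hs := hX.time_nonneg
  have hmem : ∀ᶠ h in 𝓝[≠] (0 : ℝ), ∀ i, v + h • coordVec i ∈ ball (0 : Space3) Q :=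
    nhdsWithin_le_nhds (eventually_all.2 fun i =>
      (by fun_prop : ContinuousAt (fun h : ℝ => v + h • coordVec i) 0).eventually_mem
        (isOpen_ball.mem_nhds (by simpa using hv)))
  have hlim : |∑ i, D (coordVec i) i - 3 - ∫ τ in 0..s, (τ - s) * ℓ τ|
      ≤ 3 * (k ^ 2 * s ^ 3 * Real.exp (3 * s)) := by
    refine le_of_tendsto (((tendsto_divQuot_of_hasFDerivAt hD).sub_const 3).sub
      (hX.tendsto_integral_mul_divQuot hv hdiv)).abs ?_
    filter_upwards [hX.eventually_mul_abs_le, hmem, self_mem_nhdsWithin] with h hsmall hmem hh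
    exact hX.abs_divQuot_velocity_zero_sub_le hv hh hsmall hmem
  have hdivergence : |∫ τ in 0..s, (τ - s) * ℓ τ| ≤ s * ∫ τ in 0..s, b τ := by
    rw [← intervalIntegral.integral_const_mul, ← Real.norm_eq_abs]
    refine intervalIntegral.norm_integral_le_of_norm_le hs (.of_forall fun τ hτ => ?_)
      ((hb.intervalIntegrable 0 s).const_mul s)
    rw [norm_mul, Real.norm_eq_abs, Real.norm_eq_abs]
    exact mul_le_mul (abs_sub_le_of_mem_Icc (Ioc_subset_Icc_self hτ))
      (hℓ τ (Ioc_subset_Icc_self hτ)) (abs_nonneg _) hs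
  calc |∑ i, D (coordVec i) i - 3|
      ≤ |∑ i, D (coordVec i) i - 3 - ∫ τ in 0..s, (τ - s) * ℓ τ|
        + |∫ τ in 0..s, (τ - s) * ℓ τ| := by
        simpa using abs_add_le (∑ i, D (coordVec i) i - 3 - ∫ τ in 0..s, (τ - s) * ℓ τ)
          (∫ τ in 0..s, (τ - s) * ℓ τ)
    _ ≤ _ := add_le_add hlim hdivergence

lemma abs_det_sub_one_le (hX : IsCharacteristicFan H s k r Q x X V)
    (hsmall : k * s * Real.exp (3 * s) ≤ 1) (hv : v ∈ ball 0 Q) {ℓ : ℝ → Space3 → ℝ} {b : ℝ → ℝ}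
    (hdiv : ∀ τ ∈ Icc 0 s, ∀ y ∈ closedBall x r,
      Tendsto (divQuot (H τ) y) (𝓝[≠] 0) (𝓝 (ℓ τ y)))
    (hℓ : ∀ τ ∈ Icc 0 s, ∀ y ∈ closedBall x r, |ℓ τ y| ≤ b τ) (hb : Continuous b)
    {D : Space3 →L[ℝ] Space3} (hD : HasFDerivAt (V · 0) D v) :
    |D.det - 1| ≤ 3 * (k ^ 2 * s ^ 3 * Real.exp (3 * s)) + s * (∫ τ in 0..s, b τ)
      + 12 * (k * s * Real.exp (3 * s)) ^ 2 := by
  have hnorm : ‖D - ContinuousLinearMap.id ℝ Space3‖ ≤ k * s * Real.exp (3 * s) :=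
    (hD.sub (hasFDerivAt_id v)).le_of_lipschitzOn (isOpen_ball.mem_nhds hv)
      (hX.lipschitzOnWith_velocity_zero_sub_id (K := ⟨_, hX.mul_exp_nonneg⟩) rfl)
  refine (VlasovPoisson.abs_det_sub_one_le hsmall hnorm).trans (add_le_add_left ?_ _)
  exact hX.abs_trace_sub_three_le hv (fun τ hτ => hdiv τ hτ _ (hX.position_mem v hv τ hτ))
    (fun τ hτ => hℓ τ hτ _ (hX.position_mem v hv τ hτ)) hb hD

lemma closedBall_subset_image_velocity_zero (hX : IsCharacteristicFan H s k r Q x X V)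
    (hsmall : k * s * Real.exp (3 * s) ≤ 1 / 2) {W : ℝ} (hW : 0 ≤ W)
    (hWQ : 2 * (W + ‖V 0 0‖) < Q) : closedBall 0 W ⊆ (V · 0) '' ball 0 Q := by
  refine closedBall_subset_image_of_lipschitzOnWith_sub_id
    (hX.lipschitzOnWith_velocity_zero_sub_id (K := ⟨_, hX.mul_exp_nonneg⟩) rfl) (by positivity)
    hWQ ?_
  calc W + ‖V 0 0‖ = (1 - 1 / 2) * (2 * (W + ‖V 0 0‖)) := by ring
    _ ≤ (1 - k * s * Real.exp (3 * s)) * (2 * (W + ‖V 0 0‖)) := by gcongr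

lemma abs_setIntegral_sub_comp_velocity_zero_le (hX : IsCharacteristicFan H s k r Q x X V)
    (hsmall : k * s * Real.exp (3 * s) ≤ 1 / 2) {F : Space3 → ℝ} (hF : Continuous F) {W BF : ℝ}
    (hW : 0 ≤ W) (hFW : ∀ v, W < ‖v‖ → F v = 0) (hBF : ∀ v, |F v| ≤ BF)
    (hWQ : 2 * (W + ‖V 0 0‖) < Q) {ℓ : ℝ → Space3 → ℝ} {b : ℝ → ℝ}
    (hdiv : ∀ τ ∈ Icc 0 s, ∀ y ∈ closedBall x r,
      Tendsto (divQuot (H τ) y) (𝓝[≠] 0) (𝓝 (ℓ τ y)))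
    (hℓ : ∀ τ ∈ Icc 0 s, ∀ y ∈ closedBall x r, |ℓ τ y| ≤ b τ) (hb : Continuous b) :
    |∫ v in ball 0 Q, (F v - F (V v 0))|
      ≤ BF * (3 * (k ^ 2 * s ^ 3 * Real.exp (3 * s)) + s * (∫ τ in 0..s, b τ)
        + 12 * (k * s * Real.exp (3 * s)) ^ 2) * volume.real (ball (0 : Space3) Q) := by
  have hsupp : Function.support F ⊆ closedBall 0 W := fun v hv =>
    mem_closedBall_zero_iff.2 (not_lt.1 fun h => hv (hFW v h))
  have hball : closedBall (0 : Space3) W ⊆ ball 0 Q :=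
    closedBall_subset_ball (by linarith [norm_nonneg (V 0 0)])
  exact abs_setIntegral_sub_comp_le (K := ⟨_, hX.mul_exp_nonneg⟩) volume isOpen_ball
    measure_ball_lt_top.ne
    (NNReal.coe_lt_coe.1 (hsmall.trans_lt (by norm_num)))
    (hX.lipschitzOnWith_velocity_zero_sub_id rfl) hF
    (HasCompactSupport.of_support_subset_isCompact (isCompact_closedBall 0 W) hsupp)
    (hsupp.trans hball)
    (hsupp.trans (hX.closedBall_subset_image_velocity_zero hsmall hW hWQ)) hBF
    fun v hv D hD => hX.abs_det_sub_one_le (hsmall.trans (by norm_num)) hv hdiv hℓ hb hD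

end IsCharacteristicFan

end Trace

section DataBounds

variable {F : Space3 → ℝ} {f₀ : Space3 → Space3 → ℝ} {A : ℝ → Space3 → Space3}

/-- Quantitative form of the hypotheses on the background `F`, the initial datum `f₀` and the
external field `A`. Every constant of the proof is a function of these numbers, so that it does not
depend on the solution. -/
structure DataBounds (F : Space3 → ℝ) (f₀ : Space3 → Space3 → ℝ) (A : ℝ → Space3 → Space3) where
  W : ℝ
  N : ℝ
  BF : ℝ
  B₀ : ℝ
  L₀ : ℝ
  CA : ℝ
  W_nonneg : 0 ≤ W
  N_nonneg : 0 ≤ N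
  one_le_L₀ : 1 ≤ L₀
  CA_nonneg : 0 ≤ CA
  continuous_background : Continuous F
  background_eq_zero : ∀ v, W < ‖v‖ → F v = 0
  abs_background_le : ∀ v, |F v| ≤ BF
  initial_eq_zero : ∀ x v, W < ‖v‖ → f₀ x v = 0
  initial_eq_background : ∀ x v, N < ‖x‖ → f₀ x v = F v
  abs_initial_le : ∀ x v, |f₀ x v| ≤ B₀
  abs_initial_sub_le : ∀ x v x' v', |f₀ x' v' - f₀ x v| ≤ L₀ * ‖(x' - x, v' - v)‖
  continuousOn_external : ContinuousOn (fun z : ℝ × Space3 => A z.1 z.2) (Ici 0 ×ˢ univ)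
  norm_external_le : ∀ τ, 0 ≤ τ → ∀ y, ‖A τ y‖ ≤ CA * R y ^ (-2 : ℝ)
  differentiable_external : ∀ τ, 0 ≤ τ → Differentiable ℝ (A τ)
  norm_fderiv_external_le : ∀ τ, 0 ≤ τ → ∀ y, ‖fderiv ℝ (A τ) y‖ ≤ CA * R y ^ (-3 : ℝ)
  divergence_external : ∀ τ, 0 ≤ τ → ∀ y, divergence (A τ) y = 0

lemma exists_abs_le_and_lipschitz_of_eq_background {N W : ℝ} (hF : ContDiff ℝ 1 F)
    (hFs : HasCompactSupport F) (hf₀ : ContDiff ℝ 1 fun z : Space3 × Space3 => f₀ z.1 z.2)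
    (hFW : ∀ v, W < ‖v‖ → F v = 0) (hW : ∀ x v, W < ‖v‖ → f₀ x v = 0)
    (hN : ∀ x v, N < ‖x‖ → f₀ x v = F v) :
    ∃ B L : ℝ, (∀ x v, |f₀ x v| ≤ B) ∧ 1 ≤ L ∧
      ∀ x v x' v', |f₀ x' v' - f₀ x v| ≤ L * ‖(x' - x, v' - v)‖ := by
  set g : Space3 × Space3 → ℝ := fun z => f₀ z.1 z.2 - F z.2
  have hg : ContDiff ℝ 1 g := hf₀.sub (hF.comp contDiff_snd)
  have hgs : HasCompactSupport g := by
    refine .intro ((isCompact_closedBall (0 : Space3) N).prod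
      (isCompact_closedBall (0 : Space3) W)) fun z hz => ?_
    rw [mem_prod, mem_closedBall_zero_iff, mem_closedBall_zero_iff, not_and_or, not_le,
      not_le] at hz
    rcases hz with hx | hv
    · simp only [g, hN _ _ hx, sub_self]
    · simp only [g, hW _ _ hv, hFW _ hv, sub_self]
  obtain ⟨Bg, hBg⟩ := hg.continuous.bounded_above_of_compact_support hgs
  obtain ⟨BF, hBF⟩ := hF.continuous.bounded_above_of_compact_support hFs
  obtain ⟨Lg, hLg⟩ := hg.lipschitzWith_of_hasCompactSupport hgs one_ne_zero
  obtain ⟨LF, hLF⟩ := hF.lipschitzWith_of_hasCompactSupport hFs one_ne_zero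
  have hf₀_eq (x v : Space3) : f₀ x v = g (x, v) + F v := (sub_add_cancel _ _).symm
  refine ⟨Bg + BF, 1 + (Lg + LF), fun x v => ?_,
    le_add_of_nonneg_right (by positivity), fun x v x' v' => ?_⟩
  · rw [hf₀_eq]
    exact (abs_add_le _ _).trans (add_le_add (hBg _) (hBF v))
  · calc |f₀ x' v' - f₀ x v| ≤ |g (x', v') - g (x, v)| + |F v' - F v| := by
          rw [hf₀_eq, hf₀_eq, add_sub_add_comm]
          exact abs_add_le _ _
      _ ≤ Lg * ‖(x' - x, v' - v)‖ + LF * ‖(x' - x, v' - v)‖ :=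
          add_le_add (hLg.norm_sub_le _ _) ((hLF.norm_sub_le _ _).trans
            (mul_le_mul_of_nonneg_left (le_max_right _ _) LF.coe_nonneg))
      _ ≤ (1 + (Lg + LF)) * ‖(x' - x, v' - v)‖ := by
          linarith [norm_nonneg (x' - x, v' - v)]

lemma nonempty_dataBounds (hF : ContDiff ℝ 1 F) (hFs : HasCompactSupport F)
    (hf₀ : InitialCondition F f₀) (hA : ExternalFieldCondition A) :
    Nonempty (DataBounds F f₀ A) := by
  obtain ⟨hf₀_diff, -, ⟨S, hS, hf₀_zero⟩, N, hN, hf₀_eq⟩ := hf₀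
  obtain ⟨hA_diff, ⟨CA, hCA, hA_le⟩, hA_div⟩ := hA
  obtain ⟨W, hW, hSW⟩ := (hFs.isCompact.union hS).isBounded.subset_closedBall_lt 0 0
  have hW_notMem {v : Space3} (hv : W < ‖v‖) : v ∉ tsupport F ∪ S := fun h =>
    hv.not_ge (by simpa using hSW h)
  have hFW (v : Space3) (hv : W < ‖v‖) : F v = 0 :=
    image_eq_zero_of_notMem_tsupport fun h => hW_notMem hv (.inl h)
  have hf₀W (x v : Space3) (hv : W < ‖v‖) : f₀ x v = 0 :=
    hf₀_zero x v fun h => hW_notMem hv (.inr h)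
  obtain ⟨BF, hBF⟩ := hF.continuous.bounded_above_of_compact_support hFs
  obtain ⟨B₀, L₀, hB₀, hL₀, hlip⟩ :=
    exists_abs_le_and_lipschitz_of_eq_background hF hFs hf₀_diff hFW hf₀W hf₀_eq
  refine ⟨W, N, BF, B₀, L₀, CA, hW.le, hN.le, hL₀, hCA.le, hF.continuous, hFW, hBF, hf₀W, hf₀_eq,
    hB₀, hlip, hA_diff.continuousOn, fun τ hτ y => (hA_le τ hτ y).1, fun τ hτ => ?_,
    fun τ hτ y => (hA_le τ hτ y).2, hA_div⟩
  exact differentiableOn_univ.1 ((hA_diff.differentiableOn one_ne_zero).comp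
    (f := fun y : Space3 => (τ, y)) (by fun_prop) fun y _ => ⟨hτ, trivial⟩)

namespace DataBounds

variable {τ : ℝ} {x y y' : Space3}

lemma BF_nonneg (D : DataBounds F f₀ A) : 0 ≤ D.BF :=
  (abs_nonneg _).trans (D.abs_background_le 0)

lemma norm_external_sub_le (D : DataBounds F f₀ A) (hτ : 0 ≤ τ) (y y' : Space3) :
    ‖A τ y' - A τ y‖ ≤ D.CA * ‖y' - y‖ :=
  convex_univ.norm_image_sub_le_of_norm_fderiv_le (fun z _ => D.differentiable_external τ hτ z)
    (fun z _ => (D.norm_fderiv_external_le τ hτ z).trans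
      (mul_le_of_le_one_right D.CA_nonneg (R_rpow_neg_le_one z (by norm_num)))) trivial trivial

lemma norm_external_sub_le_R_rpow (D : DataBounds F f₀ A) (hτ : 0 ≤ τ)
    (hy : y ∈ closedBall x (R x / 2)) (hy' : y' ∈ closedBall x (R x / 2)) :
    ‖A τ y' - A τ y‖ ≤ 8 * D.CA * R x ^ (-3 : ℝ) * ‖y' - y‖ := by
  refine (convex_closedBall x (R x / 2)).norm_image_sub_le_of_norm_fderiv_le
    (fun z _ => D.differentiable_external τ hτ z) (fun z hz => ?_) hy hy'
  calc ‖fderiv ℝ (A τ) z‖ ≤ D.CA * R z ^ (-3 : ℝ) := D.norm_fderiv_external_le τ hτ z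
    _ ≤ D.CA * (2 ^ (3 : ℝ) * R x ^ (-3 : ℝ)) :=
        mul_le_mul_of_nonneg_left (R_rpow_neg_le_of_norm_sub_le (by norm_num)
          (mem_closedBall_iff_norm'.1 hz)) D.CA_nonneg
    _ = 8 * D.CA * R x ^ (-3 : ℝ) := by norm_num; ring

lemma tendsto_divQuot_external (D : DataBounds F f₀ A) (hτ : 0 ≤ τ) (y : Space3) :
    Tendsto (divQuot (A τ) y) (𝓝[≠] 0) (𝓝 0) := by
  have h := tendsto_divQuot_of_hasFDerivAt (D.differentiable_external τ hτ y).hasFDerivAt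
  rwa [show ∑ i, (fderiv ℝ (A τ) y (coordVec i)) i = 0 from D.divergence_external τ hτ y] at h

end DataBounds

end DataBounds

section DominatedSolution

variable {F : Space3 → ℝ} {f₀ : Space3 → Space3 → ℝ} {A : ℝ → Space3 → Space3}
  {p M t T τ s : ℝ} {f : ℝ → Space3 → Space3 → ℝ} {x y y' : Space3}

namespace DataBounds

/-- A bound for the total force `E + A` when `|ρ| ≤ M R⁻ᵖ`. -/
def forceBound (D : DataBounds F f₀ A) (p M : ℝ) : ℝ := M * fieldConst p + D.CA

/-- A radius outside which `F` and the solution vanish up to time `t`. -/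
def velocityBound (D : DataBounds F f₀ A) (p M t : ℝ) : ℝ := D.W + D.forceBound p M * t

/-- The volume of the ball of velocities that contains the supports of `F` and the solution. -/
def velocityVol (D : DataBounds F f₀ A) (p M t : ℝ) : ℝ :=
  volume.real (closedBall (0 : Space3) (D.velocityBound p M t))

/-- The constant `c₁` for which the total force satisfies `IsLogLipschitzForce`. -/
def logLipConst (D : DataBounds F f₀ A) (p M t : ℝ) : ℝ :=
  3 * ballVol * D.velocityVol p M t + 8 * M * truncLipConst p + D.CA

/-- A Lipschitz constant of the charge density up to time `t`. -/
def rhoLipConst (D : DataBounds F f₀ A) (p M t : ℝ) : ℝ :=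
  transportLipConst D.L₀ (D.logLipConst p M t) t * D.velocityVol p M t

/-- The constant `C_H` for which the total force has Lipschitz constant `C_H R(x)⁻³` near `x`. -/
def forceLipConst (D : DataBounds F f₀ A) (p M t : ℝ) : ℝ :=
  8 * (lipConst p * (M + D.rhoLipConst p M t)) + 8 * D.CA

lemma forceBound_nonneg (D : DataBounds F f₀ A) (p : ℝ) (hM : 0 ≤ M) : 0 ≤ D.forceBound p M :=
  add_nonneg (mul_nonneg hM (fieldConst_nonneg p)) D.CA_nonneg

lemma W_le_velocityBound (D : DataBounds F f₀ A) (p : ℝ) (hM : 0 ≤ M) (ht : 0 ≤ t) :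
    D.W ≤ D.velocityBound p M t :=
  le_add_of_nonneg_right (mul_nonneg (D.forceBound_nonneg p hM) ht)

lemma velocityVol_nonneg (D : DataBounds F f₀ A) (p M t : ℝ) : 0 ≤ D.velocityVol p M t :=
  measureReal_nonneg

lemma rhoLipConst_nonneg (D : DataBounds F f₀ A) (p M t : ℝ) : 0 ≤ D.rhoLipConst p M t :=
  mul_nonneg (Real.exp_nonneg _) (D.velocityVol_nonneg p M t)

lemma logLipConst_nonneg (D : DataBounds F f₀ A) (hp : 3 < p) (hM : 0 ≤ M) (t : ℝ) :
    0 ≤ D.logLipConst p M t := by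
  have := ballVol_nonneg
  have := D.velocityVol_nonneg p M t
  have := truncLipConst_nonneg hp
  have := D.CA_nonneg
  unfold logLipConst
  positivity

lemma forceLipConst_nonneg (D : DataBounds F f₀ A) (hp : 3 < p) (hM : 0 ≤ M) (t : ℝ) :
    0 ≤ D.forceLipConst p M t := by
  have := lipConst_nonneg hp
  have := D.rhoLipConst_nonneg p M t
  have := D.CA_nonneg
  unfold forceLipConst
  positivity

end DataBounds

/-- A solution on `[0, T)` whose charge density satisfies `|ρ| ≤ M R⁻ᵖ` up to the time `t < T`. -/
structure IsDominatedSolution (F : Space3 → ℝ) (f₀ : Space3 → Space3 → ℝ)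
    (A : ℝ → Space3 → Space3) (p M t T : ℝ) (f : ℝ → Space3 → Space3 → ℝ) : Prop where
  isSolution : IsSolution F f₀ A T f
  time_nonneg : 0 ≤ t
  time_lt : t < T
  three_lt : 3 < p
  abs_rho_le : ∀ τ ∈ Icc 0 t, ∀ y, |rho F f τ y| ≤ M * R y ^ (-p)

namespace IsDominatedSolution

lemma nonneg (h : IsDominatedSolution F f₀ A p M t T f) : 0 ≤ M :=
  nonneg_of_abs_le_mul_R_rpow (h.abs_rho_le 0 ⟨le_rfl, h.time_nonneg⟩)

lemma mem_Ico (h : IsDominatedSolution F f₀ A p M t T f) (hτ : τ ∈ Icc 0 t) : τ ∈ Ico 0 T :=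
  ⟨hτ.1, hτ.2.trans_lt h.time_lt⟩

lemma norm_force_le (h : IsDominatedSolution F f₀ A p M t T f) (D : DataBounds F f₀ A)
    (hτ : τ ∈ Icc 0 t) (y : Space3) : ‖force F f A τ y‖ ≤ D.forceBound p M := by
  have hR : R y ^ (-2 : ℝ) ≤ 1 := R_rpow_neg_le_one y (by norm_num)
  refine (norm_add_le _ _).trans (add_le_add ?_ ?_)
  · exact (norm_field_le h.three_lt (h.abs_rho_le τ hτ) y).trans
      (mul_le_of_le_one_right (mul_nonneg h.nonneg (fieldConst_nonneg p)) hR)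
  · exact (D.norm_external_le τ hτ.1 y).trans (mul_le_of_le_one_right D.CA_nonneg hR)

lemma background_eq_zero (h : IsDominatedSolution F f₀ A p M t T f) (D : DataBounds F f₀ A)
    (v : Space3) (hv : D.velocityBound p M t < ‖v‖) : F v = 0 :=
  D.background_eq_zero v ((D.W_le_velocityBound p h.nonneg h.time_nonneg).trans_lt hv)

lemma eq_zero (h : IsDominatedSolution F f₀ A p M t T f) (D : DataBounds F f₀ A)
    (hτ : τ ∈ Icc 0 t) (x v : Space3) (hv : D.velocityBound p M t < ‖v‖) : f τ x v = 0 := by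
  refine h.isSolution.eq_zero_of_lt (h.mem_Ico hτ)
    (fun σ hσ => h.norm_force_le D ⟨hσ.1, hσ.2.trans hτ.2⟩) D.initial_eq_zero x
    (lt_of_le_of_lt ?_ hv)
  exact add_le_add_right
    (mul_le_mul_of_nonneg_left hτ.2 (D.forceBound_nonneg p h.nonneg)) _

lemma continuousOn_rho (h : IsDominatedSolution F f₀ A p M t T f) (D : DataBounds F f₀ A) :
    ContinuousOn (fun z : ℝ × Space3 => rho F f z.1 z.2) (Icc 0 t ×ˢ univ) :=
  h.isSolution.continuousOn_rho h.time_lt D.continuous_background (h.background_eq_zero D)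
    fun _ hτ => h.eq_zero D hτ

lemma isDominated_rho (h : IsDominatedSolution F f₀ A p M t T f) (D : DataBounds F f₀ A)
    (hτ : τ ∈ Icc 0 t) : IsDominated p M (rho F f τ) where
  three_lt := h.three_lt
  continuous := continuousOn_univ.1 <| (h.continuousOn_rho D).comp (f := fun y => (τ, y))
    (by fun_prop) fun _ _ => ⟨hτ, trivial⟩
  abs_le := h.abs_rho_le τ hτ

lemma continuousOn_force (h : IsDominatedSolution F f₀ A p M t T f) (D : DataBounds F f₀ A) :
    ContinuousOn (fun z : ℝ × Space3 => force F f A z.1 z.2) (Icc 0 t ×ˢ univ) :=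
  (continuousOn_field h.three_lt (h.continuousOn_rho D) h.abs_rho_le).add
    (D.continuousOn_external.mono (prod_mono Icc_subset_Ici_self subset_rfl))

lemma norm_force_sub_le_log (h : IsDominatedSolution F f₀ A p M t T f) (D : DataBounds F f₀ A)
    (hτ : τ ∈ Icc 0 t) {d η : ℝ} (hd : 0 < d) (hd2 : d ≤ 1 / 2)
    (hη : ∀ z, ‖z‖ < d → |rho F f τ (y' - z) - rho F f τ (y - z)| ≤ η) :
    ‖force F f A τ y' - force F f A τ y‖ ≤ 3 * ballVol * d * η
      + (8 * M * truncLipConst p * (1 + Real.log (1 / d)) + D.CA) * ‖y' - y‖ := by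
  calc ‖force F f A τ y' - force F f A τ y‖
      ≤ ‖field (rho F f τ) y' - field (rho F f τ) y‖ + ‖A τ y' - A τ y‖ := by
        rw [force, force, add_sub_add_comm]
        exact norm_add_le _ _
    _ ≤ (3 * ballVol * d * η + 8 * M * truncLipConst p * (1 + Real.log (1 / d)) * ‖y' - y‖)
        + D.CA * ‖y' - y‖ :=
        add_le_add ((h.isDominated_rho D hτ).norm_field_sub_le_log hd hd2 hη)
          (D.norm_external_sub_le hτ.1 y y')
    _ = _ := by ring

lemma exists_lipschitzOnWith_force (h : IsDominatedSolution F f₀ A p M t T f)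
    (D : DataBounds F f₀ A) (r : ℝ) :
    ∃ L : ℝ≥0, ∀ τ ∈ Icc 0 t, LipschitzOnWith L (force F f A τ) (closedBall 0 r) := by
  obtain ⟨Lρ, hLρ⟩ := h.isSolution.exists_local_lipschitz_rho h.time_lt
    D.continuous_background (h.background_eq_zero D) (fun _ hτ => h.eq_zero D hτ) (r + 1)
  refine ⟨Real.toNNReal (3 * ballVol * (1 / 2) * Lρ
    + (8 * M * truncLipConst p * (1 + Real.log (1 / (1 / 2))) + D.CA)), fun τ hτ => ?_⟩
  refine LipschitzOnWith.of_dist_le' fun y' hy' y hy => ?_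
  have hmem {w z : Space3} (hw : w ∈ closedBall 0 r) (hz : ‖z‖ < 1 / 2) :
      w - z ∈ closedBall (0 : Space3) (r + 1) := by
    rw [mem_closedBall_zero_iff] at hw ⊢
    linarith [norm_sub_le w z]
  rw [dist_eq_norm, dist_eq_norm]
  refine (h.norm_force_sub_le_log D hτ (by norm_num) le_rfl (η := Lρ * ‖y' - y‖)
    fun z hz => ?_).trans_eq (by ring)
  simpa using hLρ τ hτ _ (hmem hy hz) _ (hmem hy' hz)

lemma exists_isCharacteristic (h : IsDominatedSolution F f₀ A p M t T f) (D : DataBounds F f₀ A)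
    (hs : s ∈ Icc 0 t) (x v : Space3) : ∃ X V, IsCharacteristic (force F f A) s x v X V := by
  have hst : Icc 0 s ⊆ Icc 0 t := Icc_subset_Icc_right hs.2
  refine VlasovPoisson.exists_isCharacteristic hs.1
    ((h.continuousOn_force D).mono (prod_mono hst subset_rfl))
    (fun τ hτ => h.norm_force_le D (hst hτ)) (fun r => ?_) x v
  obtain ⟨L, hL⟩ := h.exists_lipschitzOnWith_force D r
  exact ⟨L, fun τ hτ => hL τ (hst hτ)⟩

lemma isTransported (h : IsDominatedSolution F f₀ A p M t T f) (D : DataBounds F f₀ A) :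
    IsTransported (force F f A) f₀ t f := by
  intro s hs x v
  obtain ⟨X, V, hXV⟩ := h.exists_isCharacteristic D hs x v
  exact ⟨X, V, hXV, h.isSolution.eq_initial (h.mem_Ico hs) hXV⟩

lemma isLogLipschitzForce (h : IsDominatedSolution F f₀ A p M t T f) (D : DataBounds F f₀ A)
    {ε : ℝ} (hε : 0 < ε) : IsLogLipschitzForce (force F f A) f t (D.logLipConst p M t) ε := by
  intro τ hτ Λ hΛ hfΛ y y'
  have : 0 < Λ := by linarith
  have hlog : 0 ≤ Real.log Λ := Real.log_nonneg (by linarith)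
  have := ballVol_nonneg
  have := D.velocityVol_nonneg p M t
  have := truncLipConst_nonneg h.three_lt
  have := D.CA_nonneg
  have := h.nonneg
  set δ := ‖y' - y‖ + ε
  -- The cutoff radius `1 / Λ` makes the singular part of the field independent of `Λ`.
  have hcut := h.norm_force_sub_le_log D hτ (d := 1 / Λ) (η := Λ * δ * D.velocityVol p M t)
    (y := y) (y' := y') (by positivity) (one_div_le_one_div_of_le (by norm_num) hΛ) fun z _ =>
      h.isSolution.abs_rho_sub_le D.continuous_background (h.background_eq_zero D) (h.mem_Ico hτ)
        (h.eq_zero D hτ) fun v _ => by simpa [δ] using hfΛ (y - z) (y' - z) v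
  rw [one_div_one_div] at hcut
  calc ‖force F f A τ y' - force F f A τ y‖
      ≤ 3 * ballVol * (1 / Λ) * (Λ * δ * D.velocityVol p M t)
        + (8 * M * truncLipConst p * (1 + Real.log Λ) + D.CA) * ‖y' - y‖ := hcut
    _ ≤ 3 * ballVol * D.velocityVol p M t * (1 + Real.log Λ) * δ
        + (8 * M * truncLipConst p * (1 + Real.log Λ) + D.CA * (1 + Real.log Λ)) * δ := by
        refine add_le_add ?_ ?_
        · calc 3 * ballVol * (1 / Λ) * (Λ * δ * D.velocityVol p M t)
              = 3 * ballVol * D.velocityVol p M t * 1 * δ := by field_simp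
            _ ≤ _ := by gcongr; linarith
        · gcongr
          · exact le_mul_of_one_le_right D.CA_nonneg (by linarith)
          · exact le_add_of_nonneg_right hε.le
    _ = D.logLipConst p M t * (1 + Real.log Λ) * δ := by
        rw [DataBounds.logLipConst]
        ring

lemma abs_rho_sub_le (h : IsDominatedSolution F f₀ A p M t T f) (D : DataBounds F f₀ A)
    (hτ : τ ∈ Icc 0 t) (y y' : Space3) :
    |rho F f τ y' - rho F f τ y| ≤ D.rhoLipConst p M t * ‖y' - y‖ := by
  refine (h.isSolution.abs_rho_sub_le D.continuous_background (h.background_eq_zero D)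
    (h.mem_Ico hτ) (h.eq_zero D hτ)
    (η := transportLipConst D.L₀ (D.logLipConst p M t) t * ‖y' - y‖) fun v _ => ?_).trans_eq ?_
  · simpa [Prod.norm_def] using (h.isTransported D).abs_sub_le D.one_le_L₀ D.abs_initial_sub_le
      D.abs_initial_le (D.logLipConst_nonneg h.three_lt h.nonneg t)
      (fun ε hε => h.isLogLipschitzForce D hε) hτ y v y' v
  · rw [DataBounds.rhoLipConst, DataBounds.velocityVol]
    ring

lemma norm_force_sub_le_R_rpow (h : IsDominatedSolution F f₀ A p M t T f)
    (D : DataBounds F f₀ A) (hτ : τ ∈ Icc 0 t) (hy : y ∈ closedBall x (R x / 8))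
    (hy' : y' ∈ closedBall x (R x / 8)) :
    ‖force F f A τ y' - force F f A τ y‖
      ≤ D.forceLipConst p M t * R x ^ (-3 : ℝ) * ‖y' - y‖ := by
  have hRx := R_pos x
  have hball : closedBall x (R x / 8) ⊆ closedBall x (R x / 2) :=
    closedBall_subset_closedBall (by linarith)
  have hext := D.norm_external_sub_le_R_rpow hτ.1 (hball hy) (hball hy')
  rw [mem_closedBall_iff_norm'] at hy hy'
  have hyy' : ‖y - y'‖ ≤ R y / 2 := by
    have htri : ‖y - y'‖ ≤ ‖x - y‖ + ‖x - y'‖ := by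
      simpa using norm_sub_le (x - y') (x - y) |>.trans_eq (add_comm _ _)
    linarith [R_le_R_add_norm_sub x y]
  have hRy : R y ^ (-3 : ℝ) ≤ 8 * R x ^ (-3 : ℝ) :=
    (R_rpow_neg_le_of_norm_sub_le (x := x) (y := y) (by norm_num) (by linarith)).trans_eq
      (by norm_num)
  have hΛ := D.rhoLipConst_nonneg p M t
  have := lipConst_nonneg h.three_lt
  have := h.nonneg
  calc ‖force F f A τ y' - force F f A τ y‖
      ≤ ‖field (rho F f τ) y' - field (rho F f τ) y‖ + ‖A τ y' - A τ y‖ := by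
        rw [force, force, add_sub_add_comm]
        exact norm_add_le _ _
    _ ≤ lipConst p * (M + D.rhoLipConst p M t) * R y ^ (-3 : ℝ) * ‖y' - y‖
        + 8 * D.CA * R x ^ (-3 : ℝ) * ‖y' - y‖ :=
        add_le_add ((h.isDominated_rho D hτ).norm_field_sub_le_R_rpow hΛ
          (h.abs_rho_sub_le D hτ) hyy') hext
    _ ≤ lipConst p * (M + D.rhoLipConst p M t) * (8 * R x ^ (-3 : ℝ)) * ‖y' - y‖
        + 8 * D.CA * R x ^ (-3 : ℝ) * ‖y' - y‖ := by gcongr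
    _ = D.forceLipConst p M t * R x ^ (-3 : ℝ) * ‖y' - y‖ := by
        rw [DataBounds.forceLipConst]
        ring

lemma tendsto_divQuot_force (h : IsDominatedSolution F f₀ A p M t T f) (D : DataBounds F f₀ A)
    (hτ : τ ∈ Icc 0 t) (y : Space3) :
    Tendsto (divQuot (force F f A τ) y) (𝓝[≠] 0) (𝓝 (3 * ballVol * rho F f τ y)) := by
  have hfield := (h.isDominated_rho D hτ).tendsto_divQuot_field (x := y)
    (D.rhoLipConst_nonneg p M t) fun z _ z' _ => h.abs_rho_sub_le D hτ z z'
  refine (add_zero (3 * ballVol * rho F f τ y) ▸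
    hfield.add (D.tendsto_divQuot_external hτ.1 y)).congr fun η => ?_
  exact (divQuot_add _ _ y η).symm

end IsDominatedSolution

end DominatedSolution

section FarField

variable {F : Space3 → ℝ} {f₀ : Space3 → Space3 → ℝ} {A : ℝ → Space3 → Space3}
  {p M t T s : ℝ} {f : ℝ → Space3 → Space3 → ℝ} {x y : Space3} {X V : Space3 → ℝ → Space3}

lemma mul_R_rpow_neg_three_le_one {c : ℝ} (h : c ≤ R x) : c * R x ^ (-3 : ℝ) ≤ 1 :=
  calc c * R x ^ (-3 : ℝ) ≤ R x ^ (1 : ℝ) * R x ^ (-3 : ℝ) := by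
        rw [Real.rpow_one]
        exact mul_le_mul_of_nonneg_right h (R_rpow_pos x _).le
    _ = R x ^ (-2 : ℝ) := by
        rw [← Real.rpow_add (R_pos x)]
        norm_num
    _ ≤ 1 := R_rpow_neg_le_one x (by norm_num)

namespace DataBounds

/-- The radius of the ball of velocities `v` for which the characteristics through `(x, v)` are
followed back to time `0`; every velocity in the support of `F` is reached from this ball. -/
def fanRadius (D : DataBounds F f₀ A) (p M t : ℝ) : ℝ := 2 * D.velocityBound p M t + 1

/-- The volume of the ball of radius `fanRadius`. -/
def fanVol (D : DataBounds F f₀ A) (p M t : ℝ) : ℝ :=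
  volume.real (ball (0 : Space3) (D.fanRadius p M t))

/-- A radius `R₀` such that the characteristics through `x` with `R(x) ≥ R₀` stay in the region
where `f₀ = F` and where the total force has a small Lipschitz constant. -/
def farRadius (D : DataBounds F f₀ A) (p M t : ℝ) : ℝ :=
  max (max (16 * ((D.fanRadius p M t + D.forceBound p M * t) * t)) (2 * (D.N + 1)))
    (max (D.forceLipConst p M t) (2 * D.forceLipConst p M t * t * Real.exp (3 * t)))

/-- The coefficient of `R⁻⁶` in the bound for the density far from the origin. -/
def farCoeff (D : DataBounds F f₀ A) (p M t : ℝ) : ℝ :=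
  3 * (D.forceLipConst p M t ^ 2 * t ^ 3 * Real.exp (3 * t))
    + 12 * (D.forceLipConst p M t * t * Real.exp (3 * t)) ^ 2

lemma lt_norm_of_mem_closedBall (D : DataBounds F f₀ A) (hx : D.farRadius p M t ≤ R x)
    (hy : y ∈ closedBall x (R x / 16)) : D.N < ‖y‖ := by
  have hN : 2 * (D.N + 1) ≤ R x := ((le_max_right _ _).trans (le_max_left _ _)).trans hx
  rw [mem_closedBall_iff_norm'] at hy
  linarith [R_le_one_add_norm x, norm_le_norm_add_norm_sub' x y, D.N_nonneg]

lemma forceLipConst_mul_R_rpow_le_one (D : DataBounds F f₀ A) (hx : D.farRadius p M t ≤ R x) :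
    D.forceLipConst p M t * R x ^ (-3 : ℝ) ≤ 1 :=
  mul_R_rpow_neg_three_le_one (((le_max_left _ _).trans (le_max_right _ _)).trans hx)

lemma forceLipConst_mul_R_rpow_mul_exp_le_half (D : DataBounds F f₀ A) (hp : 3 < p) (hM : 0 ≤ M)
    (hs : s ∈ Icc 0 t) (hx : D.farRadius p M t ≤ R x) :
    D.forceLipConst p M t * R x ^ (-3 : ℝ) * s * Real.exp (3 * s) ≤ 1 / 2 := by
  have hL := D.forceLipConst_nonneg hp hM t
  have hR := R_rpow_pos x (-3)
  have hfar : 2 * D.forceLipConst p M t * t * Real.exp (3 * t) * R x ^ (-3 : ℝ) ≤ 1 :=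
    mul_R_rpow_neg_three_le_one (((le_max_right _ _).trans (le_max_right _ _)).trans hx)
  calc D.forceLipConst p M t * R x ^ (-3 : ℝ) * s * Real.exp (3 * s)
      ≤ D.forceLipConst p M t * R x ^ (-3 : ℝ) * t * Real.exp (3 * t) := by
        gcongr
        exacts [mul_nonneg (mul_nonneg hL hR.le) (hs.1.trans hs.2), hs.2, hs.2]
    _ ≤ 1 / 2 := by linarith

lemma farCoeff_nonneg (D : DataBounds F f₀ A) (p M : ℝ) (ht : 0 ≤ t) : 0 ≤ D.farCoeff p M t := by
  unfold farCoeff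
  positivity

lemma farError_le (D : DataBounds F f₀ A) (hp : 3 < p) (hM : 0 ≤ M) (hs : s ∈ Icc 0 t)
    (x : Space3) :
    3 * ((D.forceLipConst p M t * R x ^ (-3 : ℝ)) ^ 2 * s ^ 3 * Real.exp (3 * s))
        + 12 * (D.forceLipConst p M t * R x ^ (-3 : ℝ) * s * Real.exp (3 * s)) ^ 2
      ≤ D.farCoeff p M t * R x ^ (-6 : ℝ) := by
  have hL := D.forceLipConst_nonneg hp hM t
  have hR := R_rpow_pos x (-3)
  have hs₀ := hs.1
  have hst := hs.2
  have ht := hs₀.trans hst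
  calc _ ≤ 3 * ((D.forceLipConst p M t * R x ^ (-3 : ℝ)) ^ 2 * t ^ 3 * Real.exp (3 * t))
        + 12 * (D.forceLipConst p M t * R x ^ (-3 : ℝ) * t * Real.exp (3 * t)) ^ 2 := by gcongr
    _ = D.farCoeff p M t * (R x ^ (-3 : ℝ)) ^ 2 := by
        rw [farCoeff]
        ring
    _ = D.farCoeff p M t * R x ^ (-6 : ℝ) := by
        rw [← Real.rpow_mul_natCast (R_pos x).le]
        norm_num

end DataBounds

namespace IsDominatedSolution

lemma exists_isCharacteristicFan (h : IsDominatedSolution F f₀ A p M t T f)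
    (D : DataBounds F f₀ A) (hs : s ∈ Icc 0 t) (hx : D.farRadius p M t ≤ R x) :
    ∃ X V, IsCharacteristicFan (force F f A) s (D.forceLipConst p M t * R x ^ (-3 : ℝ))
      (R x / 16) (D.fanRadius p M t) x X V := by
  choose X V hXV using h.exists_isCharacteristic D hs x
  have hIcc : Icc 0 s ⊆ Icc 0 t := Icc_subset_Icc_right hs.2
  have hball : closedBall x (2 * (R x / 16)) ⊆ closedBall x (R x / 8) :=
    closedBall_subset_closedBall (by linarith)
  have hRx := R_pos x
  refine ⟨X, V, hs.1, by positivity, mul_nonneg (D.forceLipConst_nonneg h.three_lt h.nonneg t)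
    (R_rpow_pos x _).le, D.forceLipConst_mul_R_rpow_le_one hx, fun w _ => hXV w,
    fun w hw τ hτ => ?_, (h.continuousOn_force D).mono (prod_mono hIcc subset_rfl),
    fun τ hτ y hy y' hy' => h.norm_force_sub_le_R_rpow D (hIcc hτ) (hball hy)
      (hball hy')⟩
  have hshift : 16 * ((D.fanRadius p M t + D.forceBound p M * t) * t) ≤ R x :=
    ((le_max_left _ _).trans (le_max_left _ _)).trans hx
  have hK := D.forceBound_nonneg p h.nonneg
  have hs₀ := hs.1
  have hst := hs.2
  have ht := h.time_nonneg
  rw [mem_ball_zero_iff] at hw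
  have hQ := (norm_nonneg w).trans hw.le
  rw [mem_closedBall_iff_norm]
  calc ‖X w τ - x‖ ≤ (‖w‖ + D.forceBound p M * s) * s :=
        (hXV w).norm_position_sub_le (fun σ hσ => h.norm_force_le D (hIcc hσ)) hτ
    _ ≤ (D.fanRadius p M t + D.forceBound p M * t) * t := by gcongr
    _ ≤ R x / 16 := by linarith

lemma rho_eq_setIntegral_sub_comp (h : IsDominatedSolution F f₀ A p M t T f)
    (D : DataBounds F f₀ A) (hs : s ∈ Icc 0 t) (hx : D.farRadius p M t ≤ R x) {k : ℝ}
    (hX : IsCharacteristicFan (force F f A) s k (R x / 16) (D.fanRadius p M t) x X V) :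
    rho F f s x = ∫ v in ball 0 (D.fanRadius p M t), (F v - F (V v 0)) := by
  have hQ : ∀ v ∉ ball (0 : Space3) (D.fanRadius p M t), D.velocityBound p M t < ‖v‖ :=
    fun v hv => by
      rw [mem_ball_zero_iff, not_lt, DataBounds.fanRadius] at hv
      linarith [D.W_nonneg, D.W_le_velocityBound p h.nonneg h.time_nonneg]
  rw [rho_eq_setIntegral (fun v hv => h.background_eq_zero D v (hQ v hv))
    fun v hv => h.eq_zero D hs x v (hQ v hv)]
  refine setIntegral_congr_fun measurableSet_ball fun v hv => ?_
  rw [h.isSolution.eq_initial (h.mem_Ico hs) (hX.isCharacteristic v hv),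
    D.initial_eq_background _ _
      (D.lt_norm_of_mem_closedBall hx (hX.position_mem v hv 0 ⟨le_rfl, hs.1⟩))]

lemma two_mul_add_lt_fanRadius (h : IsDominatedSolution F f₀ A p M t T f)
    (D : DataBounds F f₀ A) (hs : s ∈ Icc 0 t) {k : ℝ}
    (hX : IsCharacteristicFan (force F f A) s k (R x / 16) (D.fanRadius p M t) x X V) :
    2 * (D.W + ‖V 0 0‖) < D.fanRadius p M t := by
  have hV : ‖V 0 0 - 0‖ ≤ D.forceBound p M * s :=
    (hX.isCharacteristic 0 (mem_ball_self (by
      rw [DataBounds.fanRadius]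
      linarith [D.W_nonneg, D.W_le_velocityBound p h.nonneg h.time_nonneg]))).norm_velocity_sub_le
      (fun σ hσ => h.norm_force_le D ⟨hσ.1, hσ.2.trans hs.2⟩) ⟨le_rfl, hs.1⟩
  have hKs := mul_le_mul_of_nonneg_left hs.2 (D.forceBound_nonneg p h.nonneg)
  rw [sub_zero] at hV
  rw [DataBounds.fanRadius, DataBounds.velocityBound]
  linarith

lemma abs_rho_le_of_farRadius_le (h : IsDominatedSolution F f₀ A p M t T f)
    (D : DataBounds F f₀ A) (hs : s ∈ Icc 0 t) (hx : D.farRadius p M t ≤ R x) {r : ℝ → ℝ}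
    (hr : Continuous r)
    (hρ : ∀ τ ∈ Icc 0 s, ∀ y ∈ closedBall x (R x / 16), |rho F f τ y| ≤ r τ) :
    |rho F f s x| ≤ D.BF * D.fanVol p M t
      * (D.farCoeff p M t * R x ^ (-6 : ℝ) + 3 * ballVol * t * ∫ τ in 0..s, r τ) := by
  obtain ⟨X, V, hX⟩ := h.exists_isCharacteristicFan D hs hx
  have hfan := hX.abs_setIntegral_sub_comp_velocity_zero_le
    (D.forceLipConst_mul_R_rpow_mul_exp_le_half h.three_lt h.nonneg hs hx)
    D.continuous_background D.W_nonneg D.background_eq_zero D.abs_background_le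
    (h.two_mul_add_lt_fanRadius D hs hX) (ℓ := fun τ y => 3 * ballVol * rho F f τ y)
    (b := fun τ => 3 * ballVol * r τ)
    (fun τ hτ y _ => h.tendsto_divQuot_force D ⟨hτ.1, hτ.2.trans hs.2⟩ y)
    (fun τ hτ y hy => by
      rw [abs_mul, abs_of_nonneg (mul_nonneg zero_le_three ballVol_nonneg)]
      exact mul_le_mul_of_nonneg_left (hρ τ hτ y hy) (mul_nonneg zero_le_three ballVol_nonneg))
    (hr.const_mul _)
  rw [← h.rho_eq_setIntegral_sub_comp D hs hx hX, intervalIntegral.integral_const_mul] at hfan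
  have hr₀ : 0 ≤ ∫ τ in 0..s, r τ := intervalIntegral.integral_nonneg hs.1 fun τ hτ =>
    (abs_nonneg _).trans (hρ τ hτ x (mem_closedBall_self (by linarith [R_pos x])))
  have herror := D.farError_le h.three_lt h.nonneg hs x
  have htime : s * (3 * ballVol * ∫ τ in 0..s, r τ) ≤ t * (3 * ballVol * ∫ τ in 0..s, r τ) :=
    mul_le_mul_of_nonneg_right hs.2
      (mul_nonneg (mul_nonneg zero_le_three ballVol_nonneg) hr₀)
  refine hfan.trans ?_
  rw [mul_right_comm]
  exact mul_le_mul_of_nonneg_left (by linarith) (mul_nonneg D.BF_nonneg measureReal_nonneg)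

end IsDominatedSolution

end FarField

section Volterra

variable {α : Type*} {u : ℝ → α → ℝ} {w : α → ℝ} {a b B t : ℝ}

lemma mul_integral_exp_mul_le_half (hb : 0 ≤ b) (s : ℝ) :
    b * ∫ τ in 0..s, Real.exp (2 * (b + 1) * τ) ≤ Real.exp (2 * (b + 1) * s) / 2 := by
  have hc : 0 < 2 * (b + 1) := by positivity
  rw [intervalIntegral.integral_comp_mul_left _ hc.ne', integral_exp, smul_eq_mul, mul_zero,
    Real.exp_zero]
  have hhalf : b * (2 * (b + 1))⁻¹ ≤ 1 / 2 := by
    rw [← div_eq_mul_inv, div_le_div_iff₀ hc two_pos]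
    linarith
  calc b * ((2 * (b + 1))⁻¹ * (Real.exp (2 * (b + 1) * s) - 1))
      = b * (2 * (b + 1))⁻¹ * (Real.exp (2 * (b + 1) * s) - 1) := (mul_assoc _ _ _).symm
    _ ≤ b * (2 * (b + 1))⁻¹ * Real.exp (2 * (b + 1) * s) :=
        mul_le_mul_of_nonneg_left (sub_le_self _ zero_le_one) (by positivity)
    _ ≤ 1 / 2 * Real.exp (2 * (b + 1) * s) :=
        mul_le_mul_of_nonneg_right hhalf (Real.exp_nonneg _)
    _ = Real.exp (2 * (b + 1) * s) / 2 := one_div_mul_eq_div _ _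

theorem le_mul_exp_of_le_integral (ha : 0 ≤ a) (hb : 0 ≤ b) (hw : ∀ x, 0 ≤ w x)
    (hu : ∀ s ∈ Icc 0 t, ∀ x, u s x ≤ B * w x)
    (hstep : ∀ r : ℝ → ℝ, Continuous r → (∀ τ ∈ Icc 0 t, ∀ y, u τ y ≤ r τ * w y) →
      ∀ s ∈ Icc 0 t, ∀ x, u s x ≤ (a + b * ∫ τ in 0..s, r τ) * w x) :
    ∀ s ∈ Icc 0 t, ∀ x, u s x ≤ 2 * a * Real.exp (2 * (b + 1) * s) * w x := by
  have hexp {s : ℝ} (hs : s ∈ Icc 0 t) : 1 ≤ Real.exp (2 * (b + 1) * s) :=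
    Real.one_le_exp (mul_nonneg (by positivity) hs.1)
  refine two_mul_mem_of_isClosed_of_halving
    (S := {m | ∀ s ∈ Icc 0 t, ∀ x, u s x ≤ m * Real.exp (2 * (b + 1) * s) * w x}) ?_ ha
    (le_max_left (2 * a) B) (fun s hs x => (hu s hs x).trans ?_) fun m hm hm₀ s hs x => ?_
  · simp only [ofPred_forall]
    exact isClosed_biInter fun s _ => isClosed_iInter fun x =>
      isClosed_le (by fun_prop) (by fun_prop)
  · refine mul_le_mul_of_nonneg_right ?_ (hw x)
    exact (le_max_right (2 * a) B).trans
      (le_mul_of_one_le_right (le_max_of_le_left (by positivity)) (hexp hs))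
  · refine (hstep _ (by fun_prop) hm s hs x).trans (mul_le_mul_of_nonneg_right ?_ (hw x))
    calc a + b * ∫ τ in 0..s, m * Real.exp (2 * (b + 1) * τ)
        = a + m * (b * ∫ τ in 0..s, Real.exp (2 * (b + 1) * τ)) := by
          rw [intervalIntegral.integral_const_mul]
          ring
      _ ≤ a * Real.exp (2 * (b + 1) * s) + m * (Real.exp (2 * (b + 1) * s) / 2) :=
          add_le_add (le_mul_of_one_le_right ha (hexp hs))
            (mul_le_mul_of_nonneg_left (mul_integral_exp_mul_le_half hb s) hm₀)
      _ = (a + m / 2) * Real.exp (2 * (b + 1) * s) := by ring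

end Volterra

section Decay

variable {F : Space3 → ℝ} {f₀ : Space3 → Space3 → ℝ} {A : ℝ → Space3 → Space3}
  {p M t T s ε : ℝ} {f : ℝ → Space3 → Space3 → ℝ} {x y : Space3}

/-- The weight `R⁻⁶ + ε R⁻ᵖ`: a density bounded by a multiple of `R⁻ᵖ` is bounded by a multiple of
this weight, which tends to `R⁻⁶` as `ε → 0`. -/
def mixedWeight (p ε : ℝ) (x : Space3) : ℝ := R x ^ (-6 : ℝ) + ε * R x ^ (-p)

lemma mixedWeight_pos (p : ℝ) (hε : 0 ≤ ε) (x : Space3) : 0 < mixedWeight p ε x :=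
  add_pos_of_pos_of_nonneg (R_rpow_pos x _) (mul_nonneg hε (R_rpow_pos x _).le)

lemma R_rpow_neg_six_le_mixedWeight (p : ℝ) (hε : 0 ≤ ε) (x : Space3) :
    R x ^ (-6 : ℝ) ≤ mixedWeight p ε x :=
  le_add_of_nonneg_right (mul_nonneg hε (R_rpow_pos x _).le)

lemma mixedWeight_le_of_norm_sub_le (hp : 0 ≤ p) (hε : 0 ≤ ε) (h : ‖x - y‖ ≤ R x / 2) :
    mixedWeight p ε y ≤ (2 ^ 6 + 2 ^ p) * mixedWeight p ε x := by
  have hsix : R y ^ (-6 : ℝ) ≤ 2 ^ 6 * R x ^ (-6 : ℝ) :=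
    (R_rpow_neg_le_of_norm_sub_le (by norm_num) h).trans_eq (by norm_num)
  have hRp := R_rpow_pos x (-p)
  have hR6 := R_rpow_pos x (-6)
  calc mixedWeight p ε y ≤ 2 ^ 6 * R x ^ (-6 : ℝ) + ε * (2 ^ p * R x ^ (-p)) :=
        add_le_add hsix (mul_le_mul_of_nonneg_left (R_rpow_neg_le_of_norm_sub_le hp h) hε)
    _ ≤ 2 ^ 6 * R x ^ (-6 : ℝ) + ε * (2 ^ p * R x ^ (-p))
        + (2 ^ p * R x ^ (-6 : ℝ) + 2 ^ 6 * (ε * R x ^ (-p))) :=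
        le_add_of_nonneg_right (by positivity)
    _ = (2 ^ 6 + 2 ^ p) * mixedWeight p ε x := by
        rw [mixedWeight]
        ring

namespace DataBounds

/-- The coefficient of `R⁻⁶` in the Volterra inequality for the density. -/
def volterraCoeff (D : DataBounds F f₀ A) (p M t : ℝ) : ℝ :=
  M * D.farRadius p M t ^ 6 + D.BF * D.fanVol p M t * D.farCoeff p M t

/-- The coefficient of the time integral in the Volterra inequality for the density. -/
def volterraRate (D : DataBounds F f₀ A) (p M t : ℝ) : ℝ :=
  D.BF * D.fanVol p M t * (3 * ballVol * t * (2 ^ 6 + 2 ^ p))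

/-- A constant `C` with `|ρ(t)| ≤ C R⁻⁶` whenever `|ρ| ≤ M R⁻ᵖ` up to time `t`. -/
def decayConst (D : DataBounds F f₀ A) (p M t : ℝ) : ℝ :=
  2 * D.volterraCoeff p M t * Real.exp (2 * (D.volterraRate p M t + 1) * t)

lemma volterraCoeff_nonneg (D : DataBounds F f₀ A) (p : ℝ) (hM : 0 ≤ M) (ht : 0 ≤ t) :
    0 ≤ D.volterraCoeff p M t := by
  have := D.BF_nonneg
  have := D.farCoeff_nonneg p M ht
  have : 0 ≤ D.fanVol p M t := measureReal_nonneg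
  have : 0 ≤ D.farRadius p M t ^ 6 := Even.pow_nonneg (by decide) _
  unfold volterraCoeff
  positivity

lemma volterraRate_nonneg (D : DataBounds F f₀ A) (p M : ℝ) (ht : 0 ≤ t) :
    0 ≤ D.volterraRate p M t := by
  have := D.BF_nonneg
  have := ballVol_nonneg
  have : 0 ≤ D.fanVol p M t := measureReal_nonneg
  unfold volterraRate
  positivity

end DataBounds

namespace IsDominatedSolution

lemma abs_rho_le_of_lt_farRadius (h : IsDominatedSolution F f₀ A p M t T f)
    (D : DataBounds F f₀ A) (hs : s ∈ Icc 0 t) (hx : R x < D.farRadius p M t) :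
    |rho F f s x| ≤ M * D.farRadius p M t ^ 6 * R x ^ (-6 : ℝ) := by
  have hR := R_pos x
  have hone : 1 ≤ D.farRadius p M t ^ 6 * R x ^ (-6 : ℝ) := by
    rw [Real.rpow_neg hR.le, ← div_eq_mul_inv, one_le_div (Real.rpow_pos_of_pos hR 6)]
    exact_mod_cast pow_le_pow_left₀ hR.le hx.le 6
  calc |rho F f s x| ≤ M * R x ^ (-p) := h.abs_rho_le s hs x
    _ ≤ M * (D.farRadius p M t ^ 6 * R x ^ (-6 : ℝ)) := mul_le_mul_of_nonneg_left
        ((R_rpow_neg_le_one x (by linarith [h.three_lt])).trans hone) h.nonneg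
    _ = _ := (mul_assoc _ _ _).symm

lemma abs_rho_le_integral_of_farRadius_le (h : IsDominatedSolution F f₀ A p M t T f)
    (D : DataBounds F f₀ A) (hε : 0 ≤ ε) {r : ℝ → ℝ} (hr : Continuous r)
    (hr₀ : ∀ τ ∈ Icc 0 t, 0 ≤ r τ)
    (hρ : ∀ τ ∈ Icc 0 t, ∀ y, |rho F f τ y| ≤ r τ * mixedWeight p ε y) (hs : s ∈ Icc 0 t)
    (hx : D.farRadius p M t ≤ R x) :
    |rho F f s x| ≤ (D.BF * D.fanVol p M t * D.farCoeff p M t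
      + D.volterraRate p M t * ∫ τ in 0..s, r τ) * mixedWeight p ε x := by
  have hBV : 0 ≤ D.BF * D.fanVol p M t := mul_nonneg D.BF_nonneg measureReal_nonneg
  have hfar₀ := D.farCoeff_nonneg p M h.time_nonneg
  have hnear : ∀ τ ∈ Icc 0 s, ∀ y ∈ closedBall x (R x / 16),
      |rho F f τ y| ≤ (2 ^ 6 + 2 ^ p) * mixedWeight p ε x * r τ := fun τ hτ y hy => by
    have hτt : τ ∈ Icc 0 t := ⟨hτ.1, hτ.2.trans hs.2⟩
    rw [mem_closedBall_iff_norm'] at hy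
    rw [mul_comm]
    exact (hρ τ hτt y).trans (mul_le_mul_of_nonneg_left (mixedWeight_le_of_norm_sub_le
      (by linarith [h.three_lt]) hε (by linarith [R_pos x])) (hr₀ τ hτt))
  calc |rho F f s x|
      ≤ D.BF * D.fanVol p M t * (D.farCoeff p M t * R x ^ (-6 : ℝ) + 3 * ballVol * t
        * ∫ τ in 0..s, (2 ^ 6 + 2 ^ p) * mixedWeight p ε x * r τ) :=
        h.abs_rho_le_of_farRadius_le D hs hx (hr.const_mul _) hnear
    _ ≤ D.BF * D.fanVol p M t * (D.farCoeff p M t * mixedWeight p ε x + 3 * ballVol * t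
        * ∫ τ in 0..s, (2 ^ 6 + 2 ^ p) * mixedWeight p ε x * r τ) := by
        gcongr
        exact R_rpow_neg_six_le_mixedWeight p hε x
    _ = _ := by
        rw [intervalIntegral.integral_const_mul, DataBounds.volterraRate]
        ring

lemma abs_rho_le_integral_mul_mixedWeight (h : IsDominatedSolution F f₀ A p M t T f)
    (D : DataBounds F f₀ A) (hε : 0 ≤ ε) {r : ℝ → ℝ} (hr : Continuous r)
    (hρ : ∀ τ ∈ Icc 0 t, ∀ y, |rho F f τ y| ≤ r τ * mixedWeight p ε y) (hs : s ∈ Icc 0 t)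
    (x : Space3) :
    |rho F f s x| ≤ (D.volterraCoeff p M t + D.volterraRate p M t * ∫ τ in 0..s, r τ)
      * mixedWeight p ε x := by
  have hw := mixedWeight_pos p hε x
  have hr₀ (τ) (hτ : τ ∈ Icc 0 t) : 0 ≤ r τ :=
    nonneg_of_mul_nonneg_left ((abs_nonneg _).trans (hρ τ hτ x)) hw
  have hint : 0 ≤ D.volterraRate p M t * ∫ τ in 0..s, r τ :=
    mul_nonneg (D.volterraRate_nonneg p M h.time_nonneg)
      (intervalIntegral.integral_nonneg hs.1 fun τ hτ => hr₀ τ ⟨hτ.1, hτ.2.trans hs.2⟩)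
  have hnear₀ : 0 ≤ M * D.farRadius p M t ^ 6 :=
    mul_nonneg h.nonneg (Even.pow_nonneg (by decide) _)
  have hfar₀ : 0 ≤ D.BF * D.fanVol p M t * D.farCoeff p M t :=
    mul_nonneg (mul_nonneg D.BF_nonneg measureReal_nonneg) (D.farCoeff_nonneg p M h.time_nonneg)
  rw [DataBounds.volterraCoeff]
  rcases lt_or_ge (R x) (D.farRadius p M t) with hx | hx
  · calc |rho F f s x| ≤ M * D.farRadius p M t ^ 6 * R x ^ (-6 : ℝ) :=
          h.abs_rho_le_of_lt_farRadius D hs hx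
      _ ≤ M * D.farRadius p M t ^ 6 * mixedWeight p ε x :=
          mul_le_mul_of_nonneg_left (R_rpow_neg_six_le_mixedWeight p hε x) hnear₀
      _ ≤ _ := mul_le_mul_of_nonneg_right (by linarith) hw.le
  · exact (h.abs_rho_le_integral_of_farRadius_le D hε hr hr₀ hρ hs hx).trans
      (mul_le_mul_of_nonneg_right (by linarith) hw.le)

theorem abs_rho_le_decayConst_mul (h : IsDominatedSolution F f₀ A p M t T f)
    (D : DataBounds F f₀ A) (x : Space3) :
    |rho F f t x| ≤ D.decayConst p M t * R x ^ (-6 : ℝ) := by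
  refine le_of_forall_pos_le_add_mul (c := D.decayConst p M t * R x ^ (-p)) fun ε hε => ?_
  have hM := h.nonneg
  have hu (s) (hs : s ∈ Icc 0 t) (y : Space3) : |rho F f s y| ≤ M / ε * mixedWeight p ε y :=
    calc |rho F f s y| ≤ M * R y ^ (-p) := h.abs_rho_le s hs y
      _ = M / ε * (ε * R y ^ (-p)) := by field_simp
      _ ≤ M / ε * mixedWeight p ε y := mul_le_mul_of_nonneg_left
          (le_add_of_nonneg_left (R_rpow_pos y _).le) (by positivity)
  have hvolterra := le_mul_exp_of_le_integral (u := fun s y => |rho F f s y|)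
    (D.volterraCoeff_nonneg p hM h.time_nonneg) (D.volterraRate_nonneg p M h.time_nonneg)
    (fun y => (mixedWeight_pos p hε.le y).le) hu
    (fun r hr hρ s hs y => h.abs_rho_le_integral_mul_mixedWeight D hε.le hr hρ hs y)
    t ⟨h.time_nonneg, le_rfl⟩ x
  exact hvolterra.trans_eq (by rw [DataBounds.decayConst, mixedWeight]; ring)

end IsDominatedSolution

lemma spaceNorm_le_iff {r : ℝ} {σ : Space3 → ℝ} {M : ℝ≥0} :
    spaceNorm r σ ≤ M ↔ ∀ x, |σ x| ≤ M * R x ^ (-r) := by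
  rw [spaceNorm, iSup_le_iff]
  refine forall_congr' fun x => ?_
  rw [ENNReal.ofReal_le_iff_le_toReal ENNReal.coe_ne_top, ENNReal.coe_toReal,
    Real.rpow_neg (R_pos x).le, ← div_eq_mul_inv, le_div_iff₀ (R_rpow_pos x r)]

lemma three_lt_pOf {q : ℝ} (hq : 8 < q) : 3 < pOf q := by
  have : 8 / q < 1 := (div_lt_one (by linarith)).2 hq
  rw [pOf]
  linarith

lemma BackgroundCondition.hasCompactSupport (hF : BackgroundCondition F) :
    HasCompactSupport F := by
  obtain ⟨-, -, FR, hFR, -, W, -, -, hW⟩ := hF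
  refine HasCompactSupport.of_support_subset_isCompact (isCompact_closedBall 0 W) fun v hv =>
    mem_closedBall_zero_iff.2 (not_lt.1 fun h => hv ?_)
  rw [hFR, hW _ h.le]

end Decay

end VlasovPoisson

end

open VlasovPoisson

theorem theorem3_general {p : ℝ} (hp : 3 < p) {F : Space3 → ℝ} (hF : ContDiff ℝ 1 F)
    (hFs : HasCompactSupport F) {f₀ : Space3 → Space3 → ℝ} (hf₀ : InitialCondition F f₀)
    {A : ℝ → Space3 → Space3} (hA : ExternalFieldCondition A) :
    ∃ C : ℝ → ℝ≥0 → ℝ≥0, ∀ (T : ℝ) (f : ℝ → Space3 → Space3 → ℝ), IsSolution F f₀ A T f →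
      ∀ t ∈ Ico 0 T, ∀ M : ℝ≥0, (⨆ τ ∈ Icc 0 t, spaceNorm p (rho F f τ)) ≤ M →
        spaceNorm 6 (rho F f t) ≤ C t M := by
  obtain ⟨D⟩ := nonempty_dataBounds hF hFs hf₀ hA
  refine ⟨fun t M => (D.decayConst p M t).toNNReal, fun T f hS t ht M hM => ?_⟩
  have h : IsDominatedSolution F f₀ A p M t T f := ⟨hS, ht.1, ht.2, hp, fun τ hτ =>
    spaceNorm_le_iff.1
      ((le_iSup₂ (f := fun τ (_ : τ ∈ Icc 0 t) => spaceNorm p (rho F f τ)) τ hτ).trans hM)⟩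
  refine spaceNorm_le_iff.2 fun x => (h.abs_rho_le_decayConst_mul D x).trans ?_
  exact mul_le_mul_of_nonneg_right (Real.le_coe_toNNReal _) (R_rpow_pos x _).le

theorem theorem3 (q : ℝ) (hq : 7 + Real.sqrt 33 < q)
    (F : Space3 → ℝ) (hF : VlasovPoisson.BackgroundCondition F)
    (f₀ : Space3 → Space3 → ℝ) (hf₀ : VlasovPoisson.InitialCondition F f₀)
    (A : ℝ → Space3 → Space3) (hA : VlasovPoisson.ExternalFieldCondition A) :
    ∃ C : ℝ → ℝ≥0 → ℝ≥0,
      ∀ (T : ℝ) (f : ℝ → Space3 → Space3 → ℝ), 0 < T →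
        VlasovPoisson.IsSolution F f₀ A T f →
        (∀ t ∈ Set.Ico 0 T, VlasovPoisson.tripleNorm q (fun x v => F v - f t x v) < ∞) →
        ∀ t ∈ Set.Ico 0 T, ∀ M : ℝ≥0,
          (⨆ τ ∈ Set.Icc 0 t,
            VlasovPoisson.spaceNorm (VlasovPoisson.pOf q) (VlasovPoisson.rho F f τ)) ≤ M →
          VlasovPoisson.spaceNorm 6 (VlasovPoisson.rho F f t) ≤ C t M := by
  have hq8 : 8 < q := by linarith [Real.one_le_sqrt.2 (by norm_num : (1 : ℝ) ≤ 33)]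
  obtain ⟨C, hC⟩ := theorem3_general (three_lt_pOf hq8) (hF.2.1.of_le one_le_two)
    hF.hasCompactSupport hf₀ hA
  exact ⟨C, fun T f _ hS _ => hC T f hS⟩
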